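/- **Setting.** Let $n\ge 3$, $C_0=2^{100n}$, $K=2^{C_0}$. Let $v\in\mathbb R^n$ have non-zero entries with $\sum_i v_i=0$ and $|v_1|\ge\dots\ge|v_n|=1$; put $\Gamma'=\mathbb R v$. For an interval or cube $J$ and $A>0$, $AJ$ has the same center and $A$ times the side length. All intervals are closed. Let $\mathbf Q$ be a finite set of cubes $Q=Q_1\times\dots\times Q_n\subset\mathbb R^n$ with side length $2^{e}$, $e=e_Q\in K\mathbb Z$, and center in $2^{e-10}\mathbb Z^n$, such that $C_0Q$ does not meet the diagonal of $\mathbb R^n$ but $4C_0Q$ does. Assume $\mathbf Q$ is sparse: for $Q,Q'\in\mathbf Q$ and every $i$, $|Q_i|<|Q'_i|$ implies $2^K|Q_i|\le|Q'_i|$; if $|Q_i|=|Q_i'|$ and $Q_i\ne Q'_i$ then $\mathrm{dist}(Q_i,Q_i')\ge 2^K|Q_i|$; and $Q_i=Q_i'$ implies $Q=Q'$. For $Q\in\mathbf Q$ fix intervals $\overline Q_i$ with $1000Q_i\subseteq\overline Q_i\subseteq1020Q_i$ such that, whenever $Q'\in\mathbf Q$ is smaller than $Q$, the convex hull of $\bigcup_j10\overline{Q'}_j$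 is either contained in or disjoint from $\overline Q_i$. *Multi-tiles.* A multi-tile $\vec P$ is a pair of a cube $Q\in\mathbf Q$ and a dyadic interval $I_{\vec P}$ of length $2^{-e_Q}$; its $i$-th tile is $P_i=I_{\vec P}\times\omega_{P_i}$ with $\omega_{P_i}=v_iQ_i$, and $\overline\omega_{P_i}:=\overline Q_i$. Fix $k\in\mathbb Z$ and let $\vec{\mathbf P}_1$ be the (finite) set of multi-tiles with $I_{\vec P}\subseteq[-2^{Kk},2^{Kk}]$. *Trees.* A dyadic interval is $K$-dyadic if its length is $2^{Kj}$ for some $j\in\mathbb Z$. A tree is a triple $(T,\xi,I)$, also denoted $T$, where $T$ is a non-empty set of multi-tiles, $\xi=\xi_T\in\Gamma'$, $I=I_T$ is $K$-dyadic, and each $\vec P\in T$ *fits* $(\xi,I)$: $I_{\vec P}\subseteq I$, and for some $i$ the interval of center $\xi_i/v_i$ (which does not depend on $i$) and length $1000/|I|$ is contained in $\overline\omega_{P_i}$. Two trees are distinct if they have no multi-tile in common. $T$ is maximal in a set $\vec{\mathbf P}$ of multi-tiles if $T$ consists of all elements of $\vec{\mathbf P}$ that fit its top data. A greedy selection process is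 a finite sequence of trees $T_1,T_2,\dots,T_r$ such that each $T_l$ is maximal in $\vec{\mathbf P}_1\setminus(T_1\cup\dots\cup T_{l-1})$. A tree is convex if it is one of the selected trees of some greedy selection process; a set of multi-tiles is convex if it equals $\vec{\mathbf P}_1\setminus(T_1\cup\dots\cup T_r)$ for some greedy selection process $T_1,\dots,T_r$ ($r\ge0$). *Sizes.* Let $N\in\mathbb N$, and $\tilde\chi_I(x)=(1+\mathrm{dist}(x,I)/|I|)^{-1}$. For intervals $I,\omega$, $\zeta\in\mathbb R$ and $g\in L^2(\mathbb R)$ put $$\|g\|_{I\times\omega,\zeta}=\sup_{\mathfrak m}\|\tilde\chi_I^{10}T_{\mathfrak m}g\|_2,$$ where $T_{\mathfrak m}$ is the Fourier multiplier with symbol $\mathfrak m$ and $\mathfrak m:\mathbb R\to\mathbb C$ ranges over the smooth functions supported on $10\omega$ with $|\eta-\zeta|^k|\mathfrak m^{(k)}(\eta)|\le|\eta-\zeta|/|\omega|$ for all $\eta\in\mathbb R$ and $0\le k\le N^2$. For $1\le i\le n$, $f_i\in L^2(\mathbb R)$ and a tree $T$, with $\omega_{i,T}$ the interval of center $(\xi_T)_i$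 and length $|v_i|/|I_T|$, $$\mathrm{size}_i(T)=\Big(\frac1{|I_T|}\sum_{\vec P\in T}\|f_i\|_{P_i,(\xi_T)_i}^2\Big)^{1/2}+|I_T|^{-1/2}\|f_i\|_{I_T\times\omega_{i,T},(\xi_T)_i}.$$ For a sign $\pm$ let $\mathrm{size}_{i,\pm}(T)$ be the same expression with $f_i$ replaced by its Riesz projection to the frequencies $\{\eta:\pm(\eta-(\xi_T)_i)>0\}$. For a set $\vec{\mathbf P}$ of multi-tiles, $\mathrm{size}^*_i(\vec{\mathbf P})$ and $\mathrm{size}^*_{i,\pm}(\vec{\mathbf P})$ are the suprema of $\mathrm{size}_i(T)$ and $\mathrm{size}_{i,\pm}(T)$ over all trees $T\subseteq\vec{\mathbf P}$. **Proposition.** For every $n\ge3$ there is $N_0$ such that for every $N\ge N_0$ there is a constant $C>0$, depending only on $n$ and $N$ (thus not on $v$, $\mathbf Q$, the $\overline Q_i$, $k$, $i$, $f_i$, $m$ or $\vec{\mathbf P}$), with the following property. Let $1\le i\le n$, $f_i\in L^2(\mathbb R)$, $m\in\mathbb Z$, and let $\vec{\mathbf P}$ be a convex set of multi-tiles such that $$\mathrm{size}^*_i(\vec{\mathbf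 P})<\|f_i\|_2\,2^{m/2}.$$ Then there is a finite collection $\mathbf T$ of pairwise distinct convex trees contained in $\vec{\mathbf P}$ such that $$\sum_{T\in\mathbf T}|I_T|\le C\,2^{-m},$$ and such that the remainder $\vec{\mathbf P}'=\vec{\mathbf P}\setminus\bigcup_{T\in\mathbf T}T$ is convex and satisfies $$\mathrm{size}^*_i(\vec{\mathbf P}')<\|f_i\|_2\,2^{(m-1)/2}.$$ The same statement holds, for either sign $\pm$, with $\mathrm{size}^*_i$ replaced by $\mathrm{size}^*_{i,\pm}$ in both the hypothesis and the conclusion. -/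

import Mathlib

open MeasureTheory
open scoped ENNReal FourierTransform

noncomputable section

namespace PhasePlane

/-! ### Constants, intervals, cubes -/

/-- The constant `C₀ = 2 ^ (100 n)` measuring the fineness of the Whitney decomposition. -/
def C0 (n : ℕ) : ℕ := 2 ^ (100 * n)

/-- The constant `K = 2 ^ C₀` measuring the separation of scales. -/
def K (n : ℕ) : ℕ := 2 ^ C0 n

/-- A bounded closed interval of the real line, given by its center and its length. -/
@[ext] structure Ivl where
  ctr : ℝ
  len : ℝ

/-- The set of points of an interval. -/
def Ivl.toSet (J : Ivl) : Set ℝ := Set.Icc (J.ctr - J.len / 2) (J.ctr + J.len / 2)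

/-- `J.dil A` is the interval with the same center as `J` and `A` times its length. -/
def Ivl.dil (A : ℝ) (J : Ivl) : Ivl := ⟨J.ctr, A * J.len⟩

/-- The dyadic interval `[2 ^ exp * pos, 2 ^ exp * (pos + 1)]`. -/
@[ext] structure DyadicIvl where
  exp : ℤ
  pos : ℤ

/-- A dyadic interval as an interval. -/
def DyadicIvl.ivl (I : DyadicIvl) : Ivl := ⟨(2 : ℝ) ^ I.exp * (I.pos + 1 / 2), (2 : ℝ) ^ I.exp⟩

/-- `I` is `K`-dyadic: its length is `2 ^ (K j)` for an integer `j`. -/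
def DyadicIvl.IsKDyadic (n : ℕ) (I : DyadicIvl) : Prop := (K n : ℤ) ∣ I.exp

/-- A cube in `ℝⁿ` with side length `2 ^ exp` whose center is the point `2 ^ (exp - 10) * node` of
the lattice `2 ^ (exp - 10) ℤⁿ`. -/
@[ext] structure Cube (n : ℕ) where
  exp : ℤ
  node : Fin n → ℤ

/-- The `i`-th side of a cube. -/
def Cube.side {n : ℕ} (Q : Cube n) (i : Fin n) : Ivl :=
  ⟨(2 : ℝ) ^ (Q.exp - 10) * Q.node i, (2 : ℝ) ^ Q.exp⟩

/-- The cube `A Q` as a subset of `ℝⁿ`. -/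
def Cube.dilSet {n : ℕ} (A : ℝ) (Q : Cube n) : Set (Fin n → ℝ) :=
  {x | ∀ i, x i ∈ ((Q.side i).dil A).toSet}

/-- The diagonal of `ℝⁿ`. -/
def diagonal (n : ℕ) : Set (Fin n → ℝ) := {x | ∃ t : ℝ, ∀ i, x i = t}

/-- The Whitney conditions with respect to the diagonal. -/
def Cube.IsWhitney {n : ℕ} (Q : Cube n) : Prop :=
  Q.dilSet (C0 n) ∩ diagonal n = ∅ ∧ (Q.dilSet (4 * C0 n) ∩ diagonal n).Nonempty

/-- Sparseness of a collection of cubes. -/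
def IsSparse {n : ℕ} (𝒬 : Set (Cube n)) : Prop :=
  ∀ Q ∈ 𝒬, ∀ Q' ∈ 𝒬, ∀ i,
    ((Q.side i).len < (Q'.side i).len → (2 : ℝ) ^ K n * (Q.side i).len ≤ (Q'.side i).len) ∧
    ((Q.side i).len = (Q'.side i).len → Q.side i ≠ Q'.side i →
      ∀ x ∈ (Q.side i).toSet, ∀ y ∈ (Q'.side i).toSet,
        (2 : ℝ) ^ K n * (Q.side i).len ≤ |x - y|) ∧
    (Q.side i = Q'.side i → Q = Q')

/-- The convex hull of the intervals `10 Q̄ᵢ`, `1 ≤ i ≤ n`. -/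
def hull {n : ℕ} (J : Fin n → Ivl) : Set ℝ := convexHull ℝ (⋃ i, ((J i).dil 10).toSet)

/-- `Qbar` is a choice of slightly enlarged intervals `Q̄ᵢ ⊇ 1000 Qᵢ` (by at most one percent
on either side) such that `Q̄ᵢ` contains or avoids the hull of every cube of smaller scale. -/
def IsEnlargement {n : ℕ} (𝒬 : Set (Cube n)) (Qbar : Cube n → Fin n → Ivl) : Prop :=
  ∀ Q ∈ 𝒬, ∀ i,
    ((Q.side i).dil 1000).toSet ⊆ (Qbar Q i).toSet ∧
    (Qbar Q i).toSet ⊆ ((Q.side i).dil 1020).toSet ∧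
    ∀ Q' ∈ 𝒬, Q'.exp < Q.exp →
      hull (Qbar Q') ⊆ (Qbar Q i).toSet ∨ Disjoint (hull (Qbar Q')) (Qbar Q i).toSet

/-! ### The fixed data: direction, frequency cubes, spatial cutoff -/

/-- The data fixed once and for all: the direction `v` of the line `Γ'`, normalized by
`|v₁| ≥ … ≥ |vₙ| = 1`; the finite sparse collection of Whitney cubes (in the rescaled
frequency space, where `Γ'` becomes the diagonal), with side lengths integral powers of `2 ^ K`;
the enlarged intervals `Q̄ᵢ`; and the exponent `k` of the spatial region `[-2 ^ (K k), 2 ^ (K k)]`. -/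
structure Setting (n : ℕ) where
  v : Fin n → ℝ
  v_ne_zero : ∀ i, v i ≠ 0
  v_sum : ∑ i, v i = 0
  v_antitone : Antitone fun i => |v i|
  v_last : ∀ i : Fin n, (i : ℕ) + 1 = n → |v i| = 1
  cubes : Set (Cube n)
  cubes_finite : cubes.Finite
  cubes_whitney : ∀ Q ∈ cubes, Q.IsWhitney
  cubes_sparse : IsSparse cubes
  cubes_exp : ∀ Q ∈ cubes, (K n : ℤ) ∣ Q.exp
  Qbar : Cube n → Fin n → Ivl
  enlargement : IsEnlargement cubes Qbar
  k : ℤ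

/-! ### Tiles, multi-tiles, trees -/

/-- A tile `I × ω`. -/
structure Tile where
  I : Ivl
  ω : Ivl

/-- A multi-tile is determined by a cube `Q` and by a dyadic interval `I` of length
`2 ^ (-exp)`, the reciprocal of the side length of `Q`. -/
@[ext] structure MultiTile (n : ℕ) where
  cube : Cube n
  pos : ℤ

/-- The spatial interval of a multi-tile. -/
def MultiTile.I {n : ℕ} (P : MultiTile n) : DyadicIvl := ⟨-P.cube.exp, P.pos⟩

namespace Setting

variable {n : ℕ} (S : Setting n)

/-- The `i`-th component of a multi-tile: an `i`-tile, of area `2 ^ Mᵢ = |vᵢ|`, whose frequency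
interval is the `i`-th side `vᵢ Qᵢ` of the box `L(Q)`. -/
def tile (P : MultiTile n) (i : Fin n) : Tile :=
  ⟨P.I.ivl, ⟨S.v i * (P.cube.side i).ctr, |S.v i| * (P.cube.side i).len⟩⟩

theorem tile_area (P : MultiTile n) (i : Fin n) :
    (S.tile P i).I.len * (S.tile P i).ω.len = |S.v i| := by
  simp only [tile, MultiTile.I, DyadicIvl.ivl, Cube.side, zpow_neg]
  have h : (2 : ℝ) ^ P.cube.exp ≠ 0 := zpow_ne_zero _ two_ne_zero
  field_simp

/-- The enlarged frequency interval of the `i`-th component of a multi-tile. -/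
def omegaBarTile (P : MultiTile n) (i : Fin n) : Ivl := S.Qbar P.cube i

/-- The set of all multi-tiles. -/
def P0 : Set (MultiTile n) := {P | P.cube ∈ S.cubes}

/-- The multi-tiles with spatial interval contained in `[-2 ^ (K k), 2 ^ (K k)]`. -/
def P1 : Set (MultiTile n) :=
  {P ∈ S.P0 | P.I.ivl.toSet ⊆
    Set.Icc (-(2 : ℝ) ^ ((K n : ℤ) * S.k)) ((2 : ℝ) ^ ((K n : ℤ) * S.k))}

/-- The line `Γ'` spanned by `v`. -/
def Gamma' : Submodule ℝ (Fin n → ℝ) := Submodule.span ℝ {S.v}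

/-- The interval `[ξᵢ - 2 ^ Mᵢ / (2 |I|), ξᵢ + 2 ^ Mᵢ / (2 |I|)]`. -/
def omegaTop (ξ : Fin n → ℝ) (I : DyadicIvl) (i : Fin n) : Ivl := ⟨ξ i, |S.v i| / I.ivl.len⟩

/-- The interval of points at distance at most `500 / |I|` from `(L⁻¹ ξ)ᵢ = ξᵢ / vᵢ`; for
`ξ ∈ Γ'` it does not depend on `i`. -/
def omegaBarTop (ξ : Fin n → ℝ) (I : DyadicIvl) (i : Fin n) : Ivl :=
  ⟨ξ i / S.v i, 1000 / I.ivl.len⟩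

/-- A multi-tile fits the top data `(ξ, I)`. -/
def Fits (ξ : Fin n → ℝ) (I : DyadicIvl) (P : MultiTile n) : Prop :=
  P.I.ivl.toSet ⊆ I.ivl.toSet ∧
    ∃ i, (S.omegaBarTop ξ I i).toSet ⊆ (S.omegaBarTile P i).toSet

/-- A tree: a non-empty set of multi-tiles together with top data `(ξ, I)`. -/
structure Tree where
  tiles : Set (MultiTile n)
  ξ : Fin n → ℝ
  I : DyadicIvl
  nonempty : tiles.Nonempty
  isMultiTile : tiles ⊆ S.P0
  ξ_mem : ξ ∈ S.Gamma'
  I_kdyadic : I.IsKDyadic n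
  fits : ∀ P ∈ tiles, S.Fits ξ I P

variable {S}

/-- The tree `T` is the maximal tree in `Ps` with its top data. -/
def Tree.IsMaximalIn (T : S.Tree) (Ps : Set (MultiTile n)) : Prop :=
  T.tiles = {P ∈ Ps | S.Fits T.ξ T.I P}

/-- `T 0, …, T (r - 1)` are the selected trees of a greedy tree selection process: each one is
maximal in what its predecessors have left of `P1`. -/
def IsGreedy {r : ℕ} (T : Fin r → S.Tree) : Prop :=
  ∀ k, (T k).IsMaximalIn (S.P1 \ ⋃ j, ⋃ _ : j < k, (T j).tiles)

/-- A tree is convex if it is a selected tree of a greedy selection process. -/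
def Tree.IsConvex (T : S.Tree) : Prop :=
  ∃ (r : ℕ) (U : Fin r → S.Tree), IsGreedy U ∧ ∃ k, U k = T

variable (S)

/-- A set of multi-tiles is convex if it is what a greedy selection process has left of `P1`. -/
def IsConvexSet (Ps : Set (MultiTile n)) : Prop :=
  ∃ (r : ℕ) (U : Fin r → S.Tree), IsGreedy U ∧ Ps = S.P1 \ ⋃ k, (U k).tiles

end Setting

/-! ### Fourier multipliers, phase space norms, sizes -/

/-- The Fourier multiplier operator `T_m` on `L²` with bounded symbol `m`. -/
def multOp (m : ℝ → ℂ) (hm : MemLp m ∞ (volume : Measure ℝ))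
    (f : Lp ℂ 2 (volume : Measure ℝ)) : Lp ℂ 2 (volume : Measure ℝ) :=
  𝓕⁻ ((hm.toLp m • 𝓕 f : Lp ℂ 2 (volume : Measure ℝ)))

/-- The open half-line `{η : ±(η - ξ) > 0}`. -/
def halfLine (σ : ℤˣ) (ξ : ℝ) : Set ℝ := {η | 0 < ((σ : ℤ) : ℝ) * (η - ξ)}

theorem measurableSet_halfLine (σ : ℤˣ) (ξ : ℝ) : MeasurableSet (halfLine σ ξ) :=
  measurableSet_lt measurable_const (by fun_prop)

theorem memLp_halfLine (σ : ℤˣ) (ξ : ℝ) :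
    MemLp ((halfLine σ ξ).indicator fun _ => (1 : ℂ)) ∞ (volume : Measure ℝ) :=
  MemLp.indicator (measurableSet_halfLine σ ξ) (memLp_top_const 1)

/-- The Riesz projection to the half-line `{η : ±(η - ξ) > 0}` in frequency space. -/
def riesz (σ : ℤˣ) (ξ : ℝ) (f : Lp ℂ 2 (volume : Measure ℝ)) : Lp ℂ 2 (volume : Measure ℝ) :=
  multOp ((halfLine σ ξ).indicator fun _ => (1 : ℂ)) (memLp_halfLine σ ξ) f

/-- The symbols of the phase space norms: smooth functions supported on `10 ω` with
`|∂ᵏ m(η)| ≤ |η - ξ| ^ (-k) * |η - ξ| / |ω|` for `0 ≤ k ≤ N²`. The power `|η - ξ| ^ (-k)` is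
moved to the left so that at `η = ξ` the bound says `m(ξ) = 0` and nothing on derivatives. -/
structure IsSymbol (N : ℕ) (ω : Ivl) (ξ : ℝ) (m : ℝ → ℂ) : Prop where
  smooth : ContDiff ℝ ((⊤ : ℕ∞) : WithTop ℕ∞) m
  support : Function.support m ⊆ (ω.dil 10).toSet
  bound : ∀ k ≤ N ^ 2, ∀ η : ℝ, |η - ξ| ^ k * ‖iteratedDeriv k m η‖ ≤ |η - ξ| / ω.len

theorem IsSymbol.memLp {N : ℕ} {ω : Ivl} {ξ : ℝ} {m : ℝ → ℂ} (h : IsSymbol N ω ξ m) :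
    MemLp m ∞ (volume : Measure ℝ) :=
  h.smooth.continuous.memLp_of_hasCompactSupport
    (HasCompactSupport.intro (K := (ω.dil 10).toSet) isCompact_Icc fun x hx => by
      by_contra hne
      exact hx (h.support hne))

/-- The approximate cutoff `(1 + dist(x, I) / |I|)⁻¹`. -/
def cutoff (I : Ivl) (x : ℝ) : ℝ := (1 + Metric.infDist x I.toSet / I.len)⁻¹

/-- The semi-norm `sup_m ‖χ̃_I ^ 10 T_m f‖₂` over the symbols `m` attached to `ω` and `ξ`. -/
def phaseNorm (N : ℕ) (I ω : Ivl) (ξ : ℝ) (f : Lp ℂ 2 (volume : Measure ℝ)) : ℝ≥0∞ :=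
  ⨆ (m : ℝ → ℂ) (hm : IsSymbol N ω ξ m),
    eLpNorm (fun x => (cutoff I x : ℂ) ^ 10 * multOp m hm.memLp f x) 2 (volume : Measure ℝ)

/-- The semi-norm `‖f‖_{P, ξ}` of a tile `P`. -/
def tileNorm (N : ℕ) (P : Tile) (ξ : ℝ) (f : Lp ℂ 2 (volume : Measure ℝ)) : ℝ≥0∞ :=
  phaseNorm N P.I P.ω ξ f

namespace Setting

variable {n : ℕ} {S : Setting n}

/-- The `i`-size of a tree with respect to `f`. -/
def Tree.size (N : ℕ) (i : Fin n) (f : Lp ℂ 2 (volume : Measure ℝ)) (T : S.Tree) : ℝ≥0∞ :=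
  ((ENNReal.ofReal T.I.ivl.len)⁻¹ *
      ∑' P : T.tiles, tileNorm N (S.tile P i) (T.ξ i) f ^ 2) ^ (1 / 2 : ℝ) +
    ENNReal.ofReal T.I.ivl.len ^ (-(1 / 2) : ℝ) *
      phaseNorm N T.I.ivl (S.omegaTop T.ξ T.I i) (T.ξ i) f

/-- The signed `i`-size of a tree: the `i`-size with respect to the Riesz projection of `f` to a
half-line ending at the `i`-th top frequency of the tree. -/
def Tree.sizeSigned (N : ℕ) (i : Fin n) (σ : ℤˣ) (f : Lp ℂ 2 (volume : Measure ℝ))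
    (T : S.Tree) : ℝ≥0∞ :=
  T.size N i (riesz σ (T.ξ i) f)

variable (S)

/-- The maximal `i`-size of a collection of multi-tiles. -/
def maxSize (N : ℕ) (i : Fin n) (f : Lp ℂ 2 (volume : Measure ℝ))
    (Ps : Set (MultiTile n)) : ℝ≥0∞ :=
  ⨆ (T : S.Tree) (_ : T.tiles ⊆ Ps), T.size N i f

/-- The maximal signed `i`-size of a collection of multi-tiles. -/
def maxSizeSigned (N : ℕ) (i : Fin n) (σ : ℤˣ) (f : Lp ℂ 2 (volume : Measure ℝ))
    (Ps : Set (MultiTile n)) : ℝ≥0∞ :=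
  ⨆ (T : S.Tree) (_ : T.tiles ⊆ Ps), T.sizeSigned N i σ f

/-- For a given notion of maximal size: if the maximal size of `Ps` is less than
`A 2 ^ (m / 2)`, then `Ps` contains a finite collection of distinct (that is, without common
multi-tiles) convex trees with total width `∑ |I_T| ≤ C 2 ^ (-m)`, whose removal leaves a convex
set of maximal size less than `A 2 ^ ((m - 1) / 2)`. -/
def TreeSelection (size : Set (MultiTile n) → ℝ≥0∞) (A C : ℝ) (m : ℤ)
    (Ps : Set (MultiTile n)) : Prop :=
  size Ps < ENNReal.ofReal (A * (2 : ℝ) ^ ((m : ℝ) / 2)) →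
    ∃ (r : ℕ) (T : Fin r → S.Tree),
      (∀ l, (T l).IsConvex ∧ (T l).tiles ⊆ Ps) ∧
      (∀ l l', l ≠ l' → Disjoint (T l).tiles (T l').tiles) ∧
      ∑ l, (T l).I.ivl.len ≤ C * (2 : ℝ) ^ (-m) ∧
      S.IsConvexSet (Ps \ ⋃ l, (T l).tiles) ∧
      size (Ps \ ⋃ l, (T l).tiles) < ENNReal.ofReal (A * (2 : ℝ) ^ (((m : ℝ) - 1) / 2))

end Setting

end PhasePlane

end

open PhasePlane

/-! ### Wave packets with kinked symbols and their almost orthogonality. -/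

noncomputable section

namespace PhasePlane

open Complex ComplexConjugate ComplexInnerProductSpace

/-! ### Fourier multipliers on `L²` -/

/-! The heart is a statement with no starting level: from any `X ⊆ P1` and for any `lam > 0`,
finitely many maximal trees of total width `≲ ‖f‖² / lam²` can be peeled off so that the rest has
size at most `lam`. Peeling off maximal trees continues a greedy selection, so convexity of the
trees and of the remainder is automatic (`IsConvexSet.diff`). The unsigned size is at most twice the
sum of the two signed ones (`Tree.size_le`), so it is enough to treat each sign. Halving a signed
size is `exists_peels_half`; iteration sums a geometric series.

For the halving, trees of size above `lam` are picked one after another, each with nearly maximal `σ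
ξᵢ`, and with each one its shadow is removed: all multi-tiles that fit one of finitely many
neighbouring tops. By pigeonholing (`Tree.exists_witness`), a picked tree `T` carries functions `F`,
restrictions of `T_m Π f` (with `Π` the Riesz projection) to the `j`-th translates of the intervals,
either all from multi-tiles or from the top alone, with `∑ ‖F‖² ≳ (1 + |j|) ^ 18 lam² |I_T|`. Picked
trees with the same `j` and the same kind of packets form a class.

Within a class the widths are summed by a `TT*` argument (`PacketFamily.sq_sum_norm_sq_le`): `∑
‖F_p‖²` is the pairing of `f` with a sum of dual functions `T_p`, and `‖∑ T_p‖²` is expanded into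
pairs. The symbols are cut off at the top frequency `ξ`, where they vanish to first order; the
resulting kink still leaves kernels decaying like the power `-3/2` of the distance
(`IsKink.norm_kernel_le`). The pairs, with `q` of smaller spatial scale than `p` or of the same one,
are of three types. Same scale: spatial decay and bounded multiplicity suffice. `q` in the same or
an earlier tree: the order of selection and the one-sided support force `ξ q` to be near the
frequencies of `p`; since the symbol of `q` vanishes at `ξ q`, the pairing gains the ratio of the
scales, and a Schur test applies. `q` in a later tree: had its interval been close to the top
interval of the tree of `p`, it would have been removed with the shadow. Spatial decay is therefore
available, and with the upper bound on single packets (`Tree.eltNorm_le`) these pairs contribute at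
most a constant times `Λ² ∑ |I_T|`.

The lower bound on `∑ ‖F_p‖²` turns the estimate into a bound for the total width of a class, with a
factor `(1 + |j|) ^ (-16)` which pays for the `O(1 + |j|)` tops of each shadow and for the sum over
`j`. -/

theorem fourier_multOp (m : ℝ → ℂ) (hm : MemLp m ∞ (volume : Measure ℝ))
    (f : Lp ℂ 2 (volume : Measure ℝ)) :
    (𝓕 (multOp m hm f) : Lp ℂ 2 (volume : Measure ℝ)) =ᵐ[volume]
      fun η => m η * (𝓕 f : Lp ℂ 2 (volume : Measure ℝ)) η := by
  unfold multOp
  rw [FourierTransform.fourier_fourierInv_eq]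
  filter_upwards [Lp.coeFn_lpSMul (r := 2) (hm.toLp m) (𝓕 f : Lp ℂ 2 (volume : Measure ℝ)),
    hm.coeFn_toLp] with η h1 h2
  rw [h1, Pi.smul_apply', h2, smul_eq_mul]

theorem fourier_L2_injective {f g : Lp ℂ 2 (volume : Measure ℝ)}
    (h : (𝓕 f : Lp ℂ 2 (volume : Measure ℝ)) =ᵐ[volume] (𝓕 g : Lp ℂ 2 (volume : Measure ℝ))) :
    f = g :=
  (Lp.fourierTransformₗᵢ ℝ ℂ).injective (Lp.ext h)

theorem multOp_multOp {m₁ m₂ m : ℝ → ℂ} (h₁ : MemLp m₁ ∞ (volume : Measure ℝ))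
    (h₂ : MemLp m₂ ∞ (volume : Measure ℝ)) (h : MemLp m ∞ (volume : Measure ℝ))
    (hm : ∀ η, m η = m₁ η * m₂ η) (f : Lp ℂ 2 (volume : Measure ℝ)) :
    multOp m₁ h₁ (multOp m₂ h₂ f) = multOp m h f := by
  apply fourier_L2_injective
  filter_upwards [fourier_multOp m₁ h₁ (multOp m₂ h₂ f), fourier_multOp m₂ h₂ f,
    fourier_multOp m h f] with η e1 e2 e3
  rw [e1, e2, e3, hm, mul_assoc]

theorem multOp_add (m : ℝ → ℂ) (hm : MemLp m ∞ (volume : Measure ℝ))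
    (f g : Lp ℂ 2 (volume : Measure ℝ)) :
    multOp m hm (f + g) = multOp m hm f + multOp m hm g := by
  unfold multOp
  rw [FourierTransform.fourier_add, Lp.add_smul, FourierTransform.fourierInv_add]

theorem multOp_const_mul {m m' : ℝ → ℂ} (hm : MemLp m ∞ (volume : Measure ℝ))
    (hm' : MemLp m' ∞ (volume : Measure ℝ)) (c : ℂ) (h : ∀ η, m' η = c * m η)
    (f : Lp ℂ 2 (volume : Measure ℝ)) : multOp m' hm' f = c • multOp m hm f := by
  apply fourier_L2_injective
  rw [FourierTransform.fourier_smul]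
  filter_upwards [fourier_multOp m' hm' f, fourier_multOp m hm f,
    Lp.coeFn_smul c (𝓕 (multOp m hm f) : Lp ℂ 2 (volume : Measure ℝ))] with η e1 e2 e3
  rw [e1, e3, Pi.smul_apply, e2, h, smul_eq_mul, mul_assoc]

theorem norm_multOp_le {m : ℝ → ℂ} (hm : MemLp m ∞ (volume : Measure ℝ)) {M : ℝ}
    (hM : ∀ η, ‖m η‖ ≤ M) (f : Lp ℂ 2 (volume : Measure ℝ)) :
    ‖multOp m hm f‖ ≤ M * ‖f‖ := by
  rw [← Lp.norm_fourier_eq (multOp m hm f), ← Lp.norm_fourier_eq f]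
  apply Lp.norm_le_mul_norm_of_ae_le_mul
  filter_upwards [fourier_multOp m hm f] with η e
  rw [e, norm_mul]
  exact mul_le_mul_of_nonneg_right (hM η) (norm_nonneg _)

theorem inner_multOp (m m' : ℝ → ℂ) (hm : MemLp m ∞ (volume : Measure ℝ))
    (hm' : MemLp m' ∞ (volume : Measure ℝ)) (f g : Lp ℂ 2 (volume : Measure ℝ)) :
    ⟪multOp m hm f, multOp m' hm' g⟫ =
      ∫ η, (conj (m η) * m' η) * (conj ((𝓕 f : Lp ℂ 2 (volume : Measure ℝ)) η) *
        (𝓕 g : Lp ℂ 2 (volume : Measure ℝ)) η) := by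
  rw [← Lp.inner_fourier_eq, L2.inner_def]
  apply integral_congr_ae
  filter_upwards [fourier_multOp m hm f, fourier_multOp m' hm' g] with η e1 e2
  rw [e1, e2, RCLike.inner_apply, map_mul]
  ring

theorem inner_multOp_conj (m m' : ℝ → ℂ) (hm : MemLp m ∞ (volume : Measure ℝ))
    (hm' : MemLp m' ∞ (volume : Measure ℝ)) (h : ∀ η, m' η = conj (m η))
    (f g : Lp ℂ 2 (volume : Measure ℝ)) :
    ⟪multOp m' hm' f, g⟫ = ⟪f, multOp m hm g⟫ := by
  rw [← Lp.inner_fourier_eq, ← Lp.inner_fourier_eq f, L2.inner_def, L2.inner_def]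
  apply integral_congr_ae
  filter_upwards [fourier_multOp m hm g, fourier_multOp m' hm' f] with η e1 e2
  rw [e1, e2, RCLike.inner_apply, RCLike.inner_apply, map_mul, h, conj_conj]
  ring

/-- The `L²` Fourier transform of an integrable function is its Fourier integral. -/
theorem fourier_L2_ae_eq (f : Lp ℂ 2 (volume : Measure ℝ)) (hf : Integrable (f : ℝ → ℂ)) :
    (𝓕 f : Lp ℂ 2 (volume : Measure ℝ)) =ᵐ[volume] 𝓕 (f : ℝ → ℂ) := by
  -- Both sides are tested against smooth compactly supported functions: there the `L²` transform
  -- agrees with the distributional one, and the multiplication formula moves the Fourier integral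
  -- from one factor to the other.
  apply ae_eq_of_integral_contDiff_smul_eq
  · exact (Lp.memLp _).locallyIntegrable (by norm_num)
  · exact (VectorFourier.fourierIntegral_continuous Real.continuous_fourierChar
      (by exact continuous_inner) hf).locallyIntegrable
  · intro g hg hgc
    have hgc' : HasCompactSupport (fun x => (g x : ℂ)) := hgc.comp_left (g := fun x : ℝ => (x : ℂ)) (by simp)
    have hgs : ContDiff ℝ ((⊤ : ℕ∞) : WithTop ℕ∞) (fun x => (g x : ℂ)) :=
      Complex.ofRealCLM.contDiff.comp hg
    let G : SchwartzMap ℝ ℂ := hgc'.toSchwartzMap hgs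
    have hG : ∀ x, G x = g x := fun x => rfl
    have h1 := congrArg (fun T => T G) (Lp.fourier_toTemperedDistribution_eq f)
    simp only [TemperedDistribution.fourier_apply, Lp.toTemperedDistribution_apply] at h1
    have h2 : ∫ x, (𝓕 G) x • f x = ∫ x, G x • 𝓕 (f : ℝ → ℂ) x := by
      have := VectorFourier.integral_fourierIntegral_smul_eq_flip (μ := volume) (ν := volume)
        (L := innerₗ ℝ) Real.continuous_fourierChar
        (by exact continuous_inner) (G.integrable (μ := volume)) hf
      rw [SchwartzMap.fourier_coe]
      simpa using! this
    rw [h2] at h1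
    simpa [hG] using h1.symm

/-- The composition of the adjoint of one multiplier with the other has a convolution kernel, the
inverse Fourier transform of `conj m * m'`. Integrability of the three factors allows Fubini, after
which a supremum of the kernel over pairs of points carrying `f` and `g` is all that matters. -/
theorem norm_inner_multOp_le {m m' : ℝ → ℂ} (hm : MemLp m ∞ (volume : Measure ℝ))
    (hm' : MemLp m' ∞ (volume : Measure ℝ)) {f g : Lp ℂ 2 (volume : Measure ℝ)}
    (hf : Integrable (f : ℝ → ℂ)) (hg : Integrable (g : ℝ → ℂ))
    (hκ : Integrable fun η => conj (m η) * m' η) {B : ℝ} {A A' : Set ℝ}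
    (hA : ∀ᵐ x, x ∉ A → f x = 0) (hA' : ∀ᵐ x, x ∉ A' → g x = 0)
    (hB : ∀ x ∈ A, ∀ y ∈ A',
      ‖∫ η, (conj (m η) * m' η) * cexp (2 * Real.pi * ((x - y) * η : ℝ) * I)‖ ≤ B) :
    ‖⟪multOp m hm f, multOp m' hm' g⟫‖ ≤ B * ((∫ x, ‖f x‖) * ∫ x, ‖g x‖) := by
  set κ := fun η => conj (m η) * m' η with hκd
  have key : ⟪multOp m hm f, multOp m' hm' g⟫ =
      ∫ z : ℝ × ℝ, (conj (f z.1) * g z.2) *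
        ∫ η, κ η * cexp (2 * Real.pi * ((z.1 - z.2) * η : ℝ) * I) := by
    rw [inner_multOp]
    have e1 : (∫ η, (conj (m η) * m' η) * (conj ((𝓕 f : Lp ℂ 2 (volume : Measure ℝ)) η) *
        (𝓕 g : Lp ℂ 2 (volume : Measure ℝ)) η)) =
        ∫ η, ∫ z : ℝ × ℝ, (conj (f z.1) * g z.2) *
          (κ η * cexp (2 * Real.pi * ((z.1 - z.2) * η : ℝ) * I)) := by
      apply integral_congr_ae
      filter_upwards [fourier_L2_ae_eq f hf, fourier_L2_ae_eq g hg] with η e1 e2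
      rw [e1, e2, Real.fourier_eq', Real.fourier_eq', ← integral_conj, ← integral_prod_mul,
        ← integral_const_mul]
      apply integral_congr_ae
      refine Filter.Eventually.of_forall fun z => ?_
      simp only [hκd, smul_eq_mul, map_mul, ← Complex.exp_conj, RCLike.inner_apply, conj_trivial,
        Complex.conj_ofReal, Complex.conj_I]
      have : cexp (2 * Real.pi * ((z.1 - z.2) * η : ℝ) * I) =
          cexp (((-2 * Real.pi * (η * z.1) : ℝ) : ℂ) * -I) *
          cexp (((-2 * Real.pi * (η * z.2) : ℝ) : ℂ) * I) := by
        rw [← Complex.exp_add]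
        congr 1
        push_cast
        ring
      rw [this]
      ring
    rw [e1, integral_integral_swap]
    · apply integral_congr_ae
      refine Filter.Eventually.of_forall fun z => ?_
      simp only []
      rw [integral_const_mul]
    · have hfc : Integrable (fun x => conj (f x)) := by
        simpa using (Complex.conjLIE.toContinuousLinearEquiv.toContinuousLinearMap.integrable_comp hf)
      have h1 : Integrable (fun w : ℝ × ℝ × ℝ => κ w.1 * (conj (f w.2.1) * g w.2.2))
          (volume.prod (volume.prod volume)) :=
        Integrable.mul_prod hκ (hfc.mul_prod hg)
      have hc : Continuous fun w : ℝ × ℝ × ℝ =>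
          cexp (2 * Real.pi * ((w.2.1 - w.2.2) * w.1 : ℝ) * I) := by fun_prop
      have h2 := h1.mul_bdd (c := 1) hc.aestronglyMeasurable
        (Filter.Eventually.of_forall fun w => by
          rw [show (2 * Real.pi * ((w.2.1 - w.2.2) * w.1 : ℝ) * I : ℂ) =
            ((2 * Real.pi * ((w.2.1 - w.2.2) * w.1) : ℝ) : ℂ) * I by push_cast; ring,
            Complex.norm_exp_ofReal_mul_I])
      refine h2.congr (Filter.Eventually.of_forall fun w => ?_)
      simp only [Function.uncurry]
      ring
  rw [key]
  have hint : Integrable (fun z : ℝ × ℝ => B * (‖f z.1‖ * ‖g z.2‖)) (volume.prod volume) :=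
    (hf.norm.mul_prod hg.norm).const_mul B
  refine (norm_integral_le_of_norm_le hint ?_).trans ?_
  · have hA1 : ∀ᵐ z : ℝ × ℝ ∂(volume.prod volume), z.1 ∉ A → f z.1 = 0 :=
      Measure.quasiMeasurePreserving_fst.ae hA
    have hA2 : ∀ᵐ z : ℝ × ℝ ∂(volume.prod volume), z.2 ∉ A' → g z.2 = 0 :=
      Measure.quasiMeasurePreserving_snd.ae hA'
    filter_upwards [hA1, hA2] with z h1 h2
    by_cases hz1 : z.1 ∈ A
    · by_cases hz2 : z.2 ∈ A'
      · rw [norm_mul, norm_mul, RCLike.norm_conj, mul_comm B]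
        exact mul_le_mul_of_nonneg_left (hB _ hz1 _ hz2) (by positivity)
      · simp [h2 hz2]
    · simp [h1 hz1]
  · rw [integral_const_mul, integral_prod_mul (fun x => ‖f x‖) (fun x => ‖g x‖)]

/-! ### Symbols with a kink -/

/-- The second difference of `μ` at `η` with step `h`. -/
def secondDiff (μ : ℝ → ℂ) (h η : ℝ) : ℂ := μ (η + 2 * h) - 2 * μ (η + h) + μ η

/-- A symbol supported in the interval of center `c` and length `10 w` and to one side of `ξ`,
which vanishes at `ξ` and is twice differentiable away from `ξ`, in terms of differences. -/
structure IsKink (w c ξ : ℝ) (σ : ℤˣ) (μ : ℝ → ℂ) : Prop where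
  meas : Measurable μ
  supp : ∀ η, μ η ≠ 0 → |η - c| ≤ 5 * w ∧ η ∈ halfLine σ ξ
  bound : ∀ η, ‖μ η‖ ≤ |η - ξ| / w
  lip : ∀ η h, 0 ≤ h → ‖μ (η + h) - μ η‖ ≤ h / w
  second : ∀ η h, 0 < h → η + h ≠ ξ → ‖secondDiff μ h η‖ ≤ 4 * (h / w) * √(h / |η + h - ξ|)

theorem abs_sub_le_of_halfLine {σ : ℤˣ} {ξ x y : ℝ} (hx : x ∈ halfLine σ ξ)
    (hy : y ∉ halfLine σ ξ) : |x - ξ| ≤ |x - y| := by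
  unfold halfLine at hx hy
  simp only [Set.mem_ofPred_eq, not_lt] at hx hy
  rcases Int.units_eq_one_or σ with rfl | rfl
  · simp only [Units.val_one, Int.cast_one, one_mul] at hx hy
    rw [abs_of_pos hx, abs_of_nonneg (by linarith)]
    linarith
  · simp only [Units.val_neg, Units.val_one, Int.cast_neg, Int.cast_one] at hx hy
    rw [abs_of_neg (by linarith), abs_of_neg (by linarith)]
    linarith

/-- Off `ξ` one divides the first order symbol bound by `|η - ξ|`. At `ξ` that bound is empty, and
continuity of the derivative fills the gap. -/
theorem IsSymbol.norm_deriv_le {N : ℕ} {ω : Ivl} {ξ : ℝ} {m : ℝ → ℂ} (h : IsSymbol N ω ξ m)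
    (hN : 2 ≤ N) (η : ℝ) : ‖deriv m η‖ ≤ 1 / ω.len := by
  have hcont : Continuous (deriv m) := h.smooth.continuous_deriv (by simp)
  have hcl : IsClosed {x | ‖deriv m x‖ ≤ 1 / ω.len} := isClosed_le hcont.norm continuous_const
  have hd : Dense ({ξ}ᶜ : Set ℝ) := dense_compl_singleton ξ
  have hsub : ({ξ}ᶜ : Set ℝ) ⊆ {x | ‖deriv m x‖ ≤ 1 / ω.len} := by
    intro x hx
    have h1 := h.bound 1 (by nlinarith) x
    have hpos : 0 < |x - ξ| := abs_pos.mpr (sub_ne_zero.mpr hx)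
    rw [iteratedDeriv_one, pow_one, div_eq_mul_one_div |x - ξ|] at h1
    exact le_of_mul_le_mul_left h1 hpos
  exact hcl.closure_subset_iff.mpr hsub (hd η)

theorem IsSymbol.norm_deriv_two_le {N : ℕ} {ω : Ivl} {ξ : ℝ} {m : ℝ → ℂ} (h : IsSymbol N ω ξ m)
    (hN : 2 ≤ N) {η : ℝ} (hη : η ≠ ξ) : ‖deriv (deriv m) η‖ ≤ 1 / (|η - ξ| * ω.len) := by
  have h1 := h.bound 2 (by nlinarith) η
  have hpos : 0 < |η - ξ| := abs_pos.mpr (sub_ne_zero.mpr hη)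
  rw [iteratedDeriv_succ, iteratedDeriv_one] at h1
  have h2 : |η - ξ| ^ 2 * (1 / (|η - ξ| * ω.len)) = |η - ξ| / ω.len := by
    rcases eq_or_ne ω.len 0 with h0 | h0
    · simp [h0]
    · field_simp
  rw [← h2] at h1
  exact le_of_mul_le_mul_left h1 (by positivity)

theorem norm_secondDiff_le {m : ℝ → ℂ} (hm : ContDiff ℝ ((⊤ : ℕ∞) : WithTop ℕ∞) m) {η h C : ℝ}
    (hh : 0 ≤ h) (hC : ∀ x ∈ Set.Icc η (η + 2 * h), ‖deriv (deriv m) x‖ ≤ C) :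
    ‖secondDiff m h η‖ ≤ C * h * h := by
  have hd : Differentiable ℝ m := hm.differentiable (by simp)
  have hd' : Differentiable ℝ (deriv m) :=
    ((contDiff_infty_iff_deriv.mp hm).2).differentiable (by simp)
  have h1 : ∀ x ∈ Set.Icc η (η + h), ‖deriv m (x + h) - deriv m x‖ ≤ C * h := by
    intro x hx
    have := (convex_Icc η (η + 2 * h)).norm_image_sub_le_of_norm_deriv_le
      (fun y _ => hd' y) hC (x := x) (y := x + h) ⟨hx.1, by linarith [hx.2]⟩
      ⟨by linarith [hx.1], by linarith [hx.2]⟩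
    simpa [abs_of_nonneg hh] using this
  have h2 := (convex_Icc η (η + h)).norm_image_sub_le_of_norm_hasDerivWithin_le
    (f := fun x => m (x + h) - m x) (f' := fun x => deriv m (x + h) - deriv m x) (C := C * h)
    (fun x _ => (((hd (x + h)).hasDerivAt.comp_add_const x h).sub
      (hd x).hasDerivAt).hasDerivWithinAt) h1 (x := η) (y := η + h)
    ⟨le_rfl, by linarith⟩ ⟨by linarith, le_rfl⟩
  have e : secondDiff m h η = m (η + h + h) - m (η + h) - (m (η + h) - m η) := by
    unfold secondDiff
    rw [show η + 2 * h = η + h + h by ring]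
    ring
  rw [e]
  simpa [abs_of_nonneg hh] using h2

/-- Cutting `m` at `ξ` preserves the Lipschitz bound because `m` vanishes there: a step across `ξ`
is at least as long as the distance to `ξ`. For second differences, a step `t` comparable with the
distance `r` of the middle node to `ξ` is handled by the Lipschitz bound, and a smaller one keeps
all nodes on one side of `ξ`, where `m''` is of order `1 / (r |ω|)`. The factor `√(t / r)` dominates
in both regimes and, unlike `t / r`, is locally integrable. -/
theorem IsSymbol.isKink {N : ℕ} {ω : Ivl} {ξ : ℝ} {m : ℝ → ℂ} (h : IsSymbol N ω ξ m)
    (hN : 2 ≤ N) (hω : 0 < ω.len) (σ : ℤˣ) :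
    IsKink ω.len ω.ctr ξ σ (fun η => m η * (halfLine σ ξ).indicator (fun _ => (1 : ℂ)) η) := by
  have hin : ∀ {x}, x ∈ halfLine σ ξ →
      m x * (halfLine σ ξ).indicator (fun _ => (1 : ℂ)) x = m x := fun hx => by
    rw [Set.indicator_of_mem hx, mul_one]
  have hout : ∀ {x}, x ∉ halfLine σ ξ →
      m x * (halfLine σ ξ).indicator (fun _ => (1 : ℂ)) x = 0 := fun hx => by
    rw [Set.indicator_of_notMem hx, mul_zero]
  have hb0 : ∀ η, ‖m η‖ ≤ |η - ξ| / ω.len := fun η => by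
    simpa using h.bound 0 (Nat.zero_le _) η
  have hlip : ∀ η t, 0 ≤ t → ‖m (η + t) * (halfLine σ ξ).indicator (fun _ => (1 : ℂ)) (η + t) -
      m η * (halfLine σ ξ).indicator (fun _ => (1 : ℂ)) η‖ ≤ t / ω.len := by
    intro η t ht
    by_cases h1 : η ∈ halfLine σ ξ <;> by_cases h2 : η + t ∈ halfLine σ ξ
    · rw [hin h1, hin h2]
      have := (convex_univ).norm_image_sub_le_of_norm_deriv_le
        (fun y _ => (h.smooth.differentiable (by simp)) y)
        (fun y _ => h.norm_deriv_le hN y) (Set.mem_univ η) (Set.mem_univ (η + t))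
      rw [add_sub_cancel_left, Real.norm_of_nonneg ht] at this
      rw [div_eq_mul_one_div, mul_comm]
      exact this
    · rw [hin h1, hout h2, zero_sub, norm_neg]
      refine (hb0 η).trans ?_
      gcongr
      have := abs_sub_le_of_halfLine h1 h2
      rwa [sub_add_cancel_left, abs_neg, abs_of_nonneg ht] at this
    · rw [hout h1, hin h2, sub_zero]
      refine (hb0 _).trans ?_
      gcongr
      have := abs_sub_le_of_halfLine h2 h1
      rwa [add_sub_cancel_left, abs_of_nonneg ht] at this
    · rw [hout h1, hout h2, sub_zero, norm_zero]
      positivity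
  refine ⟨?_, ?_, ?_, hlip, ?_⟩
  · exact h.smooth.continuous.measurable.mul
      (measurable_const.indicator (measurableSet_halfLine σ ξ))
  · intro η hη
    have h1 := h.support (left_ne_zero_of_mul hη)
    constructor
    · simp only [Ivl.toSet, Ivl.dil, Set.mem_Icc] at h1
      rw [abs_le]
      constructor <;> linarith
    · by_contra hc
      exact hη (hout hc)
  · intro η
    by_cases h1 : η ∈ halfLine σ ξ
    · rw [hin h1]
      exact hb0 η
    · rw [hout h1, norm_zero]
      positivity
  · intro η t ht hne
    have hr : 0 < |η + t - ξ| := abs_pos.mpr (sub_ne_zero.mpr hne)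
    set r := |η + t - ξ| with hrd
    rcases le_or_gt r (2 * t) with hc | hc
    · have e1 := hlip η t ht.le
      have e2 := hlip (η + t) t ht.le
      rw [show η + t + t = η + 2 * t by ring] at e2
      have e3 : ‖secondDiff (fun η => m η * (halfLine σ ξ).indicator (fun _ => (1 : ℂ)) η) t η‖ ≤
          t / ω.len + t / ω.len := by
        refine le_trans ?_ (add_le_add e2 e1)
        refine le_trans (le_of_eq ?_) (norm_sub_le _ _)
        unfold secondDiff
        congr 1
        ring
      have e4 : 1 / 2 ≤ √(t / r) := by
        apply Real.le_sqrt_of_sq_le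
        rw [le_div_iff₀ hr]
        linarith
      have : 0 ≤ t / ω.len := by positivity
      nlinarith
    · have hside : ∀ x ∈ Set.Icc η (η + 2 * t), r / 2 ≤ |x - ξ| := by
        intro x hx
        have : r ≤ |x - ξ| + |η + t - x| := by
          rw [hrd]
          calc |η + t - ξ| = |(x - ξ) + (η + t - x)| := by ring_nf
            _ ≤ _ := abs_add_le _ _
        have h3 : |η + t - x| ≤ t := by
          rw [abs_le]
          constructor <;> linarith [hx.1, hx.2]
        linarith
      have hmem : ∀ x ∈ Set.Icc η (η + 2 * t), (x ∈ halfLine σ ξ ↔ η + t ∈ halfLine σ ξ) := by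
        intro x hx
        have h3 : |x - (η + t)| ≤ t := by
          rw [abs_le]
          constructor <;> linarith [hx.1, hx.2]
        constructor
        · intro h1
          by_contra h2
          rcases lt_or_ge t |x - ξ| with h4 | h4
          · linarith [abs_sub_le_of_halfLine h1 h2]
          · have : r ≤ |x - ξ| + |x - (η + t)| := by
              rw [hrd, abs_sub_comm x (η + t)]
              calc |η + t - ξ| = |(x - ξ) + (η + t - x)| := by ring_nf
                _ ≤ _ := abs_add_le _ _
            linarith
        · intro h1
          by_contra h2
          have := abs_sub_le_of_halfLine h1 h2
          rw [abs_sub_comm (η + t) x] at this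
          linarith
      have m0 : η ∈ Set.Icc η (η + 2 * t) := ⟨le_rfl, by linarith⟩
      have m2 : η + 2 * t ∈ Set.Icc η (η + 2 * t) := ⟨by linarith, le_rfl⟩
      by_cases h1 : η + t ∈ halfLine σ ξ
      · have e : secondDiff (fun η => m η * (halfLine σ ξ).indicator (fun _ => (1 : ℂ)) η) t η =
            secondDiff m t η := by
          unfold secondDiff
          beta_reduce
          rw [hin h1, hin ((hmem _ m0).mpr h1), hin ((hmem _ m2).mpr h1)]
        rw [e]
        have hC : ∀ x ∈ Set.Icc η (η + 2 * t), ‖deriv (deriv m) x‖ ≤ 2 / (r * ω.len) := by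
          intro x hx
          have hx' := hside x hx
          refine (h.norm_deriv_two_le hN ?_).trans ?_
          · rintro rfl
            simp at hx'
            linarith
          · have : 0 < |x - ξ| := by linarith
            rw [div_le_div_iff₀ (by positivity) (by positivity)]
            nlinarith
        refine (norm_secondDiff_le h.smooth ht.le hC).trans ?_
        have hq : t / r ≤ 1 := (div_le_one hr).mpr (by linarith)
        have hs : t / r ≤ √(t / r) := by
          apply Real.le_sqrt_of_sq_le
          have : 0 ≤ t / r := by positivity
          nlinarith
        calc 2 / (r * ω.len) * t * t = 2 * (t / ω.len) * (t / r) := by field_simp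
          _ ≤ 4 * (t / ω.len) * √(t / r) := by gcongr; norm_num
      · have e : secondDiff (fun η => m η * (halfLine σ ξ).indicator (fun _ => (1 : ℂ)) η) t η =
            0 := by
          unfold secondDiff
          beta_reduce
          rw [hout h1, hout (fun h => h1 ((hmem _ m0).mp h)),
            hout (fun h => h1 ((hmem _ m2).mp h))]
          simp
        rw [e, norm_zero]
        positivity

theorem IsKink.memLp {w c ξ : ℝ} {σ : ℤˣ} {μ : ℝ → ℂ} (h : IsKink w c ξ σ μ) (hw : 0 < w) :
    MemLp μ ∞ (volume : Measure ℝ) := by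
  refine memLp_top_of_bound h.meas.aestronglyMeasurable ((5 * w + |c - ξ|) / w)
    (Filter.Eventually.of_forall fun η => ?_)
  by_cases h0 : μ η = 0
  · rw [h0, norm_zero]
    positivity
  · refine (h.bound η).trans ?_
    gcongr
    have := (h.supp η h0).1
    calc |η - ξ| = |(η - c) + (c - ξ)| := by ring_nf
      _ ≤ _ := (abs_add_le _ _).trans (by linarith)

/-! ### The kernel of a product of two symbols with kinks -/

/-- Translation by half a period `1 / (2 |z|)` flips the sign of the exponential, so replacing `κ`
by its second difference multiplies the integral by four. This takes the place of two integrations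
by parts, which the kink forbids. -/
theorem norm_integral_exp_le {κ : ℝ → ℂ} (hκ : Integrable κ) {z : ℝ} (hz : z ≠ 0) :
    ‖∫ η, κ η * cexp (2 * Real.pi * (z * η : ℝ) * I)‖ ≤
      1 / 4 * ∫ η, ‖secondDiff κ (1 / (2 * |z|)) η‖ := by
  set h := 1 / (2 * |z|) with hh
  set e : ℝ → ℂ := fun η => cexp (2 * Real.pi * (z * η : ℝ) * I) with he
  have hnorm : ∀ η, ‖e η‖ = 1 := fun η => by
    rw [he]
    simp only []
    rw [show (2 * Real.pi * (z * η : ℝ) * I : ℂ) = ((2 * Real.pi * (z * η) : ℝ) : ℂ) * I by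
      push_cast; ring, Complex.norm_exp_ofReal_mul_I]
  have hzabs : 0 < |z| := abs_pos.mpr hz
  have hshift : ∀ η, e (η + h) = - e η := fun η => by
    have h1 : cexp (2 * Real.pi * (z * h : ℝ) * I) = -1 := by
      rcases lt_or_gt_of_ne hz with hneg | hpos
      · have : z * h = -(1 / 2) := by rw [hh, abs_of_neg hneg]; field_simp
        rw [this]
        rw [show (2 * Real.pi * (-(1 / 2) : ℝ) * I : ℂ) = -(Real.pi * I) by push_cast; ring,
          Complex.exp_neg, Complex.exp_pi_mul_I]
        norm_num
      · have : z * h = 1 / 2 := by rw [hh, abs_of_pos hpos]; field_simp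
        rw [this]
        rw [show (2 * Real.pi * ((1 / 2 : ℝ) : ℂ) * I : ℂ) = Real.pi * I by push_cast; ring,
          Complex.exp_pi_mul_I]
    rw [he]
    simp only []
    rw [show (2 * Real.pi * (z * (η + h) : ℝ) * I : ℂ) =
      2 * Real.pi * (z * η : ℝ) * I + 2 * Real.pi * (z * h : ℝ) * I by push_cast; ring,
      Complex.exp_add, h1]
    ring
  have hec : Continuous e := by rw [he]; fun_prop
  have hi : ∀ {g : ℝ → ℂ}, Integrable g → Integrable fun η => g η * e η := fun hg =>
    hg.mul_bdd (c := 1) hec.aestronglyMeasurable (Filter.Eventually.of_forall fun η => (hnorm η).le)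
  have hs1 : ∀ {g : ℝ → ℂ}, ∫ η, g (η + h) * e η = - ∫ η, g η * e η := fun {g} => by
    rw [← integral_add_right_eq_self (fun η => g η * e η) h, ← integral_neg]
    congr 1
    ext η
    rw [hshift]
    ring
  have hκ1 : Integrable fun η => κ (η + h) := hκ.comp_add_right h
  have hκ2 : Integrable fun η => κ (η + 2 * h) := hκ.comp_add_right (2 * h)
  have key : ∫ η, secondDiff κ h η * e η = 4 * ∫ η, κ η * e η := by
    have e2 : ∫ η, κ (η + 2 * h) * e η = ∫ η, κ η * e η := by
      have := hs1 (g := fun η => κ (η + h))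
      rw [hs1, neg_neg] at this
      rw [← this]
      congr 1
      ext η
      ring_nf
    have : ∀ η, secondDiff κ h η * e η =
        κ (η + 2 * h) * e η - 2 * (κ (η + h) * e η) + κ η * e η := fun η => by
      unfold secondDiff
      ring
    simp_rw [this]
    have i1 : Integrable fun η => κ (η + 2 * h) * e η - 2 * (κ (η + h) * e η) :=
      (hi hκ2).sub ((hi hκ1).const_mul 2)
    rw [integral_add i1 (hi hκ),
      integral_sub (hi hκ2) ((hi hκ1).const_mul 2), integral_const_mul, hs1, e2]
    ring
  have h3 : ‖∫ η, secondDiff κ h η * e η‖ ≤ ∫ η, ‖secondDiff κ h η‖ := by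
    refine (norm_integral_le_integral_norm _).trans (le_of_eq ?_)
    congr 1
    ext η
    rw [norm_mul, hnorm, mul_one]
  rw [key, norm_mul] at h3
  norm_num at h3
  linarith

/-- An integrable majorant, on intervals of length `ℓ`, of `|x - c| ^ (-1 / 2)`. -/
def invSqrtMajorant (a b c x : ℝ) : ℝ :=
  (Set.Ioc 0 (b - a)).indicator (fun y => y ^ (-(1 / 2) : ℝ)) (x - c) +
  (Set.Ioc 0 (b - a)).indicator (fun y => y ^ (-(1 / 2) : ℝ)) (c - x) +
  (Set.Icc a b).indicator (fun _ => (√(b - a))⁻¹) x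

theorem invSqrtMajorant_nonneg (a b c x : ℝ) : 0 ≤ invSqrtMajorant a b c x := by
  have h : ∀ y, 0 ≤ (Set.Ioc 0 (b - a)).indicator (fun y => y ^ (-(1 / 2) : ℝ)) y := fun y =>
    Set.indicator_nonneg (fun y hy => Real.rpow_nonneg hy.1.le _) _
  exact add_nonneg (add_nonneg (h _) (h _)) (Set.indicator_nonneg (fun _ _ => by positivity) _)

theorem le_invSqrtMajorant {a b c x : ℝ} (hab : a < b) (hx : x ∈ Set.Icc a b) (hxc : x ≠ c) :
    (√|x - c|)⁻¹ ≤ invSqrtMajorant a b c x := by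
  have h : ∀ y, 0 ≤ (Set.Ioc 0 (b - a)).indicator (fun y => y ^ (-(1 / 2) : ℝ)) y := fun y =>
    Set.indicator_nonneg (fun y hy => Real.rpow_nonneg hy.1.le _) _
  have h3 : 0 ≤ (√(b - a))⁻¹ := by positivity
  have e : ∀ y : ℝ, 0 ≤ y → y ^ (-(1 / 2) : ℝ) = (√y)⁻¹ := fun y hy => by
    rw [Real.rpow_neg hy, Real.sqrt_eq_rpow]
  unfold invSqrtMajorant
  rw [Set.indicator_of_mem hx]
  rcases le_or_gt (b - a) |x - c| with hc | hc
  · have : (√|x - c|)⁻¹ ≤ (√(b - a))⁻¹ := by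
      have : 0 < √(b - a) := Real.sqrt_pos.mpr (by linarith)
      gcongr
    linarith [h (x - c), h (c - x)]
  · rcases lt_or_gt_of_ne hxc with hlt | hgt
    · rw [abs_of_neg (by linarith), neg_sub] at hc ⊢
      rw [Set.indicator_of_mem (a := c - x) (Set.mem_Ioc.mpr ⟨by linarith, hc.le⟩), e _ (by linarith)]
      linarith [h (x - c)]
    · rw [abs_of_pos (by linarith)] at hc ⊢
      rw [Set.indicator_of_mem (a := x - c) (Set.mem_Ioc.mpr ⟨by linarith, hc.le⟩), e _ (by linarith)]
      linarith [h (c - x)]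

/-- The value does not depend on `c`: the singularity may lie anywhere inside or outside `[a, b]`.
-/
theorem integral_invSqrtMajorant {a b : ℝ} (hab : a < b) (c : ℝ) :
    Integrable (invSqrtMajorant a b c) ∧ ∫ x, invSqrtMajorant a b c x = 5 * √(b - a) := by
  set F := (Set.Ioc 0 (b - a)).indicator (fun y : ℝ => y ^ (-(1 / 2) : ℝ)) with hF
  have hFi : Integrable F := by
    rw [hF, integrable_indicator_iff measurableSet_Ioc]
    exact (intervalIntegrable_iff_integrableOn_Ioc_of_le (by linarith)).mp
      (intervalIntegral.intervalIntegrable_rpow' (by norm_num))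
  have hFv : ∫ x, F x = 2 * √(b - a) := by
    rw [hF, integral_indicator measurableSet_Ioc,
      ← intervalIntegral.integral_of_le (by linarith), integral_rpow (Or.inl (by norm_num))]
    rw [Real.zero_rpow (by norm_num), Real.sqrt_eq_rpow]
    norm_num
    ring
  have h1 : Integrable fun x => F (x - c) := hFi.comp_sub_right c
  have h2 : Integrable fun x => F (c - x) := hFi.comp_sub_left c
  have h3 : Integrable ((Set.Icc a b).indicator (fun _ => (√(b - a))⁻¹)) := by
    rw [integrable_indicator_iff measurableSet_Icc]
    exact integrableOn_const (by simp)
  have h12 : Integrable fun x => F (x - c) + F (c - x) := h1.add h2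
  constructor
  · exact h12.add h3
  · unfold invSqrtMajorant
    rw [← hF]
    rw [integral_add h12 h3, integral_add h1 h2, integral_sub_right_eq_self F,
      integral_sub_left_eq_self F, hFv, integral_indicator measurableSet_Icc, setIntegral_const,
      Real.volume_real_Icc_of_le hab.le, smul_eq_mul]
    have hp : 0 < √(b - a) := Real.sqrt_pos.mpr (by linarith)
    have : (b - a) * (√(b - a))⁻¹ = √(b - a) := by
      rw [mul_inv_eq_iff_eq_mul₀ hp.ne', Real.mul_self_sqrt (by linarith)]
    linarith

theorem IsKink.norm_le {w c ξ : ℝ} {σ : ℤˣ} {μ : ℝ → ℂ} (h : IsKink w c ξ σ μ) (hw : 0 < w)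
    {D : ℝ} (hD : |c - ξ| ≤ D * w) (η : ℝ) : ‖μ η‖ ≤ 5 + D := by
  have hD0 : 0 ≤ D := by
    by_contra h0
    nlinarith [abs_nonneg (c - ξ)]
  by_cases h0 : μ η = 0
  · rw [h0, norm_zero]
    linarith
  · refine (h.bound η).trans ?_
    rw [div_le_iff₀ hw]
    have := (h.supp η h0).1
    calc |η - ξ| = |(η - c) + (c - ξ)| := by ring_nf
      _ ≤ _ := (abs_add_le _ _).trans (by linarith)

theorem IsKink.integrable {w c ξ : ℝ} {σ : ℤˣ} {μ : ℝ → ℂ} (h : IsKink w c ξ σ μ) (hw : 0 < w) :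
    Integrable μ := by
  have hD : |c - ξ| ≤ (|c - ξ| / w) * w := by rw [div_mul_cancel₀ _ hw.ne']
  have h1 : IntegrableOn μ (Set.Icc (c - 5 * w) (c + 5 * w)) :=
    IntegrableOn.of_bound (by simp) h.meas.aestronglyMeasurable (5 + |c - ξ| / w)
      (Filter.Eventually.of_forall fun η => h.norm_le hw hD η)
  refine h1.integrable_of_forall_notMem_eq_zero fun η hη => ?_
  by_contra h0
  have := abs_le.mp (h.supp η h0).1
  exact hη ⟨by linarith, by linarith⟩

theorem secondDiff_mul (μ ν : ℝ → ℂ) (h η : ℝ) :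
    secondDiff (fun x => conj (μ x) * ν x) h η =
      conj (secondDiff μ h η) * ν (η + 2 * h) +
      2 * (conj (μ (η + h) - μ η) * (ν (η + h + h) - ν (η + h))) +
      conj (μ η) * secondDiff ν h η := by
  unfold secondDiff
  rw [show η + h + h = η + 2 * h by ring]
  simp only [map_add, map_sub, map_mul, map_ofNat]
  ring

/-- By the Leibniz rule `secondDiff_mul`, the two second differences are singular at `ξ - h` and `ξ'
- h` and are paid for by one majorant each, while the product of first differences is bounded by a
constant. The hypothesis on `Γ` makes `ν` of size `O(Γ)` near the support of `μ` and gives `1 / w' ≤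
Γ / w`, which removes `w'` from the bound. -/
theorem integral_norm_secondDiff_le {w c ξ w' c' ξ' D Γ h : ℝ} {σ : ℤˣ} {μ ν : ℝ → ℂ}
    (hμ : IsKink w c ξ σ μ) (hν : IsKink w' c' ξ' σ ν) (hw : 0 < w) (hw' : 0 < w')
    (hD : |c - ξ| ≤ D * w) (hΓ : |c - ξ'| + w ≤ Γ * w') (hh : 0 < h) (hhw : h ≤ w) :
    ∫ η, ‖secondDiff (fun x => conj (μ x) * ν x) h η‖ ≤
      (1000 + 80 * D) * Γ * (h * √h / √w) := by
  have hD0 : 0 ≤ D := by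
    by_contra h0
    nlinarith [abs_nonneg (c - ξ)]
  have hΓ0 : 0 < Γ := by
    by_contra h0
    nlinarith [abs_nonneg (c - ξ')]
  have hww' : 1 / w' ≤ Γ / w := by
    rw [div_le_div_iff₀ hw' hw]
    linarith [abs_nonneg (c - ξ')]
  -- For `η` outside `[c - 7 w, c + 5 w]` none of the nodes `η`, `η + h`, `η + 2 h` meets the
  -- support of `μ`, because `h ≤ w`.
  set a := c - 7 * w with ha
  set b := c + 5 * w with hb
  have hab : a < b := by linarith
  have hba : b - a = 12 * w := by ring
  set A := (h / w) * Γ * √h with hA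
  have hA0 : 0 ≤ A := by positivity
  set Φ : ℝ → ℝ := fun η => A * (28 * invSqrtMajorant a b (ξ - h) η +
    ((20 + 4 * D) * invSqrtMajorant a b (ξ' - h) η +
      (Set.Icc a b).indicator (fun _ => 2 * (√w)⁻¹) η)) with hΦ
  have i1 := integral_invSqrtMajorant hab (ξ - h)
  have i2 := integral_invSqrtMajorant hab (ξ' - h)
  have i3 : Integrable ((Set.Icc a b).indicator (fun _ => 2 * (√w)⁻¹)) := by
    rw [integrable_indicator_iff measurableSet_Icc]
    exact integrableOn_const (by simp)
  have i23 : Integrable fun η => (20 + 4 * D) * invSqrtMajorant a b (ξ' - h) η +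
      (Set.Icc a b).indicator (fun _ => 2 * (√w)⁻¹) η := (i2.1.const_mul _).add i3
  have i123 := (i1.1.const_mul 28).add i23
  have hΦi : Integrable Φ := i123.const_mul A
  have hsw : 0 < √w := Real.sqrt_pos.mpr hw
  have hpt : ∀ᵐ η, ‖secondDiff (fun x => conj (μ x) * ν x) h η‖ ≤ Φ η := by
    have z1 : ∀ᵐ η : ℝ, η ≠ ξ - h := by simp [ae_iff, measure_singleton]
    have z2 : ∀ᵐ η : ℝ, η ≠ ξ' - h := by simp [ae_iff, measure_singleton]
    filter_upwards [z1, z2] with η n1 n2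
    by_cases hη : η ∈ Set.Icc a b
    · have m1 := le_invSqrtMajorant hab hη n1
      have m2 := le_invSqrtMajorant hab hη n2
      have ind : (Set.Icc a b).indicator (fun _ => 2 * (√w)⁻¹) η = 2 * (√w)⁻¹ :=
        Set.indicator_of_mem hη _
      have s1 := hμ.second η h hh (by intro e; apply n1; linarith)
      have s2 := hν.second η h hh (by intro e; apply n2; linarith)
      have l1 := hμ.lip η h hh.le
      have l2 := hν.lip (η + h) h hh.le
      have b2 : ‖ν (η + 2 * h)‖ ≤ 7 * Γ := by
        refine (hν.bound _).trans ?_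
        rw [div_le_iff₀ hw']
        have t1 : |η + 2 * h - c| ≤ 7 * w := by
          rw [abs_le]
          constructor <;> linarith [hη.1, hη.2]
        calc |η + 2 * h - ξ'| = |(η + 2 * h - c) + (c - ξ')| := by ring_nf
          _ ≤ _ := (abs_add_le _ _).trans (by nlinarith [abs_nonneg (c - ξ')])
      have b0 := hμ.norm_le hw hD η
      rw [Real.sqrt_div hh.le, div_eq_mul_inv (√h)] at s1 s2
      rw [show η + h - ξ = η - (ξ - h) by ring] at s1
      rw [show η + h - ξ' = η - (ξ' - h) by ring] at s2
      set M1 := invSqrtMajorant a b (ξ - h) η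
      set M2 := invSqrtMajorant a b (ξ' - h) η
      have hM1 : 0 ≤ M1 := invSqrtMajorant_nonneg _ _ _ _
      have hM2 : 0 ≤ M2 := invSqrtMajorant_nonneg _ _ _ _
      have hw'' : h / w' ≤ (h / w) * Γ := by
        calc h / w' = h * (1 / w') := by ring
          _ ≤ h * (Γ / w) := by gcongr
          _ = _ := by ring
      have t1 : ‖conj (secondDiff μ h η) * ν (η + 2 * h)‖ ≤ A * (28 * M1) := by
        rw [norm_mul, RCLike.norm_conj]
        calc ‖secondDiff μ h η‖ * ‖ν (η + 2 * h)‖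
            ≤ (4 * (h / w) * (√h * M1)) * (7 * Γ) := by
              refine mul_le_mul (s1.trans ?_) b2 (norm_nonneg _) (by positivity)
              gcongr
          _ = A * (28 * M1) := by rw [hA]; ring
      have t3 : ‖conj (μ η) * secondDiff ν h η‖ ≤ A * ((20 + 4 * D) * M2) := by
        rw [norm_mul, RCLike.norm_conj]
        calc ‖μ η‖ * ‖secondDiff ν h η‖
            ≤ (5 + D) * (4 * ((h / w) * Γ) * (√h * M2)) := by
              refine mul_le_mul b0 (s2.trans ?_) (norm_nonneg _) (by positivity)
              gcongr
          _ = A * ((20 + 4 * D) * M2) := by rw [hA]; ring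
      have t2 : ‖2 * (conj (μ (η + h) - μ η) * (ν (η + h + h) - ν (η + h)))‖ ≤
          A * (2 * (√w)⁻¹) := by
        rw [norm_mul, norm_mul, RCLike.norm_conj]
        have hhh : h / w ≤ √h * (√w)⁻¹ := by
          rw [← div_eq_mul_inv, ← Real.sqrt_div hh.le]
          apply Real.le_sqrt_of_sq_le
          have : h / w ≤ 1 := (div_le_one hw).mpr hhw
          have : 0 ≤ h / w := by positivity
          nlinarith
        calc ‖(2 : ℂ)‖ * (‖μ (η + h) - μ η‖ * ‖ν (η + h + h) - ν (η + h)‖)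
            ≤ 2 * ((√h * (√w)⁻¹) * ((h / w) * Γ)) := by
              rw [Complex.norm_ofNat]
              gcongr
              · exact l1.trans hhh
              · exact l2.trans hw''
          _ = _ := by rw [hA]; ring
      rw [secondDiff_mul]
      refine (norm_add₃_le).trans ?_
      rw [hΦ]
      simp only [ind]
      linarith
    · have hz : ∀ t, 0 ≤ t → t ≤ 2 * h → μ (η + t) = 0 := by
        intro t ht0 ht1
        by_contra h0
        have := abs_le.mp (hμ.supp _ h0).1
        exact hη ⟨by linarith, by linarith⟩
      have z0 : secondDiff (fun x => conj (μ x) * ν x) h η = 0 := by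
        unfold secondDiff
        have := hz 0 le_rfl (by linarith)
        rw [add_zero] at this
        beta_reduce
        rw [this, hz h hh.le (by linarith), hz (2 * h) (by linarith) le_rfl]
        simp
      rw [z0, norm_zero, hΦ]
      have hM1 := invSqrtMajorant_nonneg a b (ξ - h) η
      have hM2 := invSqrtMajorant_nonneg a b (ξ' - h) η
      have hM3 : 0 ≤ (Set.Icc a b).indicator (fun _ => 2 * (√w)⁻¹) η :=
        Set.indicator_nonneg (fun _ _ => by positivity) _
      positivity
  have hval : ∫ η, Φ η = A * (28 * (5 * √(b - a)) + ((20 + 4 * D) * (5 * √(b - a)) +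
      24 * √w)) := by
    rw [hΦ, integral_const_mul, integral_add (i1.1.const_mul 28) i23, integral_const_mul,
      integral_add (i2.1.const_mul _) i3, integral_const_mul, i1.2, i2.2,
      integral_indicator measurableSet_Icc, setIntegral_const,
      Real.volume_real_Icc_of_le hab.le, smul_eq_mul, hba]
    congr 3
    have : w = √w * √w := (Real.mul_self_sqrt hw.le).symm
    calc 12 * w * (2 * (√w)⁻¹) = 24 * (w * (√w)⁻¹) := by ring
      _ = 24 * √w := by nth_rewrite 1 [this]; field_simp
  have hle : ∫ η, ‖secondDiff (fun x => conj (μ x) * ν x) h η‖ ≤ ∫ η, Φ η :=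
    integral_mono_of_nonneg (Filter.Eventually.of_forall fun _ => norm_nonneg _) hΦi hpt
  refine hle.trans ?_
  rw [hval, hba]
  have h12 : √(12 * w) ≤ 4 * √w := by
    rw [Real.sqrt_mul (by norm_num)]
    gcongr
    rw [Real.sqrt_le_left (by norm_num)]
    norm_num
  calc A * (28 * (5 * √(12 * w)) + ((20 + 4 * D) * (5 * √(12 * w)) + 24 * √w))
      ≤ A * (28 * (5 * (4 * √w)) + ((20 + 4 * D) * (5 * (4 * √w)) + 24 * √w)) := by gcongr
    _ = (984 + 80 * D) * (A * √w) := by ring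
    _ = (984 + 80 * D) * Γ * (h * √h / √w) := by
        rw [hA]
        have : w = √w * √w := (Real.mul_self_sqrt hw.le).symm
        have e : h / w * √w = h / √w := by
          nth_rewrite 1 [this]
          field_simp
        calc (984 + 80 * D) * (h / w * Γ * √h * √w) =
            (984 + 80 * D) * Γ * √h * (h / w * √w) := by ring
          _ = _ := by rw [e]; ring
    _ ≤ _ := by gcongr; norm_num

/-- The kernel bound for a product of two symbols with kinks. -/
theorem IsKink.norm_kernel_le {w c ξ w' c' ξ' D Γ d z : ℝ} {σ : ℤˣ} {μ ν : ℝ → ℂ}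
    (hμ : IsKink w c ξ σ μ) (hν : IsKink w' c' ξ' σ ν) (hw : 0 < w) (hw' : 0 < w')
    (hD : |c - ξ| ≤ D * w) (hΓ : |c - ξ'| + w ≤ Γ * w') (hd : 0 < d) (hdw : 1 ≤ 2 * d * w)
    (hz : d ≤ |z|) :
    ‖∫ η, (conj (μ η) * ν η) * cexp (2 * Real.pi * (z * η : ℝ) * I)‖ ≤
      (250 + 20 * D) * Γ * (d⁻¹ * √d⁻¹ * (√w)⁻¹) := by
  have hD0 : 0 ≤ D := by
    by_contra h0
    nlinarith [abs_nonneg (c - ξ)]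
  have hΓ0 : 0 < Γ := by
    by_contra h0
    nlinarith [abs_nonneg (c - ξ')]
  have hz0 : z ≠ 0 := by
    rintro rfl
    simp at hz
    linarith
  have hzp : 0 < |z| := abs_pos.mpr hz0
  have hD' : |c' - ξ'| ≤ (|c' - ξ'| / w') * w' := by rw [div_mul_cancel₀ _ hw'.ne']
  have hκ : Integrable fun η => conj (μ η) * ν η := by
    refine Integrable.mul_bdd (c := 5 + |c' - ξ'| / w') ?_ hν.meas.aestronglyMeasurable
      (Filter.Eventually.of_forall fun η => hν.norm_le hw' hD' η)
    simpa using! (Complex.conjLIE.toContinuousLinearEquiv.toContinuousLinearMap.integrable_comp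
      (hμ.integrable hw))
  have hh1 : 1 / (2 * |z|) ≤ w := by
    rw [div_le_iff₀ (by positivity)]
    nlinarith
  have hh2 : 1 / (2 * |z|) ≤ d⁻¹ := by
    rw [inv_eq_one_div]
    gcongr
    linarith
  refine (norm_integral_exp_le hκ hz0).trans ?_
  have h1 := integral_norm_secondDiff_le hμ hν hw hw' hD hΓ (by positivity) hh1
  have h2 : 1 / (2 * |z|) * √(1 / (2 * |z|)) / √w ≤ d⁻¹ * √d⁻¹ * (√w)⁻¹ := by
    rw [div_eq_mul_inv _ (√w)]
    gcongr
  calc _ ≤ 1 / 4 * ((1000 + 80 * D) * Γ * (1 / (2 * |z|) * √(1 / (2 * |z|)) / √w)) := by gcongr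
    _ ≤ 1 / 4 * ((1000 + 80 * D) * Γ * (d⁻¹ * √d⁻¹ * (√w)⁻¹)) := by gcongr
    _ = _ := by ring

theorem IsKink.conj {w c ξ : ℝ} {σ : ℤˣ} {μ : ℝ → ℂ} (h : IsKink w c ξ σ μ) :
    IsKink w c ξ σ (fun η => conj (μ η)) where
  meas := Complex.continuous_conj.measurable.comp h.meas
  supp η hη := h.supp η (by simpa using hη)
  bound η := by rw [RCLike.norm_conj]; exact h.bound η
  lip η t ht := by rw [← map_sub, RCLike.norm_conj]; exact h.lip η t ht
  second η t ht hne := by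
    have : secondDiff (fun η => starRingEnd ℂ (μ η)) t η = starRingEnd ℂ (secondDiff μ t η) := by
      unfold secondDiff
      simp only [map_add, map_sub, map_mul, map_ofNat]
    rw [this, RCLike.norm_conj]
    exact h.second η t ht hne

/-! ### Packing of dyadic intervals -/

/-- The half-open dyadic interval of length `2 ^ e` and position `a`. -/
def dyIco (e a : ℤ) : Set ℝ := Set.Ico ((2 : ℝ) ^ e * a) ((2 : ℝ) ^ e * (a + 1))

theorem measurableSet_dyIco (e a : ℤ) : MeasurableSet (dyIco e a) := measurableSet_Ico

theorem volume_real_dyIco (e a : ℤ) : (volume : Measure ℝ).real (dyIco e a) = (2 : ℝ) ^ e := by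
  have : (0 : ℝ) < 2 ^ e := by positivity
  rw [dyIco, Real.volume_real_Ico_of_le (by nlinarith)]
  ring

theorem left_mem_dyIco (e a : ℤ) : (2 : ℝ) ^ e * a ∈ dyIco e a := by
  have : (0 : ℝ) < 2 ^ e := by positivity
  exact ⟨le_rfl, by nlinarith⟩

theorem eq_of_mem_dyIco {e a b : ℤ} {x : ℝ} (ha : x ∈ dyIco e a) (hb : x ∈ dyIco e b) :
    a = b := by
  have hp : (0 : ℝ) < 2 ^ e := by positivity
  have h1 : (2 : ℝ) ^ e * a < (2 : ℝ) ^ e * (b + 1) := ha.1.trans_lt hb.2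
  have h2 : (2 : ℝ) ^ e * b < (2 : ℝ) ^ e * (a + 1) := hb.1.trans_lt ha.2
  have h3 : (a : ℝ) < b + 1 := lt_of_mul_lt_mul_left h1 hp.le
  have h4 : (b : ℝ) < a + 1 := lt_of_mul_lt_mul_left h2 hp.le
  norm_cast at h3 h4
  omega

/-- The function `(1 + |u|) ^ (-3 / 2)`. -/
def decay (u : ℝ) : ℝ := (1 + |u|)⁻¹ * √(1 + |u|)⁻¹

theorem decay_pos (u : ℝ) : 0 < decay u := by
  unfold decay
  positivity

theorem decay_neg (u : ℝ) : decay (-u) = decay u := by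
  unfold decay
  rw [abs_neg]

theorem decay_le_mul {u v A r : ℝ} (hA : 0 ≤ A) (hr : A ≤ r ^ 2) (hr0 : 0 ≤ r)
    (h : 1 + |v| ≤ A * (1 + |u|)) :
    decay u ≤ A * r * decay v := by
  unfold decay
  have h1 : (1 + |u|)⁻¹ ≤ A * (1 + |v|)⁻¹ := by
    rw [inv_le_iff_one_le_mul₀ (by positivity), mul_assoc, mul_comm, mul_assoc, ← div_eq_inv_mul,
      one_le_div (by positivity)]
    linarith
  have h2 : √(1 + |u|)⁻¹ ≤ r * √(1 + |v|)⁻¹ := by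
    apply Real.sqrt_le_iff.mpr
    constructor
    · positivity
    · rw [mul_pow, Real.sq_sqrt (by positivity)]
      exact h1.trans (by gcongr)
  calc _ ≤ (A * (1 + |v|)⁻¹) * (r * √(1 + |v|)⁻¹) := by gcongr
    _ = _ := by ring

theorem integrable_decay : Integrable decay := by
  have h := integrable_one_add_norm (E := ℝ) (μ := volume) (r := 3 / 2) (by simp; norm_num)
  refine h.congr (Filter.Eventually.of_forall fun u => ?_)
  simp only [decay, Real.norm_eq_abs]
  have hp : 0 < 1 + |u| := by positivity
  rw [Real.sqrt_inv, Real.sqrt_eq_rpow, ← Real.rpow_neg_one, ← Real.rpow_neg hp.le,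
    ← Real.rpow_add hp]
  norm_num

/-- The integral of `decay`. -/
def decayMass : ℝ := ∫ u, decay u

theorem decayMass_nonneg : 0 ≤ decayMass := integral_nonneg fun u => (decay_pos u).le

/-- On an interval of length at most `s` the function `decay ((x - y) / s)` varies by at most `2 √2
≤ 3`, so each term is at most three times an integral over its interval. The weighted overlap bound
`B` then leaves `3 B` times the integral of `decay ((x - y) / s)`. -/
theorem packing {ι : Type*} (t : Finset ι) (e a : ι → ℤ) (g : ι → ℝ) (hg : ∀ q ∈ t, 0 ≤ g q)
    {s B y : ℝ} (hs : ∀ q ∈ t, (2 : ℝ) ^ e q ≤ s) (hs0 : 0 < s)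
    (hB : ∀ x, ∑ q ∈ t, g q * (dyIco (e q) (a q)).indicator (fun _ => (1 : ℝ)) x ≤ B) :
    ∑ q ∈ t, g q * (2 : ℝ) ^ e q * decay (((2 : ℝ) ^ e q * a q - y) / s) ≤
      3 * decayMass * B * s := by
  have hB0 : 0 ≤ B := le_trans (Finset.sum_nonneg fun q hq =>
    mul_nonneg (hg q hq) (Set.indicator_nonneg (fun _ _ => zero_le_one) 0)) (hB 0)
  have hi : Integrable fun x => decay ((x - y) / s) :=
    (integrable_decay.comp_div hs0.ne').comp_sub_right y
  have hiv : ∫ x, decay ((x - y) / s) = s * decayMass := by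
    rw [integral_sub_right_eq_self (fun x => decay (x / s)), Measure.integral_comp_div decay,
      abs_of_pos hs0, smul_eq_mul, decayMass]
  have hterm : ∀ q ∈ t, g q * (2 : ℝ) ^ e q * decay (((2 : ℝ) ^ e q * a q - y) / s) ≤
      ∫ x, g q * (dyIco (e q) (a q)).indicator (fun _ => (1 : ℝ)) x * (3 * decay ((x - y) / s)) := by
    intro q hq
    have e1 : (fun x => g q * (dyIco (e q) (a q)).indicator (fun _ => (1 : ℝ)) x *
        (3 * decay ((x - y) / s))) =
        fun x => g q * (dyIco (e q) (a q)).indicator (fun x => 3 * decay ((x - y) / s)) x := by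
      ext x
      by_cases hx : x ∈ dyIco (e q) (a q) <;> simp [hx]
    rw [e1, integral_const_mul, integral_indicator (measurableSet_dyIco _ _), mul_assoc]
    refine mul_le_mul_of_nonneg_left ?_ (hg q hq)
    have e2 : (2 : ℝ) ^ e q * decay (((2 : ℝ) ^ e q * a q - y) / s) =
        ∫ _x in dyIco (e q) (a q), decay (((2 : ℝ) ^ e q * a q - y) / s) := by
      rw [setIntegral_const, volume_real_dyIco, smul_eq_mul]
    rw [e2]
    refine setIntegral_mono_on ?_ ((hi.const_mul 3).integrableOn) (measurableSet_dyIco _ _) ?_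
    · exact integrableOn_const (by simp [dyIco])
    · intro x hx
      have h2 : (2 : ℝ) * √2 ≤ 3 := by
        have : √2 ≤ 3 / 2 := by
          rw [Real.sqrt_le_left (by norm_num)]
          norm_num
        linarith
      refine (decay_le_mul (A := 2) (r := √2) (v := (x - y) / s) (by norm_num)
        (by rw [Real.sq_sqrt (by norm_num)]) (by positivity) ?_).trans
        (mul_le_mul_of_nonneg_right h2 (decay_pos _).le)
      rw [abs_div, abs_div, abs_of_pos hs0]
      have h3 : |x - y| ≤ |(2 : ℝ) ^ e q * a q - y| + s := by
        have : |x - (2 : ℝ) ^ e q * a q| ≤ s := by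
          rw [abs_of_nonneg (by linarith [hx.1])]
          have := hx.2
          linarith [hs q hq]
        calc |x - y| = |((2 : ℝ) ^ e q * a q - y) + (x - (2 : ℝ) ^ e q * a q)| := by ring_nf
          _ ≤ _ := (abs_add_le _ _).trans (by linarith)
      have h4 : |x - y| / s ≤ |(2 : ℝ) ^ e q * a q - y| / s + 1 := by
        rw [div_add_one hs0.ne']
        gcongr
      have : 0 ≤ |(2 : ℝ) ^ e q * a q - y| / s := by positivity
      linarith
  have hint : ∀ q ∈ t, Integrable fun x =>
      g q * (dyIco (e q) (a q)).indicator (fun _ => (1 : ℝ)) x * (3 * decay ((x - y) / s)) := by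
    intro q _
    have e1 : (fun x => g q * (dyIco (e q) (a q)).indicator (fun _ => (1 : ℝ)) x *
        (3 * decay ((x - y) / s))) =
        fun x => g q * (dyIco (e q) (a q)).indicator (fun x => 3 * decay ((x - y) / s)) x := by
      ext x
      by_cases hx : x ∈ dyIco (e q) (a q) <;> simp [hx]
    rw [e1]
    exact ((hi.const_mul 3).indicator (measurableSet_dyIco _ _)).const_mul _
  calc _ ≤ ∑ q ∈ t, ∫ x, g q * (dyIco (e q) (a q)).indicator (fun _ => (1 : ℝ)) x *
        (3 * decay ((x - y) / s)) := Finset.sum_le_sum hterm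
    _ = ∫ x, ∑ q ∈ t, g q * (dyIco (e q) (a q)).indicator (fun _ => (1 : ℝ)) x *
        (3 * decay ((x - y) / s)) := (integral_finsetSum t hint).symm
    _ ≤ ∫ x, B * (3 * decay ((x - y) / s)) := by
      refine integral_mono (integrable_finsetSum t hint) ((hi.const_mul 3).const_mul B) fun x => ?_
      simp only []
      rw [← Finset.sum_mul]
      exact mul_le_mul_of_nonneg_right (hB x) (by have := decay_pos ((x - y) / s); positivity)
    _ = _ := by
      rw [integral_const_mul, integral_const_mul, hiv]
      ring

/-- Grouped by scale, the sum is dominated by a geometric series of ratio `√(1/2) ≤ 3/4`, hence the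
factor `4`. -/
theorem sum_geometric_le {ι : Type*} (t : Finset ι) (e : ι → ℤ) (w : ι → ℝ) {B : ℝ} {E : ℤ}
    (hE : ∀ p ∈ t, e p ≤ E) (hB : ∀ e₀, ∑ p ∈ t with e p = e₀, w p ≤ B)
    (hw : ∀ p ∈ t, 0 ≤ w p) :
    ∑ p ∈ t, w p * √((2 : ℝ) ^ e p / (2 : ℝ) ^ E) ≤ 4 * B := by
  classical
  have hB0 : 0 ≤ B := le_trans (Finset.sum_nonneg fun p hp => hw p (Finset.mem_filter.mp hp).1)
    (hB E)
  rw [← Finset.sum_fiberwise_of_maps_to (g := e) (t := t.image e)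
    (fun p hp => Finset.mem_image_of_mem e hp)]
  have h1 : ∀ e₀ ∈ t.image e, ∑ p ∈ t with e p = e₀, w p * √((2 : ℝ) ^ e p / (2 : ℝ) ^ E) ≤
      B * (√(1 / 2)) ^ (E - e₀).toNat := by
    intro e₀ he
    obtain ⟨p₀, hp₀, rfl⟩ := Finset.mem_image.mp he
    have h2 : √((2 : ℝ) ^ e p₀ / (2 : ℝ) ^ E) = (√(1 / 2)) ^ (E - e p₀).toNat := by
      have hsq : ((1 : ℝ) / 2) ^ (E - e p₀).toNat = (√(1 / 2) ^ (E - e p₀).toNat) ^ 2 := by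
        rw [← pow_mul, mul_comm, pow_mul, Real.sq_sqrt (by norm_num)]
      rw [← Real.sqrt_sq (x := √(1 / 2) ^ (E - e p₀).toNat) (by positivity), ← hsq]
      congr 1
      rw [← zpow_sub₀ (by norm_num), one_div, inv_pow, ← zpow_natCast,
        Int.toNat_of_nonneg (by linarith [hE p₀ hp₀]), ← zpow_neg]
      congr 1
      ring
    calc _ = ∑ p ∈ t with e p = e p₀, w p * √((2 : ℝ) ^ e p₀ / (2 : ℝ) ^ E) := by
          refine Finset.sum_congr rfl fun p hp => ?_
          rw [(Finset.mem_filter.mp hp).2]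
      _ = (∑ p ∈ t with e p = e p₀, w p) * √((2 : ℝ) ^ e p₀ / (2 : ℝ) ^ E) :=
          (Finset.sum_mul _ _ _).symm
      _ ≤ _ := by
          rw [h2]
          exact mul_le_mul_of_nonneg_right (hB _) (by positivity)
  refine (Finset.sum_le_sum h1).trans ?_
  rw [← Finset.mul_sum, mul_comm 4]
  refine mul_le_mul_of_nonneg_left ?_ hB0
  have hinj : Set.InjOn (fun e₀ => (E - e₀).toNat) (t.image e : Set ℤ) := by
    intro x hx y hy hxy
    obtain ⟨p, hp, rfl⟩ := Finset.mem_image.mp (Finset.mem_coe.mp hx)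
    obtain ⟨q, hq, rfl⟩ := Finset.mem_image.mp (Finset.mem_coe.mp hy)
    have := hE p hp
    have := hE q hq
    simp only at hxy
    omega
  rw [← Finset.sum_image (s := t.image e) (g := fun e₀ => (E - e₀).toNat)
    (f := fun j => (√(1 / 2)) ^ j) hinj]
  have hr : √(1 / 2) ≤ (3 : ℝ) / 4 := by
    rw [Real.sqrt_le_left (by norm_num)]
    norm_num
  have hr1 : √(1 / 2) < (1 : ℝ) := by linarith
  refine ((summable_geometric_of_lt_one (by positivity) hr1).sum_le_tsum _
    fun _ _ => by positivity).trans ?_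
  rw [tsum_geometric_of_lt_one (by positivity) hr1]
  rw [inv_le_comm₀ (by linarith) (by norm_num)]
  linarith

/-- The Schur test, with the kernel split into two factors because rows and columns need different
weights when `p` and `q` have different scales. -/
theorem schur {ι : Type*} (t : Finset ι) (r : ι → ι → Prop) [DecidableRel r] (b : ι → ℝ)
    (k k₁ k₂ : ι → ι → ℝ) {M : ℝ} (h₁ : ∀ p q, 0 ≤ k₁ p q) (h₂ : ∀ p q, 0 ≤ k₂ p q)
    (hk : ∀ p q, k p q ^ 2 ≤ k₁ p q * k₂ p q)
    (hs₁ : ∀ p ∈ t, ∑ q ∈ t with r p q, k₁ p q ≤ M)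
    (hs₂ : ∀ q ∈ t, ∑ p ∈ t with r p q, k₂ p q ≤ M) :
    ∑ p ∈ t, ∑ q ∈ t with r p q, b p * b q * k p q ≤ M * ∑ p ∈ t, b p ^ 2 := by
  have hpt : ∀ p q, b p * b q * k p q ≤ 1 / 2 * (b p ^ 2 * k₁ p q) + 1 / 2 * (b q ^ 2 * k₂ p q) := by
    intro p q
    have s1 := Real.sq_sqrt (h₁ p q)
    have s2 := Real.sq_sqrt (h₂ p q)
    have hk' : |k p q| ≤ √(k₁ p q) * √(k₂ p q) := by
      rw [← Real.sqrt_mul (h₁ p q)]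
      exact Real.abs_le_sqrt (hk p q)
    have h3 : b p * b q * k p q ≤ (|b p| * √(k₁ p q)) * (|b q| * √(k₂ p q)) := by
      refine (le_abs_self _).trans ?_
      rw [abs_mul, abs_mul]
      calc |b p| * |b q| * |k p q| ≤ |b p| * |b q| * (√(k₁ p q) * √(k₂ p q)) := by gcongr
        _ = _ := by ring
    have h4 := two_mul_le_add_sq (|b p| * √(k₁ p q)) (|b q| * √(k₂ p q))
    rw [mul_pow, mul_pow, sq_abs, sq_abs, s1, s2] at h4
    linarith
  have e1 : ∑ p ∈ t, ∑ q ∈ t with r p q, 1 / 2 * (b p ^ 2 * k₁ p q) ≤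
      1 / 2 * (M * ∑ p ∈ t, b p ^ 2) := by
    simp_rw [← Finset.mul_sum]
    gcongr 1 / 2 * ?_
    rw [Finset.mul_sum]
    refine Finset.sum_le_sum fun p hp => ?_
    rw [mul_comm M]
    exact mul_le_mul_of_nonneg_left (hs₁ p hp) (sq_nonneg _)
  have e2 : ∑ p ∈ t, ∑ q ∈ t with r p q, 1 / 2 * (b q ^ 2 * k₂ p q) ≤
      1 / 2 * (M * ∑ p ∈ t, b p ^ 2) := by
    rw [Finset.sum_comm' (t' := t) (s' := fun q => t.filter fun p => r p q)
      (by intro x y; simp only [Finset.mem_filter]; tauto)]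
    simp_rw [← Finset.mul_sum]
    gcongr 1 / 2 * ?_
    rw [Finset.mul_sum]
    refine Finset.sum_le_sum fun p hp => ?_
    rw [mul_comm M]
    exact mul_le_mul_of_nonneg_left (hs₂ p hp) (sq_nonneg _)
  calc _ ≤ ∑ p ∈ t, ∑ q ∈ t with r p q,
        (1 / 2 * (b p ^ 2 * k₁ p q) + 1 / 2 * (b q ^ 2 * k₂ p q)) :=
        Finset.sum_le_sum fun p _ => Finset.sum_le_sum fun q _ => hpt p q
    _ ≤ _ := by
        simp_rw [Finset.sum_add_distrib]
        linarith

/-! ### Pairs of wave packets -/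

theorem inner_multOp_eq_zero {m m' : ℝ → ℂ} (hm : MemLp m ∞ (volume : Measure ℝ))
    (hm' : MemLp m' ∞ (volume : Measure ℝ)) (h : ∀ η, m η = 0 ∨ m' η = 0)
    (f g : Lp ℂ 2 (volume : Measure ℝ)) : ⟪multOp m hm f, multOp m' hm' g⟫ = 0 := by
  rw [inner_multOp]
  rw [← integral_zero ℝ ℂ (μ := volume)]
  congr 1
  ext η
  rcases h η with h | h <;> simp [h]

theorem norm_inner_multOp_le_of_norm_le {m m' : ℝ → ℂ} (hm : MemLp m ∞ (volume : Measure ℝ))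
    (hm' : MemLp m' ∞ (volume : Measure ℝ)) {M : ℝ} (h : ∀ η, ‖conj (m η) * m' η‖ ≤ M)
    (f g : Lp ℂ 2 (volume : Measure ℝ)) :
    ‖⟪multOp m hm f, multOp m' hm' g⟫‖ ≤ M * (‖f‖ * ‖g‖) := by
  have hc : MemLp (fun η => conj (m η)) ∞ (volume : Measure ℝ) := hm.star
  have hp : MemLp (fun η => conj (m η) * m' η) ∞ (volume : Measure ℝ) :=
    memLp_top_of_bound (hc.aestronglyMeasurable.mul hm'.aestronglyMeasurable) M
      (Filter.Eventually.of_forall h)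
  rw [inner_multOp_conj _ m hc hm (fun η => by simp), multOp_multOp hc hm' hp fun _ => rfl]
  refine (norm_inner_le_norm _ _).trans ?_
  calc ‖f‖ * ‖multOp _ hp g‖ ≤ ‖f‖ * (M * ‖g‖) := by
        gcongr
        exact norm_multOp_le hp h g
    _ = _ := by ring

theorem integrable_and_integral_norm_le {F : Lp ℂ 2 (volume : Measure ℝ)} {e a : ℤ}
    (hF : ∀ᵐ x, x ∉ dyIco e a → F x = 0) :
    Integrable (F : ℝ → ℂ) ∧ ∫ x, ‖F x‖ ≤ √((2 : ℝ) ^ e) * ‖F‖ := by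
  have hind : (F : ℝ → ℂ) =ᵐ[volume] (dyIco e a).indicator F := by
    filter_upwards [hF] with x hx
    by_cases h : x ∈ dyIco e a
    · rw [Set.indicator_of_mem h]
    · rw [Set.indicator_of_notMem h, hx h]
  have hfin : (volume : Measure ℝ) (dyIco e a) ≠ ∞ := by simp [dyIco]
  have hon : IntegrableOn (F : ℝ → ℂ) (dyIco e a) := by
    have : IsFiniteMeasure ((volume : Measure ℝ).restrict (dyIco e a)) := ⟨by
      rw [Measure.restrict_apply_univ]; exact hfin.lt_top⟩
    exact ((Lp.memLp F).restrict _).integrable (by norm_num)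
  have hint : Integrable (F : ℝ → ℂ) :=
    ((integrable_indicator_iff (measurableSet_dyIco e a)).mpr hon).congr hind.symm
  refine ⟨hint, ?_⟩
  have h1 : ∫ x, ‖F x‖ = ∫ x, (dyIco e a).indicator (fun _ => (1 : ℝ)) x * ‖F x‖ := by
    apply integral_congr_ae
    filter_upwards [hF] with x hx
    by_cases h : x ∈ dyIco e a
    · rw [Set.indicator_of_mem h, one_mul]
    · rw [Set.indicator_of_notMem h, hx h, norm_zero, mul_zero]
  have hm1 : MemLp ((dyIco e a).indicator (fun _ => (1 : ℝ))) 2 (volume : Measure ℝ) :=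
    memLp_indicator_const 2 (measurableSet_dyIco e a) 1 (Or.inr hfin)
  have h2 := integral_mul_le_Lp_mul_Lq_of_nonneg (μ := (volume : Measure ℝ))
    (p := 2) (q := 2) (f := (dyIco e a).indicator (fun _ => (1 : ℝ))) (g := fun x => ‖F x‖)
    (by constructor <;> norm_num)
    (Filter.Eventually.of_forall fun x => Set.indicator_nonneg (fun _ _ => zero_le_one) x)
    (Filter.Eventually.of_forall fun x => norm_nonneg _)
    (by simpa using hm1) (by simpa using (Lp.memLp F).norm)
  rw [h1]
  refine h2.trans (le_of_eq ?_)
  congr 1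
  · rw [Real.sqrt_eq_rpow]
    congr 1
    rw [← volume_real_dyIco e a, ← integral_indicator_one (measurableSet_dyIco e a)]
    congr 1
    ext x
    by_cases h : x ∈ dyIco e a <;> simp [h]
  · rw [← Real.sqrt_eq_rpow, Lp.norm_def, (Lp.memLp F).eLpNorm_eq_integral_rpow_norm (by norm_num)
      (by norm_num), ENNReal.toReal_ofReal (by positivity), Real.sqrt_eq_rpow]
    norm_num

/-- The kernel bound is paired with `L¹` norms; Cauchy–Schwarz on the two carrying intervals
converts them to `L²` norms. -/
theorem IsKink.norm_inner_le {w c ξ w' c' ξ' D Γ d : ℝ} {σ : ℤˣ} {μ ν : ℝ → ℂ}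
    (hμ : IsKink w c ξ σ μ) (hν : IsKink w' c' ξ' σ ν) (hw : 0 < w) (hw' : 0 < w')
    (hD : |c - ξ| ≤ D * w) (hΓ : |c - ξ'| + w ≤ Γ * w') (hd : 0 < d) (hdw : 1 ≤ 2 * d * w)
    {F G : Lp ℂ 2 (volume : Measure ℝ)} {e a e' a' : ℤ}
    (hF : ∀ᵐ x, x ∉ dyIco e a → F x = 0) (hG : ∀ᵐ x, x ∉ dyIco e' a' → G x = 0)
    (hdist : ∀ x ∈ dyIco e a, ∀ y ∈ dyIco e' a', d ≤ |x - y|) :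
    ‖⟪multOp μ (hμ.memLp hw) F, multOp ν (hν.memLp hw') G⟫‖ ≤
      (250 + 20 * D) * Γ * (d⁻¹ * √d⁻¹ * (√w)⁻¹) *
        (√((2 : ℝ) ^ e) * ‖F‖ * (√((2 : ℝ) ^ e') * ‖G‖)) := by
  have hD0 : 0 ≤ D := by
    by_contra h0
    nlinarith [abs_nonneg (c - ξ)]
  have hΓ0 : 0 < Γ := by
    by_contra h0
    nlinarith [abs_nonneg (c - ξ')]
  obtain ⟨iF, nF⟩ := integrable_and_integral_norm_le hF
  obtain ⟨iG, nG⟩ := integrable_and_integral_norm_le hG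
  have hD' : |c' - ξ'| ≤ (|c' - ξ'| / w') * w' := by rw [div_mul_cancel₀ _ hw'.ne']
  have hκ : Integrable fun η => conj (μ η) * ν η :=
    (hμ.conj.integrable hw).mul_bdd (c := 5 + |c' - ξ'| / w') hν.meas.aestronglyMeasurable
      (Filter.Eventually.of_forall fun η => hν.norm_le hw' hD' η)
  refine (norm_inner_multOp_le (hμ.memLp hw) (hν.memLp hw') iF iG hκ hF hG fun x hx y hy =>
    hμ.norm_kernel_le hν hw hw' hD hΓ hd hdw (hdist x hx y hy)).trans ?_
  gcongr

/-- On the support of `μ` one has `|η - ξ'| ≤ 5 w + |c - ξ'|`, so the vanishing of `ν` at `ξ'` gives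
`‖ν‖ ≤ 5 Γ` there. The gain `Γ` is thus present even for packets that overlap in space. -/
theorem IsKink.norm_inner_le_trivial {w c ξ w' c' ξ' D Γ : ℝ} {σ : ℤˣ} {μ ν : ℝ → ℂ}
    (hμ : IsKink w c ξ σ μ) (hν : IsKink w' c' ξ' σ ν) (hw : 0 < w) (hw' : 0 < w')
    (hD : |c - ξ| ≤ D * w) (hΓ : |c - ξ'| + w ≤ Γ * w')
    (F G : Lp ℂ 2 (volume : Measure ℝ)) :
    ‖⟪multOp μ (hμ.memLp hw) F, multOp ν (hν.memLp hw') G⟫‖ ≤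
      (25 + 5 * D) * Γ * (‖F‖ * ‖G‖) := by
  have hD0 : 0 ≤ D := by
    by_contra h0
    nlinarith [abs_nonneg (c - ξ)]
  have hΓ0 : 0 < Γ := by
    by_contra h0
    nlinarith [abs_nonneg (c - ξ')]
  refine norm_inner_multOp_le_of_norm_le _ _ (fun η => ?_) F G
  by_cases h0 : μ η = 0
  · rw [h0, map_zero, zero_mul, norm_zero]
    positivity
  · rw [norm_mul, RCLike.norm_conj]
    have h1 : ‖ν η‖ ≤ 5 * Γ := by
      refine (hν.bound η).trans ?_
      rw [div_le_iff₀ hw']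
      have := (hμ.supp η h0).1
      calc |η - ξ'| = |(η - c) + (c - ξ')| := by ring_nf
        _ ≤ _ := (abs_add_le _ _).trans (by nlinarith [abs_nonneg (c - ξ')])
    calc ‖μ η‖ * ‖ν η‖ ≤ (5 + D) * (5 * Γ) := by
          gcongr
          exact hμ.norm_le hw hD η
      _ = _ := by ring

/-! ### The almost orthogonality estimate -/

/-- A finite family of wave packets, at the scales `2 ^ e p`, grouped into trees `l p`, with the
order and disjointness relations produced by a greedy selection. -/
structure PacketFamily (ι L : Type*) [Fintype ι] [LinearOrder L] (σ : ℤˣ) (V D B Λ : ℝ) (n : ℤ)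
    (f : Lp ℂ 2 (volume : Measure ℝ)) where
  e : ι → ℤ
  a : ι → ℤ
  c : ι → ℝ
  ξ : ι → ℝ
  l : ι → L
  width : L → ℤ
  ctr : L → ℝ
  ν : ι → ℝ → ℂ
  F : ι → Lp ℂ 2 (volume : Measure ℝ)
  one_le_V : 1 ≤ V
  D_nonneg : 0 ≤ D
  Λ_nonneg : 0 ≤ Λ
  kink : ∀ p, IsKink (V / 2 ^ e p) (c p) (ξ p) σ (ν p)
  dual : ∀ p (h : MemLp (ν p) ∞ (volume : Measure ℝ)),
    ⟪multOp (ν p) h (F p), f⟫ = ((‖F p‖ ^ 2 : ℝ) : ℂ)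
  supp : ∀ p, ∀ᵐ x, x ∉ dyIco (e p) (a p + n) → F p x = 0
  near : ∀ p, |c p - ξ p| ≤ D * (V / 2 ^ e p)
  sep : ∀ p q, l p < l q → e q < e p → |c p - c q| ≤ 20 * (V / 2 ^ e q) →
    ∀ x ∈ dyIco (e q) (a q), (4 * |(n : ℝ)| + 3) * 2 ^ width (l p) ≤ |x - ctr (l p)|
  order : ∀ p q, l q ≤ l p → ((σ : ℤ) : ℝ) * ξ p ≤ ((σ : ℤ) : ℝ) * ξ q + V / 2 ^ e p
  count : ∀ (e₀ a₀ : ℤ) (y : ℝ) (t : Finset ι),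
    (∀ q ∈ t, e q = e₀ ∧ a q = a₀ ∧ |c q - y| ≤ (D + 20) * (V / 2 ^ e₀)) → (t.card : ℝ) ≤ B
  size : ∀ p, ‖F p‖ ≤ Λ * √(2 ^ e p)
  e_le : ∀ p, e p ≤ width (l p)
  inside : ∀ p, ∀ x ∈ dyIco (e p) (a p), |x - ctr (l p)| ≤ 2 ^ width (l p) / 2
  same : ∀ p q, l p = l q → ξ p = ξ q

namespace PacketFamily

variable {ι L : Type*} [Fintype ι] [LinearOrder L] {σ : ℤˣ} {V D B Λ : ℝ} {n : ℤ}
  {f : Lp ℂ 2 (volume : Measure ℝ)} (P : PacketFamily ι L σ V D B Λ n f)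

include P in
theorem V_pos : 0 < V := lt_of_lt_of_le one_pos P.one_le_V

/-- The frequency width of a packet. -/
def w (p : ι) : ℝ := V / 2 ^ P.e p

theorem w_pos (p : ι) : 0 < P.w p := by
  have := P.V_pos
  unfold w
  positivity

theorem w_le_of_lt {p q : ι} (h : P.e q ≤ P.e p) : P.w p ≤ P.w q := by
  have := P.V_pos
  have h2 : (2 : ℝ) ^ P.e q ≤ 2 ^ P.e p := zpow_le_zpow_right₀ (by norm_num) h
  unfold w
  gcongr

theorem w_mul (p q : ι) : P.w p = (2 : ℝ) ^ P.e q / 2 ^ P.e p * P.w q := by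
  unfold w
  field_simp

/-- The dual function of a packet. -/
def T (p : ι) : Lp ℂ 2 (volume : Measure ℝ) := multOp (P.ν p) ((P.kink p).memLp (P.w_pos p)) (P.F p)

/-- The left end point of the shifted spatial interval of a packet. -/
def pt (p : ι) : ℝ := 2 ^ P.e p * ((P.a p + n : ℤ) : ℝ)

/-- Two packets interact. -/
def Rel (p q : ι) : Prop := ∃ η, P.ν p η ≠ 0 ∧ P.ν q η ≠ 0

theorem inner_eq_zero {p q : ι} (h : ¬ P.Rel p q) : ⟪P.T p, P.T q⟫ = 0 := by
  refine inner_multOp_eq_zero _ _ (fun η => ?_) _ _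
  by_contra hc
  push Not at hc
  exact h ⟨η, hc⟩

theorem Rel.abs_sub_le {P : PacketFamily ι L σ V D B Λ n f} {p q : ι} (h : P.Rel p q) :
    |P.c p - P.c q| ≤ 5 * P.w p + 5 * P.w q := by
  obtain ⟨η, h1, h2⟩ := h
  have e1 := ((P.kink p).supp η h1).1
  have e2 := ((P.kink q).supp η h2).1
  rw [abs_sub_comm] at e1
  calc |P.c p - P.c q| = |(P.c p - η) + (η - P.c q)| := by ring_nf
    _ ≤ _ := (abs_add_le _ _).trans (add_le_add e1 e2)

/-- Only `V ≥ 1` is used, through `1 / w p ≤ 2 ^ e p`; this keeps the constants independent of the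
direction `v`. -/
theorem norm_inner_le_far {p q : ι} {Γ d : ℝ}
    (hΓ : |P.c p - P.ξ q| + P.w p ≤ Γ * P.w q) (hd : 0 < d) (hdw : 2 ^ P.e p ≤ 2 * d)
    (hdist : ∀ x ∈ dyIco (P.e p) (P.a p + n), ∀ y ∈ dyIco (P.e q) (P.a q + n), d ≤ |x - y|) :
    ‖⟪P.T p, P.T q⟫‖ ≤ (250 + 20 * D) * Γ * (d⁻¹ * √d⁻¹) * (2 ^ P.e p * √(2 ^ P.e q)) *
      (‖P.F p‖ * ‖P.F q‖) := by
  have hD0 := P.D_nonneg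
  have hΓ0 : 0 < Γ := by
    by_contra h0
    nlinarith [abs_nonneg (P.c p - P.ξ q), P.w_pos p, P.w_pos q]
  have hp : (0 : ℝ) < 2 ^ P.e p := by positivity
  have hinv : (P.w p)⁻¹ ≤ 2 ^ P.e p := by
    unfold w
    rw [inv_div]
    exact div_le_self hp.le P.one_le_V
  have h1 : 1 ≤ 2 * d * P.w p := by
    have := (inv_le_iff_one_le_mul₀ (P.w_pos p)).mp hinv
    nlinarith [P.w_pos p]
  have h2 := (P.kink p).norm_inner_le (P.kink q) (P.w_pos p) (P.w_pos q) (P.near p) hΓ hd h1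
    (P.supp p) (P.supp q) hdist
  refine h2.trans ?_
  have h3 : (√(P.w p))⁻¹ ≤ √(2 ^ P.e p) := by
    rw [← Real.sqrt_inv]
    exact Real.sqrt_le_sqrt hinv
  change (250 + 20 * D) * Γ * (d⁻¹ * √d⁻¹ * (√(P.w p))⁻¹) * _ ≤ _
  calc _ ≤ (250 + 20 * D) * Γ * (d⁻¹ * √d⁻¹ * √(2 ^ P.e p)) *
        (√(2 ^ P.e p) * ‖P.F p‖ * (√(2 ^ P.e q) * ‖P.F q‖)) := by gcongr
    _ = (250 + 20 * D) * Γ * (d⁻¹ * √d⁻¹) * ((√(2 ^ P.e p) * √(2 ^ P.e p)) * √(2 ^ P.e q)) *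
      (‖P.F p‖ * ‖P.F q‖) := by ring
    _ = _ := by rw [Real.mul_self_sqrt hp.le]

/-- If the left end points are within twice the length of the larger interval, `decay` is at least
`1/6` and the trivial bound suffices. Otherwise the intervals are at least half as far apart as
their end points, and the kernel bound is of order `(2 ^ e p / Δ) ^ (3/2)`. -/
theorem norm_inner_le_decay {p q : ι} {Γ : ℝ} (he : P.e q ≤ P.e p)
    (hΓ : |P.c p - P.ξ q| + P.w p ≤ Γ * P.w q) :
    ‖⟪P.T p, P.T q⟫‖ ≤ (1500 + 120 * D) * Γ * decay ((P.pt q - P.pt p) / 2 ^ P.e p) *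
      (‖P.F p‖ * ‖P.F q‖) := by
  have hD0 := P.D_nonneg
  have hΓ0 : 0 < Γ := by
    by_contra h0
    nlinarith [abs_nonneg (P.c p - P.ξ q), P.w_pos p, P.w_pos q]
  have hp : (0 : ℝ) < 2 ^ P.e p := by positivity
  have hq : (0 : ℝ) < 2 ^ P.e q := by positivity
  have hqp : (2 : ℝ) ^ P.e q ≤ 2 ^ P.e p := zpow_le_zpow_right₀ (by norm_num) he
  set s : ℝ := 2 ^ P.e p with hs
  set Δ := |P.pt q - P.pt p| with hΔ
  have hdec : decay ((P.pt q - P.pt p) / s) = (1 + Δ / s)⁻¹ * √(1 + Δ / s)⁻¹ := by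
    unfold decay
    rw [abs_div, abs_of_pos hp]
  have hsq3 : (1 : ℝ) / 2 ≤ √(1 / 3) := by
    apply Real.le_sqrt_of_sq_le
    norm_num
  rcases le_or_gt Δ (2 * s) with hc | hc
  · refine ((P.kink p).norm_inner_le_trivial (P.kink q) (P.w_pos p) (P.w_pos q) (P.near p) hΓ
      (P.F p) (P.F q)).trans ?_
    have h1 : (1 : ℝ) / 6 ≤ decay ((P.pt q - P.pt p) / s) := by
      rw [hdec]
      have h3 : (1 : ℝ) / 3 ≤ (1 + Δ / s)⁻¹ := by
        rw [one_div]
        have : Δ / s ≤ 2 := (div_le_iff₀ hp).mpr hc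
        gcongr
        linarith
      calc (1 : ℝ) / 6 = 1 / 3 * (1 / 2) := by norm_num
        _ ≤ (1 + Δ / s)⁻¹ * √(1 + Δ / s)⁻¹ := by
          gcongr
          exact hsq3.trans (Real.sqrt_le_sqrt h3)
    calc (25 + 5 * D) * Γ * (‖P.F p‖ * ‖P.F q‖)
        ≤ ((1500 + 120 * D) * (1 / 6)) * Γ * (‖P.F p‖ * ‖P.F q‖) := by
          gcongr
          linarith
      _ = (1500 + 120 * D) * Γ * (1 / 6) * (‖P.F p‖ * ‖P.F q‖) := by ring
      _ ≤ _ := by gcongr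
  · have hd : 0 < Δ / 2 := by linarith
    refine (P.norm_inner_le_far hΓ hd (by rw [← hs]; linarith) ?_).trans ?_
    · intro x hx y hy
      have hx1 : P.pt p ≤ x := hx.1
      have hx2 : x < P.pt p + s := by
        have := hx.2
        unfold pt
        linarith
      have hy1 : P.pt q ≤ y := hy.1
      have hy2 : y < P.pt q + s := by
        have := hy.2
        unfold pt
        linarith
      rcases le_total (P.pt q) (P.pt p) with h | h
      · rw [hΔ, abs_of_nonpos (by linarith)] at hc ⊢
        have := le_abs_self (x - y)
        linarith
      · rw [hΔ, abs_of_nonneg (by linarith)] at hc ⊢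
        have := neg_abs_le (x - y)
        linarith
    · rw [← hs]
      gcongr ?_ * (‖P.F p‖ * ‖P.F q‖)
      have hsr : √(2 ^ P.e q) ≤ √s := Real.sqrt_le_sqrt hqp
      have e1 : (Δ / 2)⁻¹ * √(Δ / 2)⁻¹ * (s * √s) = (2 * s / Δ) * √(2 * s / Δ) := by
        rw [show (2 * s / Δ) = (Δ / 2)⁻¹ * s by rw [inv_div]; ring,
          Real.sqrt_mul (by positivity)]
        ring
      have e2 : (2 * s / Δ) * √(2 * s / Δ) ≤ 6 * decay ((P.pt q - P.pt p) / s) := by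
        rw [hdec]
        have h5 : 1 / 3 * (2 * s / Δ) ≤ (1 + Δ / s)⁻¹ := by
          have : (1 + Δ / s)⁻¹ = s / (s + Δ) := by field_simp
          rw [this]
          have h6 : 0 < Δ := by linarith
          rw [show 1 / 3 * (2 * s / Δ) = 2 * s / (3 * Δ) by field_simp,
            div_le_div_iff₀ (by positivity) (by positivity)]
          nlinarith
        have h6 : 1 / 2 * √(2 * s / Δ) ≤ √(1 + Δ / s)⁻¹ := by
          calc 1 / 2 * √(2 * s / Δ) ≤ √(1 / 3) * √(2 * s / Δ) := by gcongr
            _ = √(1 / 3 * (2 * s / Δ)) := (Real.sqrt_mul (by norm_num) _).symm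
            _ ≤ _ := Real.sqrt_le_sqrt h5
        have h7 : 0 ≤ 2 * s / Δ := by positivity
        calc _ = 6 * ((1 / 3 * (2 * s / Δ)) * (1 / 2 * √(2 * s / Δ))) := by ring
          _ ≤ 6 * ((1 + Δ / s)⁻¹ * √(1 + Δ / s)⁻¹) := by gcongr
      calc (250 + 20 * D) * Γ * ((Δ / 2)⁻¹ * √(Δ / 2)⁻¹) * (s * √(2 ^ P.e q))
          ≤ (250 + 20 * D) * Γ * ((Δ / 2)⁻¹ * √(Δ / 2)⁻¹) * (s * √s) := by gcongr
        _ = (250 + 20 * D) * Γ * ((2 * s / Δ) * √(2 * s / Δ)) := by rw [← e1]; ring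
        _ ≤ (250 + 20 * D) * Γ * (6 * decay ((P.pt q - P.pt p) / s)) := by gcongr
        _ = _ := by ring

/-! #### Counting -/

include P in
theorem B_nonneg : 0 ≤ B := by simpa using P.count 0 0 0 ∅ (by simp)

/-- Intervals of one scale that contain `x` coincide, so the multiplicity bound `count` applies to
them. -/
theorem sum_indicator_le (t : Finset ι) (e₀ : ℤ) (y : ℝ) (k : ℤ)
    (h : ∀ q ∈ t, P.e q = e₀ ∧ |P.c q - y| ≤ (D + 20) * P.w q) (x : ℝ) :
    ∑ q ∈ t, (dyIco (P.e q) (P.a q + k)).indicator (fun _ => (1 : ℝ)) x ≤ B := by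
  classical
  have e1 : ∀ q ∈ t, (dyIco (P.e q) (P.a q + k)).indicator (fun _ => (1 : ℝ)) x =
      if x ∈ dyIco (P.e q) (P.a q + k) then 1 else 0 := fun q _ => by
    rw [Set.indicator_apply]
  rw [Finset.sum_congr rfl e1, Finset.sum_boole]
  rcases (t.filter fun q => x ∈ dyIco (P.e q) (P.a q + k)).eq_empty_or_nonempty with h0 | ⟨q₀, hq₀⟩
  · rw [h0]
    simpa using P.B_nonneg
  · obtain ⟨m0, x0⟩ := Finset.mem_filter.mp hq₀
    refine P.count e₀ (P.a q₀) y _ fun q hq => ?_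
    obtain ⟨m1, x1⟩ := Finset.mem_filter.mp hq
    obtain ⟨a1, b1⟩ := h q m1
    obtain ⟨a0, b0⟩ := h q₀ m0
    refine ⟨a1, ?_, ?_⟩
    · rw [a1] at x1
      rw [a0] at x0
      have := eq_of_mem_dyIco x1 x0
      omega
    · unfold w at b1
      rwa [a1] at b1

theorem sum_sqrt_indicator_le (t : Finset ι) {E : ℤ} (y : ℝ) (k : ℤ) (hE : ∀ q ∈ t, P.e q ≤ E)
    (h : ∀ q ∈ t, |P.c q - y| ≤ (D + 20) * P.w q) (x : ℝ) :
    ∑ q ∈ t, √(2 ^ P.e q / 2 ^ E) *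
      (dyIco (P.e q) (P.a q + k)).indicator (fun _ => (1 : ℝ)) x ≤ 4 * B := by
  have := sum_geometric_le t P.e
    (fun q => (dyIco (P.e q) (P.a q + k)).indicator (fun _ => (1 : ℝ)) x) (B := B) hE
    (fun e₀ => P.sum_indicator_le _ e₀ y k (fun q hq => by
      obtain ⟨m, e⟩ := Finset.mem_filter.mp hq
      exact ⟨e, h q m⟩) x)
    (fun q _ => Set.indicator_nonneg (fun _ _ => zero_le_one) x)
  refine le_trans (le_of_eq ?_) this
  exact Finset.sum_congr rfl fun q _ => mul_comm _ _

theorem sum_decay_le (t : Finset ι) (e₀ : ℤ) (y z : ℝ)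
    (h : ∀ q ∈ t, P.e q = e₀ ∧ |P.c q - y| ≤ (D + 20) * P.w q) :
    ∑ q ∈ t, decay ((P.pt q - z) / 2 ^ e₀) ≤ 3 * decayMass * B := by
  have hp : (0 : ℝ) < 2 ^ e₀ := by positivity
  have := packing t P.e (fun q => P.a q + n) (fun _ => 1) (fun _ _ => zero_le_one) (s := 2 ^ e₀)
    (B := B) (y := z) (fun q hq => by rw [(h q hq).1]) hp (fun x => by
      simpa using P.sum_indicator_le t e₀ y n h x)
  refine le_of_mul_le_mul_right ?_ hp
  refine le_trans (le_of_eq ?_) this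
  rw [Finset.sum_mul]
  refine Finset.sum_congr rfl fun q hq => ?_
  simp only [one_mul]
  rw [(h q hq).1, mul_comm]
  unfold pt
  rw [(h q hq).1]

/-! #### Packets of the same scale -/

-- Interacting packets of equal scale have frequency centers within ten widths, so `Γ = 11 + D` will
-- do. No gain is needed: the spatial decay alone makes the symmetric kernel summable.
open Classical in
theorem sum_same_scale :
    ∑ p, ∑ q with P.e q = P.e p, ‖⟪P.T p, P.T q⟫‖ ≤
      (1500 + 120 * D) * (11 + D) * (3 * decayMass * B) * ∑ p, ‖P.F p‖ ^ 2 := by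
  have hD0 := P.D_nonneg
  set A := (1500 + 120 * D) * (11 + D) with hA
  have hA0 : 0 ≤ A := by positivity
  have h1 : ∑ p, ∑ q with P.e q = P.e p, ‖⟪P.T p, P.T q⟫‖ ≤
      ∑ p, ∑ q with (P.e q = P.e p ∧ P.Rel p q), ‖P.F p‖ * ‖P.F q‖ *
        (A * decay ((P.pt q - P.pt p) / 2 ^ P.e p)) := by
    refine Finset.sum_le_sum fun p _ => ?_
    rw [← Finset.filter_filter, Finset.sum_filter (fun q => P.Rel p q)]
    refine Finset.sum_le_sum fun q hq => ?_
    have hq' := (Finset.mem_filter.mp hq).2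
    split_ifs with hr
    · have hww : P.w q = P.w p := by unfold w; rw [hq']
      have := P.norm_inner_le_decay (p := p) (q := q) (Γ := 11 + D) hq'.le (by
        have e1 := hr.abs_sub_le
        have e2 : |P.c q - P.ξ q| ≤ D * P.w q := P.near q
        rw [hww] at e1 e2 ⊢
        have : |P.c p - P.ξ q| ≤ |P.c p - P.c q| + |P.c q - P.ξ q| := abs_sub_le _ _ _
        linarith)
      linarith
    · rw [P.inner_eq_zero hr, norm_zero]
  have hsum : ∀ p, ∑ q with (P.e q = P.e p ∧ P.Rel p q),
      A * decay ((P.pt q - P.pt p) / 2 ^ P.e p) ≤ A * (3 * decayMass * B) := by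
    intro p
    rw [← Finset.mul_sum]
    refine mul_le_mul_of_nonneg_left ?_ hA0
    refine P.sum_decay_le _ (P.e p) (P.c p) (P.pt p) fun q hq => ?_
    obtain ⟨e1, hr⟩ := (Finset.mem_filter.mp hq).2
    refine ⟨e1, ?_⟩
    have hww : P.w q = P.w p := by unfold w; rw [e1]
    have e1 := hr.abs_sub_le
    rw [abs_sub_comm, hww] at e1
    rw [hww]
    nlinarith [P.w_pos p]
  refine h1.trans ?_
  refine schur Finset.univ (fun p q => P.e q = P.e p ∧ P.Rel p q) (fun p => ‖P.F p‖)
    (fun p q => A * decay ((P.pt q - P.pt p) / 2 ^ P.e p))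
    (fun p q => A * decay ((P.pt q - P.pt p) / 2 ^ P.e p))
    (fun p q => A * decay ((P.pt q - P.pt p) / 2 ^ P.e p))
    (fun p q => mul_nonneg hA0 (decay_pos _).le) (fun p q => mul_nonneg hA0 (decay_pos _).le)
    (fun p q => (sq _).le) (fun p _ => hsum p) (fun q _ => ?_)
  refine le_trans (le_of_eq ?_) (hsum q)
  have hfil : (Finset.univ.filter fun p => P.e q = P.e p ∧ P.Rel p q) =
      Finset.univ.filter fun p => P.e p = P.e q ∧ P.Rel q p := by
    refine Finset.filter_congr fun p _ => ?_
    constructor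
    · rintro ⟨h1, η, h2, h3⟩
      exact ⟨h1.symm, η, h3, h2⟩
    · rintro ⟨h1, η, h2, h3⟩
      exact ⟨h1.symm, η, h3, h2⟩
  rw [hfil]
  refine Finset.sum_congr rfl fun p hp => ?_
  rw [← (Finset.mem_filter.mp hp).2.1, ← decay_neg, ← neg_div, neg_sub]

/-! #### Packets of smaller scale in earlier trees -/

/-- Here the one-sidedness of the symbols meets the order of selection. A frequency shared by `p`
and `q` lies on the `σ`-side of `ξ q`, which bounds `σ ξ q` above in terms of `p`; the order bounds
it below in terms of `ξ p'`, which is near `c p' ≈ c p`. It is used with `p' = p` in `sum_earlier`,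
and with `p'` a packet of a later tree in `sum_gain_indicator_le`. -/
theorem abs_sub_le_of_le {p q p' : ι} (hr : P.Rel p q) (hl : P.l q ≤ P.l p')
    (hr' : P.Rel p p') (he : P.e p' ≤ P.e p) :
    |P.ξ q - P.c p| ≤ (D + 11) * P.w p' := by
  obtain ⟨η, h1, h2⟩ := hr
  have e1 := ((P.kink p).supp η h1).1
  have e2 := ((P.kink q).supp η h2).2
  have e3 := P.order p' q hl
  have e4 : |P.c p' - P.ξ p'| ≤ D * P.w p' := P.near p'
  have e5 := hr'.abs_sub_le
  have e6 : P.w p ≤ P.w p' := P.w_le_of_lt he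
  have hD := P.D_nonneg
  have hw := P.w_pos p'
  change _ ≤ _ + P.w p' at e3
  change |η - P.c p| ≤ 5 * P.w p at e1
  change 0 < ((σ : ℤ) : ℝ) * (η - P.ξ q) at e2
  rw [abs_le] at e1 e4 e5 ⊢
  rcases Int.units_eq_one_or σ with rfl | rfl
  · simp only [Units.val_one, Int.cast_one, one_mul] at e2 e3
    constructor <;> nlinarith
  · simp only [Units.val_neg, Units.val_one, Int.cast_neg, Int.cast_one] at e2 e3
    constructor <;> nlinarith

-- As `ξ q` is within `O(w p)` of `c p` and the symbol of `q` vanishes at `ξ q`, the pairing gains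
-- `ρ = 2 ^ e q / 2 ^ e p`. The Schur weights split `ρ²` as `ρ ^ (3/2) * ρ ^ (1/2)`. For fixed `p`,
-- one factor `ρ` is absorbed by packing the small intervals; for fixed `q`, the packets `p` of one
-- scale are already summable by `decay`. In both cases the remaining `√ρ` sums over the scales.
open Classical in
theorem sum_earlier :
    ∑ p, ∑ q with (P.e q < P.e p ∧ P.l q ≤ P.l p), ‖⟪P.T p, P.T q⟫‖ ≤
      (1500 + 120 * D) * (D + 12) * (12 * decayMass * B) * ∑ p, ‖P.F p‖ ^ 2 := by
  have hD0 := P.D_nonneg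
  have hB0 := P.B_nonneg
  have hm0 := decayMass_nonneg
  set A := (1500 + 120 * D) * (D + 12) with hA
  have hA0 : 0 ≤ A := by positivity
  set R : ι → ι → Prop := fun p q => (P.e q < P.e p ∧ P.l q ≤ P.l p) ∧ P.Rel p q with hR
  set dec : ι → ι → ℝ := fun p q => decay ((P.pt q - P.pt p) / 2 ^ P.e p) with hdec
  set ρ : ι → ι → ℝ := fun p q => 2 ^ P.e q / 2 ^ P.e p with hρ
  have hdec0 : ∀ p q, 0 ≤ dec p q := fun p q => (decay_pos _).le
  have hρ0 : ∀ p q, 0 ≤ ρ p q := fun p q => by rw [hρ]; positivity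
  have hclose : ∀ p q, R p q → |P.ξ q - P.c p| ≤ (D + 11) * P.w p := fun p q h =>
    P.abs_sub_le_of_le h.2 h.1.2 (p' := p) (by
      obtain ⟨η, h1, -⟩ := h.2
      exact ⟨η, h1, h1⟩) le_rfl
  have h1 : ∑ p, ∑ q with (P.e q < P.e p ∧ P.l q ≤ P.l p), ‖⟪P.T p, P.T q⟫‖ ≤
      ∑ p, ∑ q with R p q, ‖P.F p‖ * ‖P.F q‖ * (A * (ρ p q * dec p q)) := by
    refine Finset.sum_le_sum fun p _ => ?_
    have hfil : (Finset.univ.filter fun q => R p q) =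
        (Finset.univ.filter fun q => P.e q < P.e p ∧ P.l q ≤ P.l p).filter
          fun q => P.Rel p q := by
      rw [Finset.filter_filter]
    rw [hfil, Finset.sum_filter (fun q => P.Rel p q)]
    refine Finset.sum_le_sum fun q hq => ?_
    have hq' := (Finset.mem_filter.mp hq).2
    split_ifs with hr
    · have := P.norm_inner_le_decay (p := p) (q := q) (Γ := (D + 12) * ρ p q) hq'.1.le (by
        have e1 := hclose p q ⟨hq', hr⟩
        have e2 := P.w_mul p q
        rw [abs_sub_comm] at e1
        rw [mul_assoc, ← e2]
        linarith)
      calc _ ≤ _ := this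
        _ = _ := by rw [hA]; ring
    · rw [P.inner_eq_zero hr, norm_zero]
  have hs1 : ∀ p, ∑ q with R p q, A * (ρ p q * √(ρ p q) * dec p q) ≤
      A * (12 * decayMass * B) := by
    intro p
    rw [← Finset.mul_sum]
    refine mul_le_mul_of_nonneg_left ?_ hA0
    have hp : (0 : ℝ) < 2 ^ P.e p := by positivity
    have := packing (Finset.univ.filter fun q => R p q) P.e (fun q => P.a q + n)
      (fun q => √(ρ p q)) (fun _ _ => by positivity) (s := 2 ^ P.e p) (B := 4 * B) (y := P.pt p)
      (fun q hq => zpow_le_zpow_right₀ (by norm_num) (Finset.mem_filter.mp hq).2.1.1.le) hp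
      (P.sum_sqrt_indicator_le _ (P.c p) n
        (fun q hq => (Finset.mem_filter.mp hq).2.1.1.le) (fun q hq => by
        obtain ⟨h1, hr⟩ := (Finset.mem_filter.mp hq).2
        have e1 := hr.abs_sub_le
        have e2 := P.w_le_of_lt h1.1.le
        rw [abs_sub_comm] at e1
        nlinarith [P.w_pos q]))
    refine le_of_mul_le_mul_right ?_ hp
    refine le_trans (le_of_eq ?_) (this.trans (le_of_eq ?_))
    · rw [Finset.sum_mul]
      refine Finset.sum_congr rfl fun q _ => ?_
      rw [hdec, hρ]
      simp only [pt]
      field_simp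
    · ring
  have hs2 : ∀ q, ∑ p with R p q, A * (√(ρ p q) * dec p q) ≤ A * (12 * decayMass * B) := by
    intro q
    rw [← Finset.mul_sum]
    refine mul_le_mul_of_nonneg_left ?_ hA0
    have := sum_geometric_le (Finset.univ.filter fun p => R p q) (fun p => - P.e p)
      (fun p => dec p q) (B := 3 * decayMass * B) (E := - P.e q)
      (fun p hp => neg_le_neg (Finset.mem_filter.mp hp).2.1.1.le)
      (fun e₀ => by
        have := P.sum_decay_le ((Finset.univ.filter fun p => R p q).filter fun p => - P.e p = e₀)
          (-e₀) (P.ξ q) (P.pt q) (fun p hp => by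
            obtain ⟨hp1, hp2⟩ := Finset.mem_filter.mp hp
            refine ⟨by linarith, ?_⟩
            have := hclose p q (Finset.mem_filter.mp hp1).2
            rw [abs_sub_comm] at this
            nlinarith [P.w_pos p])
        refine le_trans (le_of_eq ?_) this
        refine Finset.sum_congr rfl fun p hp => ?_
        rw [hdec, ← (Finset.mem_filter.mp hp).2, neg_neg, ← decay_neg, ← neg_div, neg_sub])
      (fun p _ => hdec0 p q)
    refine le_trans (le_of_eq ?_) (this.trans (le_of_eq (by ring)))
    refine Finset.sum_congr rfl fun p _ => ?_
    rw [hρ, mul_comm]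
    simp only
    congr 2
    rw [zpow_neg, zpow_neg]
    field_simp
  refine h1.trans ?_
  refine schur Finset.univ R (fun p => ‖P.F p‖) (fun p q => A * (ρ p q * dec p q))
    (fun p q => A * (ρ p q * √(ρ p q) * dec p q)) (fun p q => A * (√(ρ p q) * dec p q))
    (fun p q => mul_nonneg hA0 (mul_nonneg (mul_nonneg (hρ0 p q) (Real.sqrt_nonneg _))
      (hdec0 p q)))
    (fun p q => mul_nonneg hA0 (mul_nonneg (Real.sqrt_nonneg _) (hdec0 p q)))
    (fun p q => le_of_eq ?_) (fun p _ => hs1 p) (fun q _ => hs2 q)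
  have : ρ p q = √(ρ p q) * √(ρ p q) := (Real.mul_self_sqrt (hρ0 p q)).symm
  calc (A * (ρ p q * dec p q)) ^ 2 = A ^ 2 * dec p q ^ 2 * ρ p q * ρ p q := by ring
    _ = A ^ 2 * dec p q ^ 2 * ρ p q * (√(ρ p q) * √(ρ p q)) := by rw [← this]
    _ = _ := by ring

/-! #### Packets of smaller scale in later trees -/

/-- The size of the second symbol of a pair on the support of the first one. -/
def gain (p q : ι) : ℝ := (|P.c p - P.ξ q| + P.w p) / P.w q

theorem gain_nonneg (p q : ι) : 0 ≤ P.gain p q := by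
  have := P.w_pos p
  have := P.w_pos q
  unfold gain
  positivity

open Classical in
/-- The packets of smaller scale, in later trees, interacting with `p`. -/
def later (p : ι) : Finset ι :=
  Finset.univ.filter fun q => (P.e q < P.e p ∧ P.l p < P.l q) ∧ P.Rel p q

theorem mem_later {p q : ι} :
    q ∈ P.later p ↔ (P.e q < P.e p ∧ P.l p < P.l q) ∧ P.Rel p q := by
  simp [later]

theorem abs_sub_le_of_mem_later {p q : ι} (h : q ∈ P.later p) :
    |P.c q - P.c p| ≤ 10 * P.w q := by
  obtain ⟨⟨h1, -⟩, hr⟩ := P.mem_later.mp h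
  have e1 := hr.abs_sub_le
  have e2 := P.w_le_of_lt h1.le
  rw [abs_sub_comm] at e1
  linarith

/-- Let `q₁` be of maximal scale among the packets over `x`. A packet `q` over `x` of smaller scale
cannot belong to a later tree than `q₁`, since `sep` would then place `x` outside the top interval
of the tree of `q₁`. Hence `abs_sub_le_of_le` with `p' = q₁` puts `ξ q` within `O(w q₁)` of `c p`,
and the gain decays geometrically in the scale of `q`. The order relation missing between `p` and
`q` is thus supplied by `q₁`. -/
theorem sum_gain_indicator_le (p : ι) (x : ℝ) :
    ∑ q ∈ P.later p, P.gain p q * (dyIco (P.e q) (P.a q)).indicator (fun _ => (1 : ℝ)) x ≤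
      4 * (D + 12) * B := by
  classical
  have hD0 := P.D_nonneg
  have hB0 := P.B_nonneg
  set Z := (P.later p).filter fun q => x ∈ dyIco (P.e q) (P.a q) with hZ
  have e0 : ∑ q ∈ P.later p, P.gain p q *
      (dyIco (P.e q) (P.a q)).indicator (fun _ => (1 : ℝ)) x = ∑ q ∈ Z, P.gain p q := by
    rw [hZ, Finset.sum_filter]
    refine Finset.sum_congr rfl fun q _ => ?_
    rw [Set.indicator_apply]
    split_ifs <;> simp
  rw [e0]
  rcases Z.eq_empty_or_nonempty with h0 | hne
  · rw [h0, Finset.sum_empty]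
    positivity
  obtain ⟨q₁, hq₁, hmax⟩ := Z.exists_max_image P.e hne
  obtain ⟨m₁, x₁⟩ := Finset.mem_filter.mp hq₁
  obtain ⟨⟨a₁, b₁⟩, r₁⟩ := P.mem_later.mp m₁
  have hg : ∀ q ∈ Z, P.gain p q ≤ (D + 12) * √(2 ^ P.e q / 2 ^ P.e q₁) := by
    intro q hq
    obtain ⟨m, hx⟩ := Finset.mem_filter.mp hq
    obtain ⟨⟨a, b⟩, r⟩ := P.mem_later.mp m
    have hwq := P.w_pos q
    have hle := hmax q hq
    have hwp : P.w p ≤ P.w q₁ := P.w_le_of_lt a₁.le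
    set ρ : ℝ := 2 ^ P.e q / 2 ^ P.e q₁ with hρ
    have hρ0 : 0 < ρ := by positivity
    have hρ1 : ρ ≤ 1 := by
      rw [hρ, div_le_one (by positivity)]
      exact zpow_le_zpow_right₀ (by norm_num) hle
    have hρs : ρ ≤ √ρ := by
      apply Real.le_sqrt_of_sq_le
      nlinarith
    have hw1 : P.w q₁ = ρ * P.w q := P.w_mul q₁ q
    have hw1pos := P.w_pos q₁
    have key : |P.c p - P.ξ q| ≤ (D + 11) * P.w q₁ := by
      rcases eq_or_lt_of_le hle with heq | hlt
      · have hww : P.w q = P.w q₁ := by unfold w; rw [heq]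
        have e1 := P.abs_sub_le_of_mem_later m
        have e2 : |P.c q - P.ξ q| ≤ D * P.w q := P.near q
        rw [abs_sub_comm, hww] at e1
        rw [hww] at e2
        have : |P.c p - P.ξ q| ≤ |P.c p - P.c q| + |P.c q - P.ξ q| := abs_sub_le _ _ _
        linarith
      · have hl : P.l q ≤ P.l q₁ := by
          by_contra hc
          push Not at hc
          have e1 := P.abs_sub_le_of_mem_later m
          have e2 := P.abs_sub_le_of_mem_later m₁
          have e3 : |P.c q₁ - P.c q| ≤ |P.c q₁ - P.c p| + |P.c p - P.c q| := abs_sub_le _ _ _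
          rw [abs_sub_comm (P.c p)] at e3
          have e4 := P.w_le_of_lt hlt.le
          have h1 := P.sep q₁ q hc hlt (by change _ ≤ 20 * P.w q; linarith) x hx
          have h2 := P.inside q₁ x x₁
          have h3 : (0 : ℝ) < 2 ^ P.width (P.l q₁) := by positivity
          nlinarith [abs_nonneg (n : ℝ), mul_nonneg (abs_nonneg (n : ℝ)) h3.le]
        rw [abs_sub_comm]
        exact P.abs_sub_le_of_le r hl r₁ a₁.le
    unfold gain
    rw [div_le_iff₀ hwq]
    calc |P.c p - P.ξ q| + P.w p ≤ (D + 12) * P.w q₁ := by linarith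
      _ = (D + 12) * ρ * P.w q := by rw [hw1]; ring
      _ ≤ (D + 12) * √ρ * P.w q := by gcongr
  have hs := P.sum_sqrt_indicator_le Z (E := P.e q₁) (P.c p) 0 hmax (fun q hq => by
    have := P.abs_sub_le_of_mem_later (Finset.mem_filter.mp hq).1
    nlinarith [P.w_pos q]) x
  have e1 : ∀ q ∈ Z, (dyIco (P.e q) (P.a q + 0)).indicator (fun _ => (1 : ℝ)) x = 1 :=
    fun q hq => by
      rw [add_zero, Set.indicator_of_mem (Finset.mem_filter.mp hq).2]
  rw [Finset.sum_congr rfl fun q hq => by rw [e1 q hq, mul_one]] at hs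
  calc _ ≤ ∑ q ∈ Z, (D + 12) * √(2 ^ P.e q / 2 ^ P.e q₁) := Finset.sum_le_sum hg
    _ = (D + 12) * ∑ q ∈ Z, √(2 ^ P.e q / 2 ^ P.e q₁) := (Finset.mul_sum _ _ _).symm
    _ ≤ (D + 12) * (4 * B) := by gcongr
    _ = _ := by ring

/-- Separation is known for the unshifted intervals, while the packets live on their `n`-th
translates. The constant `4 |n| + 3` in `sep` leaves room for both translations, each by at most
`|n| W`, and for the half width of the top interval. With `‖F‖ ≤ Λ √(2 ^ e)` inserted, the kernel
decay provides the power `(2 ^ e p / W) ^ (3/2)`. -/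
theorem norm_inner_le_later {p q : ι} (h : q ∈ P.later p) :
    ‖⟪P.T p, P.T q⟫‖ ≤ 3 * (250 + 20 * D) * Λ ^ 2 *
      (2 ^ P.e p / 2 ^ P.width (P.l p) * √(2 ^ P.e p / 2 ^ P.width (P.l p))) *
      (P.gain p q * 2 ^ P.e q *
        decay ((2 ^ P.e q * P.a q - P.ctr (P.l p)) / 2 ^ P.width (P.l p))) := by
  obtain ⟨⟨h1, h2⟩, hr⟩ := P.mem_later.mp h
  have hD0 := P.D_nonneg
  have hΛ0 := P.Λ_nonneg
  have hg0 := P.gain_nonneg p q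
  set W : ℝ := 2 ^ P.width (P.l p) with hW
  set X := P.ctr (P.l p) with hX
  set s : ℝ := 2 ^ P.e p with hs
  set r : ℝ := 2 ^ P.e q with hrdef
  have hW0 : 0 < W := by positivity
  have hs0 : 0 < s := by positivity
  have hr0 : 0 < r := by positivity
  have hrs : r ≤ s := zpow_le_zpow_right₀ (by norm_num) h1.le
  have hsW : s ≤ W := zpow_le_zpow_right₀ (by norm_num) (P.e_le p)
  set u := (r * P.a q - X) / W with hu
  -- This lower bound for the distance of the translated intervals equals `W (1 + |u|) / 2`, so `d ^
  -- (-3/2)` is a multiple of `W ^ (-3/2) * decay u`.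
  set d := (W + |r * P.a q - X|) / 2 with hd
  have hd0 : 0 < d := by positivity
  have hdu : d = W * (1 + |u|) / 2 := by
    rw [hd, hu, abs_div, abs_of_pos hW0]
    field_simp
  have hΓ : |P.c p - P.ξ q| + P.w p ≤ P.gain p q * P.w q := by
    unfold gain
    rw [div_mul_cancel₀ _ (P.w_pos q).ne']
  have hfar := P.norm_inner_le_far (p := p) (q := q) hΓ hd0
    (by rw [← hs, hd]; linarith [abs_nonneg (r * P.a q - X)]) (by
      intro x hx y hy
      have hx0 : x - n * s ∈ dyIco (P.e p) (P.a p) := by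
        have e1 := hx.1
        have e2 := hx.2
        push_cast at e1 e2
        constructor
        · rw [← hs] at e1 ⊢; linarith
        · rw [← hs] at e2 ⊢; linarith
      have hy0 : y - n * r ∈ dyIco (P.e q) (P.a q) := by
        have e1 := hy.1
        have e2 := hy.2
        push_cast at e1 e2
        constructor
        · rw [← hrdef] at e1 ⊢; linarith
        · rw [← hrdef] at e2 ⊢; linarith
      have e1 := P.inside p _ hx0
      have e2 := P.sep p q h2 h1 (by
        have := P.abs_sub_le_of_mem_later h
        rw [abs_sub_comm] at this
        change _ ≤ 20 * P.w q
        linarith [P.w_pos q]) _ hy0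
      rw [← hW, ← hX] at e1 e2
      have e3 : |r * P.a q - X| ≤ |y - n * r - X| + r := by
        have t1 : |r * P.a q - (y - n * r)| ≤ r := by
          have a1 := hy0.1
          have a2 := hy0.2
          rw [← hrdef] at a1 a2
          rw [abs_le]
          constructor <;> linarith
        have := abs_sub_le (r * P.a q) (y - n * r) X
        linarith
      have e4 : |y - n * r - X| ≤ |x - y| + |x - n * s - X| + |(n : ℝ)| * s + |(n : ℝ)| * r := by
        have t1 : y - n * r - X = -(x - y) + (x - n * s - X) + n * s - n * r := by ring
        rw [t1]
        have t2 : |(n : ℝ)| * s = |n * s| := by rw [abs_mul, abs_of_pos hs0]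
        have t3 : |(n : ℝ)| * r = |n * r| := by rw [abs_mul, abs_of_pos hr0]
        rw [t2, t3]
        have u1 := abs_sub (-(x - y) + (x - n * s - X) + n * s) (n * r)
        have u2 := abs_add_le (-(x - y) + (x - n * s - X)) (n * s)
        have u3 := abs_add_le (-(x - y)) (x - n * s - X)
        rw [abs_neg] at u3
        linarith
      have hn := abs_nonneg (n : ℝ)
      have e5 : |(n : ℝ)| * s ≤ |(n : ℝ)| * W := by gcongr
      have e6 : |(n : ℝ)| * r ≤ |(n : ℝ)| * W := by
        gcongr
        exact hrs.trans hsW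
      rw [hd]
      linarith)
  refine hfar.trans ?_
  have hdd : d⁻¹ * √d⁻¹ ≤ 3 * (W⁻¹ * √W⁻¹) * decay u := by
    have t1 : d⁻¹ = 2 * (W⁻¹ * (1 + |u|)⁻¹) := by
      rw [hdu, inv_div, div_eq_mul_inv, mul_inv]
    have t2 : √d⁻¹ = √2 * (√W⁻¹ * √(1 + |u|)⁻¹) := by
      rw [t1, Real.sqrt_mul (by norm_num), Real.sqrt_mul (by positivity)]
    have t3 : (2 : ℝ) * √2 ≤ 3 := by
      have : √2 ≤ 3 / 2 := by
        rw [Real.sqrt_le_left (by norm_num)]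
        norm_num
      linarith
    calc d⁻¹ * √d⁻¹ = 2 * √2 * (W⁻¹ * √W⁻¹) * decay u := by
          rw [t2, t1, decay]
          ring
      _ ≤ _ := by
          have := (decay_pos u).le
          gcongr
  have hFF : ‖P.F p‖ * ‖P.F q‖ ≤ (Λ * √s) * (Λ * √r) := by
    have := P.size p
    have := P.size q
    gcongr
  have hss : √(s / W) = √s * √W⁻¹ := by rw [div_eq_mul_inv, Real.sqrt_mul hs0.le]
  have hrr : √r * √r = r := Real.mul_self_sqrt hr0.le
  have hdec := (decay_pos u).le
  calc (250 + 20 * D) * P.gain p q * (d⁻¹ * √d⁻¹) * (s * √r) * (‖P.F p‖ * ‖P.F q‖)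
      ≤ (250 + 20 * D) * P.gain p q * (3 * (W⁻¹ * √W⁻¹) * decay u) * (s * √r) *
          ((Λ * √s) * (Λ * √r)) := by gcongr
    _ = 3 * (250 + 20 * D) * Λ ^ 2 * (s / W * (√s * √W⁻¹)) *
          (P.gain p q * (√r * √r) * decay u) := by ring
    _ = _ := by rw [hrr, ← hss]

-- For fixed `p`, `packing` at the scale `W` of the top interval sums the later packets to `O(W)`,
-- which turns `(s / W) ^ (3/2)` with `s = 2 ^ e p` into `s √(s / W)`. The packets of one tree share
-- `ξ`, and packing them inside the top interval gives `O(W)` again.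
open Classical in
theorem sum_later :
    ∑ p, ∑ q with (P.e q < P.e p ∧ P.l p < P.l q), ‖⟪P.T p, P.T q⟫‖ ≤
      (36 * (250 + 20 * D) * (D + 12) * decayMass * B) * (72 * decayMass * B) *
        (Λ ^ 2 * ∑ l ∈ Finset.univ.image P.l, (2 : ℝ) ^ P.width l) := by
  have hD0 := P.D_nonneg
  have hB0 := P.B_nonneg
  have hm0 := decayMass_nonneg
  set A := 36 * (250 + 20 * D) * (D + 12) * decayMass * B with hA
  have hA0 : 0 ≤ A := by positivity
  set g : ι → ℝ := fun p => √(2 ^ P.e p / 2 ^ P.width (P.l p)) with hgdef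
  have h1 : ∀ p, ∑ q with (P.e q < P.e p ∧ P.l p < P.l q), ‖⟪P.T p, P.T q⟫‖ ≤
      A * Λ ^ 2 * (g p * 2 ^ P.e p) := by
    intro p
    have hW0 : (0 : ℝ) < 2 ^ P.width (P.l p) := by positivity
    have e1 : ∑ q with (P.e q < P.e p ∧ P.l p < P.l q), ‖⟪P.T p, P.T q⟫‖ =
        ∑ q ∈ P.later p, ‖⟪P.T p, P.T q⟫‖ := by
      symm
      refine Finset.sum_subset (fun q hq => ?_) fun q hq hn => ?_
      · exact Finset.mem_filter.mpr ⟨Finset.mem_univ _, (P.mem_later.mp hq).1⟩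
      · rw [P.inner_eq_zero fun hr =>
          hn (P.mem_later.mpr ⟨(Finset.mem_filter.mp hq).2, hr⟩), norm_zero]
    have hpack := packing (P.later p) P.e P.a (fun q => P.gain p q)
      (fun q _ => P.gain_nonneg p q) (s := 2 ^ P.width (P.l p)) (B := 4 * (D + 12) * B)
      (y := P.ctr (P.l p))
      (fun q hq => zpow_le_zpow_right₀ (by norm_num)
        ((P.mem_later.mp hq).1.1.le.trans (P.e_le p))) hW0 (P.sum_gain_indicator_le p)
    rw [e1]
    refine (Finset.sum_le_sum fun q hq => P.norm_inner_le_later hq).trans ?_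
    rw [← Finset.mul_sum]
    calc _ ≤ 3 * (250 + 20 * D) * Λ ^ 2 *
          (2 ^ P.e p / 2 ^ P.width (P.l p) * √(2 ^ P.e p / 2 ^ P.width (P.l p))) *
          (3 * decayMass * (4 * (D + 12) * B) * 2 ^ P.width (P.l p)) := by gcongr
      _ = A * Λ ^ 2 * (g p * (2 ^ P.e p / 2 ^ P.width (P.l p) * 2 ^ P.width (P.l p))) := by
          rw [hA, hgdef]; ring
      _ = _ := by rw [div_mul_cancel₀ _ hW0.ne']
  have h2 : ∀ l, ∑ p with P.l p = l, g p * 2 ^ P.e p ≤ 72 * decayMass * B * 2 ^ P.width l := by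
    intro l
    have hW0 : (0 : ℝ) < 2 ^ P.width l := by positivity
    rcases (Finset.univ.filter fun p => P.l p = l).eq_empty_or_nonempty with h0 | ⟨p₀, hp₀⟩
    · rw [h0, Finset.sum_empty]
      positivity
    have hl₀ := (Finset.mem_filter.mp hp₀).2
    have hpack := packing (Finset.univ.filter fun p => P.l p = l) P.e P.a g
      (fun p _ => Real.sqrt_nonneg _) (s := 2 ^ P.width l) (B := 4 * B) (y := P.ctr l)
      (fun p hp => zpow_le_zpow_right₀ (by norm_num)
        (by rw [← (Finset.mem_filter.mp hp).2]; exact P.e_le p)) hW0 (fun x => by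
        have := P.sum_sqrt_indicator_le (Finset.univ.filter fun p => P.l p = l) (E := P.width l)
          (P.ξ p₀) 0
          (fun p hp => by rw [← (Finset.mem_filter.mp hp).2]; exact P.e_le p)
          (fun p hp => by
            have h := P.near p
            rw [P.same p p₀ ((Finset.mem_filter.mp hp).2.trans hl₀.symm)] at h
            change _ ≤ D * P.w p at h
            nlinarith [P.w_pos p]) x
        refine le_trans (le_of_eq ?_) this
        refine Finset.sum_congr rfl fun p hp => ?_
        rw [add_zero, hgdef]
        simp only
        rw [(Finset.mem_filter.mp hp).2])
    have h6 : ∀ p ∈ Finset.univ.filter (fun p => P.l p = l), g p * 2 ^ P.e p ≤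
        6 * (g p * 2 ^ P.e p * decay ((2 ^ P.e p * P.a p - P.ctr l) / 2 ^ P.width l)) := by
      intro p hp
      have hl := (Finset.mem_filter.mp hp).2
      have hin := P.inside p _ (left_mem_dyIco _ _)
      rw [hl] at hin
      have hdec : (1 : ℝ) / 6 ≤ decay ((2 ^ P.e p * P.a p - P.ctr l) / 2 ^ P.width l) := by
        unfold decay
        rw [abs_div, abs_of_pos hW0]
        have t1 : |2 ^ P.e p * P.a p - P.ctr l| / 2 ^ P.width l ≤ 1 / 2 := by
          rw [div_le_iff₀ hW0]
          linarith
        have t2 : (1 : ℝ) / 3 ≤ (1 + |2 ^ P.e p * P.a p - P.ctr l| / 2 ^ P.width l)⁻¹ := by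
          rw [one_div]
          gcongr
          linarith
        have t3 : (1 : ℝ) / 2 ≤ √(1 / 3) := by
          apply Real.le_sqrt_of_sq_le
          norm_num
        calc (1 : ℝ) / 6 = 1 / 3 * (1 / 2) := by norm_num
          _ ≤ _ := by
            gcongr
            exact t3.trans (Real.sqrt_le_sqrt t2)
      have hgp : 0 ≤ g p * 2 ^ P.e p := by positivity
      nlinarith
    calc _ ≤ _ := Finset.sum_le_sum h6
      _ ≤ _ := by
        rw [← Finset.mul_sum]
        linarith
  calc _ ≤ ∑ p, A * Λ ^ 2 * (g p * 2 ^ P.e p) := Finset.sum_le_sum fun p _ => h1 p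
    _ = A * Λ ^ 2 * ∑ l ∈ Finset.univ.image P.l, ∑ p with P.l p = l, g p * 2 ^ P.e p := by
        rw [← Finset.mul_sum, Finset.sum_fiberwise_of_maps_to
          (fun p _ => Finset.mem_image_of_mem _ (Finset.mem_univ p))]
    _ ≤ A * Λ ^ 2 * ∑ l ∈ Finset.univ.image P.l, 72 * decayMass * B * 2 ^ P.width l := by
        gcongr with l _
        exact h2 l
    _ = _ := by
        rw [← Finset.mul_sum]
        ring

/-- The constant in the almost orthogonality estimate. -/
def _root_.PhasePlane.orthoConst (D B : ℝ) : ℝ :=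
  (1500 + 120 * D) * (11 + D) * (3 * decayMass * B) +
  2 * ((1500 + 120 * D) * (D + 12) * (12 * decayMass * B)) +
  2 * ((36 * (250 + 20 * D) * (D + 12) * decayMass * B) * (72 * decayMass * B))

/-- The almost orthogonality estimate for wave packets. -/
theorem sq_sum_norm_sq_le :
    (∑ p, ‖P.F p‖ ^ 2) ^ 2 ≤ ‖f‖ ^ 2 * (orthoConst D B *
      (∑ p, ‖P.F p‖ ^ 2 + Λ ^ 2 * ∑ l ∈ Finset.univ.image P.l, (2 : ℝ) ^ P.width l)) := by
  classical
  have hD0 := P.D_nonneg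
  have hB0 := P.B_nonneg
  have hm0 := decayMass_nonneg
  set S := ∑ p, ‖P.F p‖ ^ 2 with hS
  have hS0 : 0 ≤ S := Finset.sum_nonneg fun _ _ => sq_nonneg _
  set Wt := Λ ^ 2 * ∑ l ∈ Finset.univ.image P.l, (2 : ℝ) ^ P.width l with hWt
  have hW0 : 0 ≤ Wt := by positivity
  set Φ := ∑ p, P.T p with hΦ
  -- Duality: the packets were chosen so that each `T p` pairs with `f` to `‖F p‖²`.
  have h1 : ⟪Φ, f⟫ = (S : ℂ) := by
    rw [hΦ, sum_inner, hS]
    push_cast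
    refine Finset.sum_congr rfl fun p _ => ?_
    have := P.dual p ((P.kink p).memLp (P.w_pos p))
    push_cast at this
    exact this
  have h2 : S ≤ ‖Φ‖ * ‖f‖ := by
    have := norm_inner_le_norm (𝕜 := ℂ) Φ f
    rw [h1, Complex.norm_real, Real.norm_of_nonneg hS0] at this
    exact this
  have h3 : ‖Φ‖ ^ 2 ≤ ∑ p, ∑ q, ‖⟪P.T p, P.T q⟫‖ := by
    have e1 : ‖Φ‖ ^ 2 = ‖⟪Φ, Φ⟫‖ := by
      rw [inner_self_eq_norm_sq_to_K]
      simp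
    rw [e1, hΦ, sum_inner]
    refine (norm_sum_le _ _).trans (Finset.sum_le_sum fun p _ => ?_)
    rw [inner_sum]
    exact norm_sum_le _ _
  -- By symmetry `p` may be taken to have the larger scale, at the price of a factor `2` for unequal
  -- scales; those pairs are then split by the order of the trees.
  have h4 : ∑ p, ∑ q, ‖⟪P.T p, P.T q⟫‖ =
      ∑ p, ∑ q with P.e q = P.e p, ‖⟪P.T p, P.T q⟫‖ +
      2 * (∑ p, ∑ q with (P.e q < P.e p ∧ P.l q ≤ P.l p), ‖⟪P.T p, P.T q⟫‖) +
      2 * (∑ p, ∑ q with (P.e q < P.e p ∧ P.l p < P.l q), ‖⟪P.T p, P.T q⟫‖) := by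
    have a1 : ∑ p, ∑ q, ‖⟪P.T p, P.T q⟫‖ =
        ∑ p, ∑ q with P.e q = P.e p, ‖⟪P.T p, P.T q⟫‖ +
        ∑ p, ∑ q with P.e q < P.e p, ‖⟪P.T p, P.T q⟫‖ +
        ∑ p, ∑ q with P.e p < P.e q, ‖⟪P.T p, P.T q⟫‖ := by
      rw [← Finset.sum_add_distrib, ← Finset.sum_add_distrib]
      refine Finset.sum_congr rfl fun p _ => ?_
      rw [Finset.sum_filter, Finset.sum_filter, Finset.sum_filter, ← Finset.sum_add_distrib,
        ← Finset.sum_add_distrib]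
      refine Finset.sum_congr rfl fun q _ => ?_
      rcases lt_trichotomy (P.e q) (P.e p) with h | h | h
      · rw [if_neg h.ne, if_pos h, if_neg h.not_gt]; simp
      · rw [if_pos h, if_neg (by omega), if_neg (by omega)]; simp
      · rw [if_neg h.ne', if_neg h.not_gt, if_pos h]; simp
    have a2 : ∑ p, ∑ q with P.e p < P.e q, ‖⟪P.T p, P.T q⟫‖ =
        ∑ p, ∑ q with P.e q < P.e p, ‖⟪P.T p, P.T q⟫‖ := by
      rw [Finset.sum_comm' (t' := Finset.univ) (s' := fun q => Finset.univ.filter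
        fun p => P.e p < P.e q) (by simp)]
      refine Finset.sum_congr rfl fun p _ => Finset.sum_congr rfl fun q _ => ?_
      exact norm_inner_symm _ _
    have a3 : ∑ p, ∑ q with P.e q < P.e p, ‖⟪P.T p, P.T q⟫‖ =
        ∑ p, ∑ q with (P.e q < P.e p ∧ P.l q ≤ P.l p), ‖⟪P.T p, P.T q⟫‖ +
        ∑ p, ∑ q with (P.e q < P.e p ∧ P.l p < P.l q), ‖⟪P.T p, P.T q⟫‖ := by
      rw [← Finset.sum_add_distrib]
      refine Finset.sum_congr rfl fun p _ => ?_
      rw [← Finset.filter_filter, ← Finset.filter_filter]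
      simp_rw [← not_le]
      rw [Finset.sum_filter_add_sum_filter_not]
    rw [a1, a2, a3]
    ring
  have h5 : ∑ p, ∑ q, ‖⟪P.T p, P.T q⟫‖ ≤ orthoConst D B * (S + Wt) := by
    rw [h4]
    set M1 := (1500 + 120 * D) * (11 + D) * (3 * decayMass * B) with hM1
    set M2 := (1500 + 120 * D) * (D + 12) * (12 * decayMass * B) with hM2
    set M3 := (36 * (250 + 20 * D) * (D + 12) * decayMass * B) * (72 * decayMass * B) with hM3
    have b1 : _ ≤ M1 * S := P.sum_same_scale
    have b2 : _ ≤ M2 * S := P.sum_earlier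
    have b3 : _ ≤ M3 * Wt := P.sum_later
    have hM10 : 0 ≤ M1 := by positivity
    have hM20 : 0 ≤ M2 := by positivity
    have hM30 : 0 ≤ M3 := by positivity
    have : orthoConst D B = M1 + 2 * M2 + 2 * M3 := rfl
    rw [this]
    nlinarith [mul_nonneg hM10 hW0, mul_nonneg hM20 hW0, mul_nonneg hM30 hS0]
  calc S ^ 2 ≤ (‖Φ‖ * ‖f‖) ^ 2 := by gcongr
    _ = ‖f‖ ^ 2 * ‖Φ‖ ^ 2 := by ring
    _ ≤ _ := by
      gcongr
      exact h3.trans h5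

end PacketFamily

end PhasePlane
end

/-! ### Geometry of scales, cubes and tree tops; shadows. -/

noncomputable section

namespace PhasePlane

/-! ### Scales and dyadic intervals -/

theorem thousand_le_C0 {n : ℕ} (hn : 1 ≤ n) : (1000 : ℝ) ≤ C0 n := by
  have h : 1000 ≤ C0 n := by
    unfold C0
    calc 1000 ≤ 2 ^ 10 := by norm_num
      _ ≤ 2 ^ (100 * n) := Nat.pow_le_pow_right (by norm_num) (by omega)
  exact_mod_cast h

theorem C0_le_two_pow_K {n : ℕ} (hn : 1 ≤ n) : 100 * (C0 n : ℝ) ≤ 2 ^ K n := by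
  have h0 : 1000 ≤ C0 n := by exact_mod_cast thousand_le_C0 hn
  have h1 : 100 * C0 n ≤ K n := by
    unfold K
    have h2 : C0 n - 10 + 1 ≤ 2 ^ (C0 n - 10) := Nat.lt_two_pow_self
    have h3 : 2 ^ C0 n = 2 ^ 10 * 2 ^ (C0 n - 10) := by
      rw [← pow_add]
      congr 1
      omega
    rw [h3]
    omega
  have h2 : K n ≤ 2 ^ K n := Nat.lt_two_pow_self.le
  exact_mod_cast h1.trans h2

theorem zpow_mul_le_of_lt {n : ℕ} {e e' : ℤ} (he : (K n : ℤ) ∣ e) (he' : (K n : ℤ) ∣ e')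
    (h : e < e') : (2 : ℝ) ^ K n * 2 ^ e ≤ 2 ^ e' := by
  obtain ⟨a, rfl⟩ := he
  obtain ⟨b, rfl⟩ := he'
  have hab : a + 1 ≤ b := by
    have : a < b := lt_of_mul_lt_mul_left h (by positivity)
    omega
  rw [← zpow_natCast, ← zpow_add₀ (by norm_num)]
  apply zpow_le_zpow_right₀ (by norm_num)
  have := mul_le_mul_of_nonneg_left hab (Int.natCast_nonneg (K n))
  linarith

theorem DyadicIvl.toSet_eq (I : DyadicIvl) :
    I.ivl.toSet = Set.Icc ((2 : ℝ) ^ I.exp * I.pos) ((2 : ℝ) ^ I.exp * (I.pos + 1)) := by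
  unfold Ivl.toSet DyadicIvl.ivl
  congr 1 <;> ring

theorem DyadicIvl.len_pos (I : DyadicIvl) : 0 < I.ivl.len := by
  unfold DyadicIvl.ivl
  positivity

theorem DyadicIvl.subset_iff {I J : DyadicIvl} :
    I.ivl.toSet ⊆ J.ivl.toSet ↔ (2 : ℝ) ^ J.exp * J.pos ≤ (2 : ℝ) ^ I.exp * I.pos ∧
      (2 : ℝ) ^ I.exp * (I.pos + 1) ≤ (2 : ℝ) ^ J.exp * (J.pos + 1) := by
  have : (0 : ℝ) < 2 ^ I.exp := by positivity
  rw [DyadicIvl.toSet_eq, DyadicIvl.toSet_eq, Set.Icc_subset_Icc_iff (by nlinarith)]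

theorem DyadicIvl.exp_le_of_subset {I J : DyadicIvl} (h : I.ivl.toSet ⊆ J.ivl.toSet) :
    I.exp ≤ J.exp := by
  obtain ⟨h1, h2⟩ := DyadicIvl.subset_iff.mp h
  have : (2 : ℝ) ^ I.exp ≤ 2 ^ J.exp := by linarith
  exact (zpow_le_zpow_iff_right₀ (by norm_num)).mp this

/-- Closed dyadic intervals may meet in an end point only, so nestedness is deduced from a common
point of the half-open ones. -/
theorem DyadicIvl.subset_of_mem {I J : DyadicIvl} (he : I.exp ≤ J.exp) {x : ℝ}
    (hI : x ∈ dyIco I.exp I.pos) (hJ : x ∈ dyIco J.exp J.pos) : I.ivl.toSet ⊆ J.ivl.toSet := by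
  obtain ⟨k, hk⟩ := Int.eq_ofNat_of_zero_le (sub_nonneg.mpr he)
  have hp : (0 : ℝ) < 2 ^ I.exp := by positivity
  have hJe : (2 : ℝ) ^ J.exp = 2 ^ I.exp * 2 ^ k := by
    rw [← zpow_natCast, ← zpow_add₀ (by norm_num)]
    congr 1
    linarith
  rw [DyadicIvl.subset_iff, hJe, mul_assoc, mul_assoc]
  unfold dyIco at hI hJ
  rw [hJe, mul_assoc, mul_assoc] at hJ
  have h1 : (2 : ℝ) ^ k * J.pos < I.pos + 1 := lt_of_mul_lt_mul_left (hJ.1.trans_lt hI.2) hp.le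
  have h2 : (I.pos : ℝ) < (2 : ℝ) ^ k * (J.pos + 1) :=
    lt_of_mul_lt_mul_left (hI.1.trans_lt hJ.2) hp.le
  have h1' : (2 : ℤ) ^ k * J.pos < I.pos + 1 := by exact_mod_cast h1
  have h2' : I.pos < (2 : ℤ) ^ k * (J.pos + 1) := by exact_mod_cast h2
  have h3 : (2 : ℤ) ^ k * J.pos ≤ I.pos := by omega
  have h4 : I.pos + 1 ≤ (2 : ℤ) ^ k * (J.pos + 1) := by omega
  constructor
  · gcongr
    exact_mod_cast h3
  · gcongr
    exact_mod_cast h4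

theorem dyIco_subset_of_subset {I J : DyadicIvl} (h : I.ivl.toSet ⊆ J.ivl.toSet) :
    dyIco I.exp I.pos ⊆ dyIco J.exp J.pos := by
  obtain ⟨h1, h2⟩ := DyadicIvl.subset_iff.mp h
  exact fun x hx => ⟨h1.trans hx.1, hx.2.trans_le h2⟩

/-- The dyadic ancestor `k` generations up. -/
def DyadicIvl.up (k : ℕ) (I : DyadicIvl) : DyadicIvl := ⟨I.exp + k, I.pos / 2 ^ k⟩

theorem DyadicIvl.subset_up (k : ℕ) (I : DyadicIvl) : I.ivl.toSet ⊆ (I.up k).ivl.toSet := by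
  have hp : (0 : ℤ) < 2 ^ k := by positivity
  have h1 : 2 ^ k * (I.pos / 2 ^ k) ≤ I.pos := Int.mul_ediv_self_le hp.ne'
  have h2 : I.pos + 1 ≤ 2 ^ k * (I.pos / 2 ^ k + 1) := by
    have := Int.lt_ediv_add_one_mul_self I.pos hp
    linarith
  rw [DyadicIvl.subset_iff]
  simp only [DyadicIvl.up]
  rw [zpow_add₀ (by norm_num), zpow_natCast, mul_assoc, mul_assoc]
  constructor
  · gcongr
    exact_mod_cast h1
  · gcongr
    exact_mod_cast h2

/-- The translate of a dyadic interval by `j` times its length. -/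
def DyadicIvl.shift (j : ℤ) (I : DyadicIvl) : DyadicIvl := ⟨I.exp, I.pos + j⟩

theorem exists_mem_shift {I : DyadicIvl} {x : ℝ} {J : ℕ}
    (h : |x - I.ivl.ctr| < (J : ℝ) * 2 ^ I.exp) :
    ∃ j : ℤ, |j| ≤ J ∧ x ∈ dyIco (I.shift j).exp (I.shift j).pos := by
  have hp : (0 : ℝ) < 2 ^ I.exp := by positivity
  set y := x / 2 ^ I.exp with hy
  have hx : x = 2 ^ I.exp * y := by rw [hy]; field_simp
  simp only [DyadicIvl.ivl] at h
  have h2 : |y - (I.pos + 1 / 2)| < J := by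
    rw [hx, ← mul_sub, abs_mul, abs_of_pos hp, mul_comm (J : ℝ)] at h
    exact lt_of_mul_lt_mul_left h hp.le
  rw [abs_lt] at h2
  refine ⟨⌊y⌋ - I.pos, ?_, ?_⟩
  · have f1 := Int.floor_le y
    have f2 := Int.lt_floor_add_one y
    have a1 : ((⌊y⌋ - I.pos : ℤ) : ℝ) < J + 1 := by push_cast; linarith
    have a2 : -((J : ℝ) + 1) < ((⌊y⌋ - I.pos : ℤ) : ℝ) := by push_cast; linarith
    rw [abs_le]
    have a1' : ⌊y⌋ - I.pos < J + 1 := by exact_mod_cast a1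
    have a2' : -((J : ℤ) + 1) < ⌊y⌋ - I.pos := by exact_mod_cast a2
    omega
  · simp only [DyadicIvl.shift, dyIco]
    rw [hx]
    constructor
    · gcongr
      push_cast
      linarith [Int.floor_le y]
    · gcongr
      push_cast
      linarith [Int.lt_floor_add_one y]

/-! ### Cubes and tops -/

/-- A diagonal point of `4 C₀ Q` has all coordinates equal to some `t`, and every side has its
center within `2 C₀` side lengths of `t`. -/
theorem Cube.abs_ctr_sub_le {n : ℕ} {Q : Cube n} (hQ : Q.IsWhitney) (i j : Fin n) :
    |(Q.side i).ctr - (Q.side j).ctr| ≤ 4 * C0 n * 2 ^ Q.exp := by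
  obtain ⟨x, hx, t, ht⟩ := hQ.2
  have h : ∀ i, |t - (Q.side i).ctr| ≤ 2 * C0 n * 2 ^ Q.exp := by
    intro i
    have := hx i
    rw [ht i] at this
    simp only [Ivl.toSet, Ivl.dil, Cube.side, Set.mem_Icc] at this ⊢
    rw [abs_le]
    constructor <;> linarith
  have h1 := h i
  have h2 := h j
  have := abs_sub_le ((Q.side i).ctr) t ((Q.side j).ctr)
  rw [abs_sub_comm ((Q.side i).ctr) t] at this
  linarith

namespace Setting

variable {n : ℕ} {S : Setting n}

/-- Sparseness is used through this: sides of equal length whose centers are too close must be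
equal, and one equal side determines the cube. -/
theorem cube_eq {Q Q' : Cube n} (hQ : Q ∈ S.cubes) (hQ' : Q' ∈ S.cubes) (he : Q.exp = Q'.exp)
    (i : Fin n) (h : |(Q.side i).ctr - (Q'.side i).ctr| < 2 ^ K n * 2 ^ Q.exp) : Q = Q' := by
  obtain ⟨-, h2, h3⟩ := S.cubes_sparse Q hQ Q' hQ' i
  apply h3
  by_contra hne
  have hpos : (0 : ℝ) < 2 ^ Q.exp := by positivity
  have hpos' : (0 : ℝ) < 2 ^ Q'.exp := by positivity
  have := h2 (by simp [Cube.side, he]) hne (Q.side i).ctr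
    ⟨by simp only [Cube.side]; linarith, by simp only [Cube.side]; linarith⟩ (Q'.side i).ctr
    ⟨by simp only [Cube.side]; linarith, by simp only [Cube.side]; linarith⟩
  simp only [Cube.side] at this h
  linarith

theorem subset_Qbar {Q : Cube n} (hQ : Q ∈ S.cubes) (i : Fin n) {x y : ℝ}
    (h1 : (Q.side i).ctr - 500 * 2 ^ Q.exp ≤ x) (h2 : y ≤ (Q.side i).ctr + 500 * 2 ^ Q.exp) :
    Set.Icc x y ⊆ (S.Qbar Q i).toSet := by
  refine Set.Subset.trans ?_ (S.enlargement Q hQ i).1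
  simp only [Ivl.toSet, Ivl.dil]
  apply Set.Icc_subset_Icc
  · simp only [Cube.side] at h1 ⊢; linarith
  · simp only [Cube.side] at h2 ⊢; linarith

theorem abs_sub_le_of_mem_Qbar {Q : Cube n} (hQ : Q ∈ S.cubes) {i : Fin n} {x : ℝ}
    (h : x ∈ (S.Qbar Q i).toSet) : |x - (Q.side i).ctr| ≤ 510 * 2 ^ Q.exp := by
  have := (S.enlargement Q hQ i).2.1 h
  simp only [Ivl.toSet, Ivl.dil, Set.mem_Icc] at this
  simp only [Cube.side] at this ⊢
  rw [abs_le]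
  constructor <;> linarith

theorem exists_zeta (T : S.Tree) : ∃ ζ : ℝ, T.ξ = ζ • S.v := by
  obtain ⟨ζ, h⟩ := Submodule.mem_span_singleton.mp T.ξ_mem
  exact ⟨ζ, h.symm⟩

/-- The common value of `ξᵢ / vᵢ` for the top frequency `ξ` of a tree. -/
def Tree.zeta (T : S.Tree) : ℝ := (exists_zeta T).choose

theorem Tree.ξ_eq (T : S.Tree) : T.ξ = T.zeta • S.v := (exists_zeta T).choose_spec

theorem Tree.ξ_apply (T : S.Tree) (i : Fin n) : T.ξ i = T.zeta * S.v i := by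
  rw [T.ξ_eq]
  simp

theorem fits_iff (ζ : ℝ) (I : DyadicIvl) (P : MultiTile n) :
    S.Fits (ζ • S.v) I P ↔ P.I.ivl.toSet ⊆ I.ivl.toSet ∧
      ∃ j, Set.Icc (ζ - 500 / 2 ^ I.exp) (ζ + 500 / 2 ^ I.exp) ⊆ (S.Qbar P.cube j).toSet := by
  unfold Fits
  refine and_congr Iff.rfl (exists_congr fun j => ?_)
  unfold omegaBarTop omegaBarTile Ivl.toSet DyadicIvl.ivl
  have := S.v_ne_zero j
  simp only [Pi.smul_apply, smul_eq_mul]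
  rw [mul_div_cancel_right₀ _ this, show (1000 : ℝ) / 2 ^ I.exp / 2 = 500 / 2 ^ I.exp by ring]

theorem Tree.fits_iff (T : S.Tree) {P : MultiTile n} (hP : P ∈ T.tiles) :
    P.I.ivl.toSet ⊆ T.I.ivl.toSet ∧ ∃ j, Set.Icc (T.zeta - 500 / 2 ^ T.I.exp)
      (T.zeta + 500 / 2 ^ T.I.exp) ⊆ (S.Qbar P.cube j).toSet := by
  have := T.fits P hP
  rwa [T.ξ_eq, Setting.fits_iff] at this

theorem Tree.exp_dvd (T : S.Tree) : (K n : ℤ) ∣ T.I.exp := T.I_kdyadic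

theorem Tree.cube_dvd (T : S.Tree) {P : MultiTile n} (hP : P ∈ T.tiles) :
    (K n : ℤ) ∣ P.I.exp := by
  simpa [MultiTile.I] using S.cubes_exp P.cube (T.isMultiTile hP)

theorem Tree.zeta_mem (T : S.Tree) {P : MultiTile n} (hP : P ∈ T.tiles) :
    ∃ j, T.zeta ∈ (S.Qbar P.cube j).toSet := by
  obtain ⟨-, j, h⟩ := T.fits_iff hP
  have : (0 : ℝ) < 500 / 2 ^ T.I.exp := by positivity
  exact ⟨j, h ⟨by linarith, by linarith⟩⟩

theorem Tree.abs_ctr_sub_le (hn : 1 ≤ n) (T : S.Tree) {P : MultiTile n} (hP : P ∈ T.tiles)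
    (i : Fin n) : |(P.cube.side i).ctr - T.zeta| ≤ 5 * C0 n * 2 ^ P.cube.exp := by
  obtain ⟨j, h⟩ := T.zeta_mem hP
  have hQ : P.cube ∈ S.cubes := T.isMultiTile hP
  have h1 := abs_sub_le_of_mem_Qbar hQ h
  have h2 := Cube.abs_ctr_sub_le (S.cubes_whitney _ hQ) i j
  have h3 := thousand_le_C0 hn
  have h4 := abs_sub_le (P.cube.side i).ctr (P.cube.side j).ctr T.zeta
  rw [abs_sub_comm (P.cube.side j).ctr T.zeta] at h4
  have hpos : (0 : ℝ) < 2 ^ P.cube.exp := by positivity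
  nlinarith

/-- The multi-tiles which fit one of the tops near the top of `T`: a translate by at most `J`
times the width in space and by `0` or `± 300` over the width in frequency. -/
def Tree.Shadow (T : S.Tree) (J : ℕ) (P : MultiTile n) : Prop :=
  ∃ ε j : ℤ, |ε| ≤ 1 ∧ |j| ≤ J ∧
    S.Fits ((T.zeta + 300 * ε / 2 ^ T.I.exp) • S.v) (T.I.shift j) P

theorem Tree.shadow_of_mem (T : S.Tree) (J : ℕ) {P : MultiTile n} (hP : P ∈ T.tiles) :
    T.Shadow J P := by
  refine ⟨0, 0, by simp, by simp, ?_⟩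
  have h := T.fits P hP
  rw [T.ξ_eq] at h
  simpa [DyadicIvl.shift] using h

theorem Tree.shadow_of_subset (T : S.Tree) {J : ℕ} {j : ℤ} (hj : |j| ≤ J) {P : MultiTile n}
    (h1 : P.I.ivl.toSet ⊆ (T.I.shift j).ivl.toSet) {i : Fin n}
    (h2 : Set.Icc (T.zeta - 500 / 2 ^ T.I.exp) (T.zeta + 500 / 2 ^ T.I.exp) ⊆
      (S.Qbar P.cube i).toSet) : T.Shadow J P := by
  refine ⟨0, j, by simp, hj, ?_⟩
  rw [Setting.fits_iff]
  refine ⟨h1, i, ?_⟩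
  simpa [DyadicIvl.shift] using h2

/-- A tile of larger frequency scale, close to a tile of `T` in frequency, fits the top of `T` if
its interval is contained in one of the translates of the top interval. -/
theorem Tree.shadow_of_tile (hn : 1 ≤ n) (T : S.Tree) {J : ℕ} {j : ℤ} (hj : |j| ≤ J)
    {P P' : MultiTile n} (hP : P ∈ T.tiles) (hP' : P'.cube ∈ S.cubes)
    (he : P'.I.exp < P.I.exp) {i : Fin n}
    (hc : |(P.cube.side i).ctr - (P'.cube.side i).ctr| ≤ 20 * 2 ^ P'.cube.exp)
    (h1 : P'.I.ivl.toSet ⊆ (T.I.shift j).ivl.toSet) : T.Shadow J P' := by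
  refine T.shadow_of_subset hj h1 (i := i) ?_
  obtain ⟨-, i₀, h⟩ := T.fits_iff hP
  have hQ : P.cube ∈ S.cubes := T.isMultiTile hP
  have hlt : P.cube.exp < P'.cube.exp := by
    simp only [MultiTile.I] at he
    omega
  -- Different scales differ by a factor of at least `2 ^ K ≥ 100 C₀`, so all frequency errors at
  -- the scale of `P`, including the `O(C₀)` side lengths between its sides, are at most a fraction
  -- of the side length of `P'`.
  have hs := zpow_mul_le_of_lt (S.cubes_exp _ hQ) (S.cubes_exp _ hP') hlt
  have hC := thousand_le_C0 hn
  have hK := C0_le_two_pow_K hn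
  have hp : (0 : ℝ) < 2 ^ P.cube.exp := by positivity
  have hs' : 100 * (C0 n : ℝ) * 2 ^ P.cube.exp ≤ 2 ^ P'.cube.exp := le_trans (by gcongr) hs
  have key : ∀ x ∈ Set.Icc (T.zeta - 500 / 2 ^ T.I.exp) (T.zeta + 500 / 2 ^ T.I.exp),
      |x - (P'.cube.side i).ctr| ≤ 30 * 2 ^ P'.cube.exp := by
    intro x hx
    have a1 := abs_sub_le_of_mem_Qbar hQ (h hx)
    have a2 := Cube.abs_ctr_sub_le (S.cubes_whitney _ hQ) i i₀
    rw [abs_le] at a1 a2 hc ⊢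
    constructor <;> nlinarith
  have hpos : (0 : ℝ) < 500 / 2 ^ T.I.exp := by positivity
  have k1 := abs_le.mp (key (T.zeta - 500 / 2 ^ T.I.exp) ⟨le_rfl, by linarith⟩)
  have k2 := abs_le.mp (key (T.zeta + 500 / 2 ^ T.I.exp) ⟨by linarith, le_rfl⟩)
  have hp' : (0 : ℝ) < 2 ^ P'.cube.exp := by positivity
  exact subset_Qbar hP' i (by linarith) (by linarith)

/-- The multi-tiles of a tree of smaller width, with a top close to the one of `T` in frequency,
fit the top of `T` if the top interval is contained in one of the translates. -/
theorem Tree.shadow_of_top (hn : 1 ≤ n) (T T' : S.Tree) {J : ℕ} {j : ℤ} (hj : |j| ≤ J)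
    (he : T'.I.exp < T.I.exp) (hc : |T.zeta - T'.zeta| ≤ 20 / 2 ^ T'.I.exp)
    (h1 : T'.I.ivl.toSet ⊆ (T.I.shift j).ivl.toSet) {P : MultiTile n} (hP : P ∈ T'.tiles) :
    T.Shadow J P := by
  obtain ⟨hI, i, h⟩ := T'.fits_iff hP
  refine T.shadow_of_subset hj (hI.trans h1) (i := i) (Set.Subset.trans ?_ h)
  have hs := zpow_mul_le_of_lt T'.exp_dvd T.exp_dvd he
  have hC := thousand_le_C0 hn
  have hK := C0_le_two_pow_K hn
  have hp : (0 : ℝ) < 2 ^ T'.I.exp := by positivity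
  have h2 : (500 : ℝ) / 2 ^ T.I.exp ≤ 1 / 2 ^ T'.I.exp := by
    rw [div_le_div_iff₀ (by positivity) hp]
    nlinarith
  rw [abs_le] at hc
  have e1 : (20 : ℝ) / 2 ^ T'.I.exp = 20 * (1 / 2 ^ T'.I.exp) := by ring
  have e2 : (500 : ℝ) / 2 ^ T'.I.exp = 500 * (1 / 2 ^ T'.I.exp) := by ring
  have e3 : (0 : ℝ) < 1 / 2 ^ T'.I.exp := by positivity
  rw [e1] at hc
  rw [e2]
  apply Set.Icc_subset_Icc <;> linarith

/-- The multi-tiles of smaller width than the common width of `T` and `T'`, where `T'` has a top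
close to the one of `T` in frequency, fit one of the tops near the top of `T`. -/
theorem Tree.shadow_of_eq (hn : 1 ≤ n) (T T' : S.Tree) (J : ℕ) (hI : T'.I = T.I)
    (hc : |T.zeta - T'.zeta| ≤ 100 / 2 ^ T.I.exp) {P : MultiTile n} (hP : P ∈ T'.tiles)
    (he : P.I.exp < T'.I.exp) : T.Shadow J P := by
  obtain ⟨hsub, i, h⟩ := T'.fits_iff hP
  have hQ : P.cube ∈ S.cubes := T'.isMultiTile hP
  rw [hI] at hsub h he
  have hs := zpow_mul_le_of_lt (T'.cube_dvd hP) T.exp_dvd he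
  have hC := thousand_le_C0 hn
  have hK := C0_le_two_pow_K hn
  have hp : (0 : ℝ) < 2 ^ T.I.exp := by positivity
  set δ : ℝ := 1 / 2 ^ T.I.exp with hδ
  have hδ0 : 0 < δ := by positivity
  have hbig : 100000 * δ ≤ 2 ^ P.cube.exp := by
    have e1 : (2 : ℝ) ^ P.cube.exp = 1 / 2 ^ P.I.exp := by
      simp [MultiTile.I]
    have hp' : (0 : ℝ) < 2 ^ P.I.exp := by positivity
    rw [e1, hδ, mul_one_div, div_le_div_iff₀ hp hp']
    nlinarith
  have e2 : (500 : ℝ) / 2 ^ T.I.exp = 500 * δ := by rw [hδ]; ring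
  have e3 : (100 : ℝ) / 2 ^ T.I.exp = 100 * δ := by rw [hδ]; ring
  rw [e2] at h
  rw [e3, abs_le] at hc
  have hz : T'.zeta ∈ Set.Icc (T'.zeta - 500 * δ) (T'.zeta + 500 * δ) :=
    ⟨by linarith, by linarith⟩
  have hlow := h (show T'.zeta - 500 * δ ∈ Set.Icc (T'.zeta - 500 * δ) (T'.zeta + 500 * δ) from
    ⟨le_rfl, by linarith⟩)
  have hhigh := h (show T'.zeta + 500 * δ ∈ Set.Icc (T'.zeta - 500 * δ) (T'.zeta + 500 * δ) from
    ⟨by linarith, le_rfl⟩)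
  have hin := (S.enlargement P.cube hQ i).1
  have hl := hin (show (P.cube.side i).ctr - 500 * 2 ^ P.cube.exp ∈ _ from by
    simp only [Ivl.toSet, Ivl.dil, Cube.side, Set.mem_Icc]
    constructor <;> linarith [show (0 : ℝ) < 2 ^ P.cube.exp by positivity])
  have hh := hin (show (P.cube.side i).ctr + 500 * 2 ^ P.cube.exp ∈ _ from by
    simp only [Ivl.toSet, Ivl.dil, Cube.side, Set.mem_Icc]
    constructor <;> linarith [show (0 : ℝ) < 2 ^ P.cube.exp by positivity])
  simp only [Ivl.toSet, Set.mem_Icc] at hlow hhigh hl hh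
  -- The interval around `T.zeta` may stick out of `Q̄ᵢ` by up to `100 δ`; moving its center by `300
  -- δ` towards the center of `Qᵢ` cures this. The other end stays inside `1000 Qᵢ`, because `P` has
  -- smaller width than the top and therefore a side length of at least `100000 δ`.
  rcases le_total T'.zeta (P.cube.side i).ctr with hle | hle
  · refine ⟨1, 0, by simp, by simp, ?_⟩
    rw [Setting.fits_iff]
    refine ⟨by simpa [DyadicIvl.shift] using hsub, i, ?_⟩
    have e4 : (300 : ℝ) * ((1 : ℤ) : ℝ) / 2 ^ T.I.exp = 300 * δ := by rw [hδ]; push_cast; ring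
    rw [e4]
    simp only [DyadicIvl.shift, e2, Ivl.toSet]
    apply Set.Icc_subset_Icc <;> linarith
  · refine ⟨-1, 0, by simp, by simp, ?_⟩
    rw [Setting.fits_iff]
    refine ⟨by simpa [DyadicIvl.shift] using hsub, i, ?_⟩
    have e4 : (300 : ℝ) * ((-1 : ℤ) : ℝ) / 2 ^ T.I.exp = -(300 * δ) := by rw [hδ]; push_cast; ring
    rw [e4]
    simp only [DyadicIvl.shift, e2, Ivl.toSet]
    apply Set.Icc_subset_Icc <;> linarith

/-- Two trees of the same top interval, each with a multi-tile of full width, and with tops close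
in frequency, have a common multi-tile. -/
theorem Tree.eq_of_full_width (hn : 1 ≤ n) (T T' : S.Tree) (hI : T'.I = T.I)
    (hc : |T.zeta - T'.zeta| ≤ (10 * C0 n + 40) / 2 ^ T.I.exp) {P P' : MultiTile n}
    (hP : P ∈ T.tiles) (hP' : P' ∈ T'.tiles) (he : P.I.exp = T.I.exp) (he' : P'.I.exp = T'.I.exp) :
    P = P' := by
  have hsub := (T.fits_iff hP).1
  have hsub' := (T'.fits_iff hP').1
  rw [hI] at he' hsub'
  have hpos : ∀ {P : MultiTile n}, P.I.ivl.toSet ⊆ T.I.ivl.toSet → P.I.exp = T.I.exp →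
      P.pos = T.I.pos := by
    intro P h1 h2
    have := dyIco_subset_of_subset h1 (left_mem_dyIco _ _)
    rw [h2] at this
    exact eq_of_mem_dyIco (left_mem_dyIco _ _) this
  have hQe : P.cube.exp = P'.cube.exp := by
    simp only [MultiTile.I] at he he'
    omega
  have hn0 : 0 < n := hn
  have hcube : P.cube = P'.cube := by
    refine cube_eq (T.isMultiTile hP) (T'.isMultiTile hP') hQe ⟨0, hn0⟩ ?_
    have a1 := T.abs_ctr_sub_le hn hP ⟨0, hn0⟩
    have a2 := T'.abs_ctr_sub_le hn hP' ⟨0, hn0⟩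
    have e1 : (10 * C0 n + 40) / (2 : ℝ) ^ T.I.exp = (10 * C0 n + 40) * 2 ^ P.cube.exp := by
      rw [← he]
      simp [MultiTile.I]
    have hC := thousand_le_C0 hn
    have hK := C0_le_two_pow_K hn
    have hp : (0 : ℝ) < 2 ^ P.cube.exp := by positivity
    rw [e1] at hc
    rw [← hQe] at a2
    rw [abs_le] at a1 a2 hc
    rw [abs_lt]
    constructor <;> nlinarith
  ext1
  · exact hcube
  · rw [hpos hsub he, hpos hsub' he']

end Setting

theorem card_le_of_separated {ι : Type*} (t : Finset ι) (z : ι → ℝ) {y M δ : ℝ} (hδ : 0 < δ)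
    (hM : 2 ≤ M) (hz : ∀ q ∈ t, |z q - y| ≤ M * δ)
    (hsep : ∀ p ∈ t, ∀ q ∈ t, p ≠ q → 100 * δ < |z p - z q|) : (t.card : ℝ) ≤ M + 1 := by
  set g : ι → ℤ := fun q => ⌊(z q - y) / (100 * δ)⌋ with hg
  have hmaps : ∀ q ∈ t, g q ∈ Finset.Icc (⌊-(M / 100)⌋) ⌊M / 100⌋ := by
    intro q hq
    have h := abs_le.mp (hz q hq)
    rw [Finset.mem_Icc]
    constructor
    · apply Int.floor_le_floor
      rw [le_div_iff₀ (by positivity)]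
      linarith
    · apply Int.floor_le_floor
      rw [div_le_iff₀ (by positivity)]
      linarith
  have hinj : Set.InjOn g t := by
    intro p hp q hq hpq
    by_contra hne
    have h1 := hsep p hp q hq hne
    have h2 := Int.abs_sub_lt_one_of_floor_eq_floor hpq
    rw [← sub_div, abs_div, abs_of_pos (by positivity : 0 < 100 * δ), div_lt_one (by positivity),
      sub_sub_sub_cancel_right] at h2
    linarith
  have hcard := Finset.card_le_card_of_injOn g hmaps hinj
  rw [Int.card_Icc] at hcard
  have h1 : (⌊M / 100⌋ : ℝ) ≤ M / 100 := Int.floor_le _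
  have h2 : -(M / 100) < (⌊-(M / 100)⌋ : ℝ) + 1 := Int.lt_floor_add_one _
  have h3 : (t.card : ℝ) ≤ ((⌊M / 100⌋ + 1 - ⌊-(M / 100)⌋).toNat : ℝ) := by exact_mod_cast hcard
  have h4 : (((⌊M / 100⌋ + 1 - ⌊-(M / 100)⌋).toNat : ℤ) : ℝ) =
      max ((⌊M / 100⌋ + 1 - ⌊-(M / 100)⌋ : ℤ) : ℝ) 0 := by
    rw [Int.toNat_eq_max]
    push_cast
    rfl
  have h5 : (((⌊M / 100⌋ + 1 - ⌊-(M / 100)⌋).toNat : ℤ) : ℝ) ≤ M + 1 := by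
    rw [h4]
    apply max_le
    · push_cast
      linarith
    · linarith
  push_cast at h5
  linarith

end PhasePlane
end

/-! ### From trees of large size to wave packets. -/

noncomputable section

namespace PhasePlane

open Complex ComplexConjugate ComplexInnerProductSpace

/-! ### The cutoff function on dyadic shells -/

theorem iUnion_dyIco (e a : ℤ) : ⋃ j : ℤ, dyIco e (a + j) = Set.univ := by
  have hp : (0 : ℝ) < 2 ^ e := by positivity
  refine Set.eq_univ_of_forall fun x => Set.mem_iUnion.mpr ⟨⌊x / 2 ^ e⌋ - a, ?_⟩
  have h1 := Int.floor_le (x / 2 ^ e)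
  have h2 := Int.lt_floor_add_one (x / 2 ^ e)
  rw [le_div_iff₀ hp] at h1
  rw [div_lt_iff₀ hp] at h2
  rw [add_sub_cancel]
  exact ⟨by linarith, by linarith⟩

theorem pairwise_disjoint_dyIco (e a : ℤ) :
    Pairwise (Function.onFun Disjoint fun j : ℤ => dyIco e (a + j)) := by
  intro j k hjk
  refine Set.disjoint_left.mpr fun x hx hx' => hjk ?_
  have := eq_of_mem_dyIco hx hx'
  omega

theorem DyadicIvl.toSet_nonempty (I : DyadicIvl) : I.ivl.toSet.Nonempty :=
  ⟨I.ivl.ctr, by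
    have := I.len_pos
    exact ⟨by linarith, by linarith⟩⟩

theorem cutoff_pos (I : DyadicIvl) (x : ℝ) : 0 < cutoff I.ivl x := by
  unfold cutoff
  have := I.len_pos
  have : 0 ≤ Metric.infDist x I.ivl.toSet := Metric.infDist_nonneg
  positivity

theorem cutoff_le_one (I : DyadicIvl) (x : ℝ) : cutoff I.ivl x ≤ 1 := by
  unfold cutoff
  have := I.len_pos
  have : 0 ≤ Metric.infDist x I.ivl.toSet := Metric.infDist_nonneg
  exact inv_le_one_of_one_le₀ (le_add_of_nonneg_right (by positivity))

theorem le_cutoff {I : DyadicIvl} {j : ℤ} {x : ℝ} (hx : x ∈ dyIco I.exp (I.pos + j)) :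
    (1 + |(j : ℝ)|)⁻¹ ≤ cutoff I.ivl x := by
  have hp : (0 : ℝ) < 2 ^ I.exp := by positivity
  unfold cutoff
  have h0 : 0 ≤ Metric.infDist x I.ivl.toSet := Metric.infDist_nonneg
  have hl : I.ivl.len = 2 ^ I.exp := rfl
  rw [hl]
  apply inv_anti₀ (by positivity)
  gcongr
  rw [div_le_iff₀ hp]
  have hmem : x - 2 ^ I.exp * j ∈ I.ivl.toSet := by
    rw [DyadicIvl.toSet_eq]
    obtain ⟨h1, h2⟩ := hx
    push_cast at h1 h2
    exact ⟨by linarith, by linarith⟩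
  refine (Metric.infDist_le_dist_of_mem hmem).trans ?_
  rw [Real.dist_eq, sub_sub_cancel, abs_mul, abs_of_pos hp, mul_comm]

theorem cutoff_le {I : DyadicIvl} {j : ℤ} {x : ℝ} (hx : x ∈ dyIco I.exp (I.pos + j)) :
    cutoff I.ivl x ≤ 2 / (1 + |(j : ℝ)|) := by
  have hp : (0 : ℝ) < 2 ^ I.exp := by positivity
  unfold cutoff
  have h0 : 0 ≤ Metric.infDist x I.ivl.toSet := Metric.infDist_nonneg
  have hl : I.ivl.len = 2 ^ I.exp := rfl
  rw [hl, inv_le_comm₀ (by positivity) (by positivity), inv_div]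
  have h1 : |(j : ℝ)| - 1 ≤ Metric.infDist x I.ivl.toSet / 2 ^ I.exp := by
    rw [le_div_iff₀ hp]
    refine (Metric.le_infDist I.toSet_nonempty).mpr fun y hy => ?_
    rw [DyadicIvl.toSet_eq] at hy
    obtain ⟨h1, h2⟩ := hx
    obtain ⟨h3, h4⟩ := hy
    push_cast at h1 h2
    rw [Real.dist_eq]
    rcases abs_cases (j : ℝ) with ⟨h, -⟩ | ⟨h, -⟩ <;> rw [h]
    · exact le_trans (by linarith) (le_abs_self _)
    · exact le_trans (by linarith) (neg_le_abs _)
  have h2 : 0 ≤ Metric.infDist x I.ivl.toSet / 2 ^ I.exp := by positivity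
  linarith

/-! ### Restriction of square integrable functions to sets -/

/-- The restriction of a square integrable function to a measurable set, extended by zero. -/
def cutL2 {A : Set ℝ} (hA : MeasurableSet A) (g : Lp ℂ 2 (volume : Measure ℝ)) :
    Lp ℂ 2 (volume : Measure ℝ) :=
  ((Lp.memLp g).indicator hA).toLp (A.indicator g)

theorem coeFn_cutL2 {A : Set ℝ} (hA : MeasurableSet A) (g : Lp ℂ 2 (volume : Measure ℝ)) :
    cutL2 hA g =ᵐ[volume] A.indicator g :=
  MemLp.coeFn_toLp _

theorem enorm_cutL2_sq {A : Set ℝ} (hA : MeasurableSet A) (g : Lp ℂ 2 (volume : Measure ℝ)) :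
    ENNReal.ofReal (‖cutL2 hA g‖ ^ 2) = ∫⁻ x in A, ‖g x‖ₑ ^ 2 := by
  rw [ENNReal.ofReal_pow (norm_nonneg _), ofReal_norm, cutL2, Lp.enorm_toLp,
    eLpNorm_indicator_eq_eLpNorm_restrict hA,
    eLpNorm_eq_lintegral_rpow_enorm_toReal (by norm_num) (by norm_num)]
  simp only [ENNReal.toReal_ofNat]
  rw [← ENNReal.rpow_natCast, ← ENNReal.rpow_mul]
  norm_num

theorem inner_cutL2 {A : Set ℝ} (hA : MeasurableSet A) (g : Lp ℂ 2 (volume : Measure ℝ)) :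
    ⟪cutL2 hA g, g⟫ = ((‖cutL2 hA g‖ ^ 2 : ℝ) : ℂ) := by
  have h : ⟪cutL2 hA g, g⟫ = ⟪cutL2 hA g, cutL2 hA g⟫ := by
    rw [L2.inner_def, L2.inner_def]
    apply integral_congr_ae
    filter_upwards [coeFn_cutL2 hA g] with x hx
    rw [hx]
    by_cases hxA : x ∈ A
    · rw [Set.indicator_of_mem hxA]
    · rw [Set.indicator_of_notMem hxA]
      simp
  rw [h, inner_self_eq_norm_sq_to_K]
  norm_cast

theorem norm_cutL2_le {A : Set ℝ} (hA : MeasurableSet A) (g : Lp ℂ 2 (volume : Measure ℝ)) :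
    ‖cutL2 hA g‖ ≤ ‖g‖ := by
  apply Lp.norm_le_norm_of_ae_le
  filter_upwards [coeFn_cutL2 hA g] with x hx
  rw [hx]
  exact norm_indicator_le_norm_self _ _

/-- The norm `‖χ̃_I ^ 10 g‖₂`. -/
def cutoffNorm (I : Ivl) (g : ℝ → ℂ) : ℝ≥0∞ :=
  eLpNorm (fun x => (cutoff I x : ℂ) ^ 10 * g x) 2 (volume : Measure ℝ)

theorem cutoffNorm_le (I : DyadicIvl) (g : Lp ℂ 2 (volume : Measure ℝ)) :
    cutoffNorm I.ivl g ≤ ENNReal.ofReal ‖g‖ := by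
  rw [ofReal_norm, Lp.enorm_def]
  refine eLpNorm_mono fun x => ?_
  rw [norm_mul, norm_pow, Complex.norm_real, Real.norm_of_nonneg (cutoff_pos I x).le]
  exact mul_le_of_le_one_left (norm_nonneg _)
    (pow_le_one₀ (cutoff_pos I x).le (cutoff_le_one I x))

theorem cutoffNorm_sq (I : DyadicIvl) (g : Lp ℂ 2 (volume : Measure ℝ)) :
    cutoffNorm I.ivl g ^ 2 = ∫⁻ x, ENNReal.ofReal (cutoff I.ivl x) ^ 20 * ‖g x‖ₑ ^ 2 := by
  unfold cutoffNorm
  rw [eLpNorm_eq_lintegral_rpow_enorm_toReal (by norm_num) (by norm_num)]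
  simp only [ENNReal.toReal_ofNat]
  rw [← ENNReal.rpow_natCast, ← ENNReal.rpow_mul]
  norm_num
  refine lintegral_congr fun x => ?_
  rw [mul_pow, ← pow_mul, ← ofReal_norm (cutoff I.ivl x : ℂ), Complex.norm_real,
    Real.norm_of_nonneg (cutoff_pos I x).le]

theorem cutoffNorm_sq_le_tsum (I : DyadicIvl) (g : Lp ℂ 2 (volume : Measure ℝ)) :
    cutoffNorm I.ivl g ^ 2 ≤ ∑' j : ℤ, ENNReal.ofReal ((2 / (1 + |(j : ℝ)|)) ^ 20 *
      ‖cutL2 (measurableSet_dyIco I.exp (I.pos + j)) g‖ ^ 2) := by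
  rw [cutoffNorm_sq, ← setLIntegral_univ, ← iUnion_dyIco I.exp I.pos,
    lintegral_iUnion (fun j => measurableSet_dyIco _ _) (pairwise_disjoint_dyIco _ _)]
  refine ENNReal.tsum_le_tsum fun j => ?_
  rw [ENNReal.ofReal_mul (by positivity), enorm_cutL2_sq, ENNReal.ofReal_pow (by positivity)]
  rw [← lintegral_const_mul' _ _ (by simp)]
  refine setLIntegral_mono' (measurableSet_dyIco _ _) fun x hx => ?_
  gcongr
  exact cutoff_le hx

theorem norm_cutL2_le_cutoffNorm (I : DyadicIvl) (g : Lp ℂ 2 (volume : Measure ℝ)) (j : ℤ) :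
    ENNReal.ofReal ‖cutL2 (measurableSet_dyIco I.exp (I.pos + j)) g‖ ≤
      ENNReal.ofReal ((1 + |(j : ℝ)|) ^ 10) * cutoffNorm I.ivl g := by
  rw [← (ENNReal.pow_right_strictMono (n := 2) two_ne_zero).le_iff_le,
    ← ENNReal.ofReal_pow (norm_nonneg _), enorm_cutL2_sq, mul_pow, cutoffNorm_sq,
    ← lintegral_const_mul' _ _ (by simp)]
  refine le_trans ?_ (setLIntegral_le_lintegral (dyIco I.exp (I.pos + j)) _)
  refine setLIntegral_mono' (measurableSet_dyIco _ _) fun x hx => ?_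
  have h := le_cutoff hx
  have hp : 0 < 1 + |(j : ℝ)| := by positivity
  rw [← mul_assoc, ← ENNReal.ofReal_pow (by positivity), ← ENNReal.ofReal_pow (cutoff_pos I x).le,
    ← ENNReal.ofReal_mul (by positivity)]
  refine le_mul_of_one_le_left (by positivity) ?_
  rw [ENNReal.one_le_ofReal, ← pow_mul, ← mul_pow]
  apply one_le_pow₀
  calc (1 : ℝ) = (1 + |(j : ℝ)|) * (1 + |(j : ℝ)|)⁻¹ := by field_simp
    _ ≤ _ := by gcongr

/-- The sum `∑ (1 + |j|) ^ (-2)` over the integers. -/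
def shellMass : ℝ := ∑' j : ℤ, ((1 + |(j : ℝ)|) ^ 2)⁻¹

theorem summable_shell : Summable fun j : ℤ => ((1 + |(j : ℝ)|) ^ 2)⁻¹ := by
  have h : Summable fun j : ℤ => 1 / (j : ℝ) ^ 2 := by
    exact Real.summable_one_div_int_pow.mpr (by norm_num)
  refine Summable.of_norm_bounded_eventually h ?_
  filter_upwards [(Set.finite_singleton (0 : ℤ)).compl_mem_cofinite] with j hj
  have hj0 : (j : ℝ) ≠ 0 := by simpa using hj
  have hj1 : 0 < |(j : ℝ)| := abs_pos.mpr hj0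
  rw [Real.norm_of_nonneg (by positivity), one_div]
  apply inv_anti₀ (by positivity)
  rw [← sq_abs (j : ℝ)]
  gcongr
  linarith

theorem shellMass_pos : 0 < shellMass :=
  summable_shell.tsum_pos (fun j => by positivity) 0 (by simp)

/-- Pigeonholing the shells. -/
theorem exists_shell {ι : Type*} (s : Finset ι) (I : ι → DyadicIvl)
    (g : ι → Lp ℂ 2 (volume : Measure ℝ)) {M : ℝ} (hM : 0 < M)
    (h : ENNReal.ofReal M < ∑ x ∈ s, cutoffNorm (I x).ivl (g x) ^ 2) :
    ∃ j : ℤ, M * (1 + |(j : ℝ)|) ^ 18 / (2 ^ 20 * shellMass) ≤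
      ∑ x ∈ s, ‖cutL2 (measurableSet_dyIco (I x).exp ((I x).pos + j)) (g x)‖ ^ 2 := by
  -- If every shell fell short, the weight `(2 / (1 + |j|)) ^ 20` would reduce the power `18` to the
  -- summable `-2`, with total at most `M`.
  by_contra! hcon
  have hm := shellMass_pos
  refine absurd h (not_lt.mpr ?_)
  calc ∑ x ∈ s, cutoffNorm (I x).ivl (g x) ^ 2
      ≤ ∑ x ∈ s, ∑' j : ℤ, ENNReal.ofReal ((2 / (1 + |(j : ℝ)|)) ^ 20 *
          ‖cutL2 (measurableSet_dyIco (I x).exp ((I x).pos + j)) (g x)‖ ^ 2) :=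
        Finset.sum_le_sum fun x _ => cutoffNorm_sq_le_tsum _ _
    _ = ∑' j : ℤ, ENNReal.ofReal ((2 / (1 + |(j : ℝ)|)) ^ 20 * ∑ x ∈ s,
          ‖cutL2 (measurableSet_dyIco (I x).exp ((I x).pos + j)) (g x)‖ ^ 2) := by
        rw [← Summable.tsum_finsetSum fun _ _ => ENNReal.summable]
        refine tsum_congr fun j => ?_
        rw [Finset.mul_sum, ENNReal.ofReal_sum_of_nonneg fun _ _ => by positivity]
    _ ≤ ∑' j : ℤ, ENNReal.ofReal (M / shellMass * ((1 + |(j : ℝ)|) ^ 2)⁻¹) := by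
        refine ENNReal.tsum_le_tsum fun j => ENNReal.ofReal_le_ofReal ?_
        have hj : 0 < 1 + |(j : ℝ)| := by positivity
        calc (2 / (1 + |(j : ℝ)|)) ^ 20 * ∑ x ∈ s,
              ‖cutL2 (measurableSet_dyIco (I x).exp ((I x).pos + j)) (g x)‖ ^ 2
            ≤ (2 / (1 + |(j : ℝ)|)) ^ 20 *
              (M * (1 + |(j : ℝ)|) ^ 18 / (2 ^ 20 * shellMass)) := by
              gcongr
              exact (hcon j).le
          _ = M / shellMass * ((1 + |(j : ℝ)|) ^ 2)⁻¹ := by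
              field_simp
    _ = ENNReal.ofReal M := by
        rw [← ENNReal.ofReal_tsum_of_nonneg (fun _ => by positivity)
          (summable_shell.mul_left _), tsum_mul_left]
        congr 1
        change M / shellMass * shellMass = M
        field_simp

/-! ### Phase space norms of Riesz projections -/

theorem IsSymbol.multOp_riesz {N : ℕ} {ω : Ivl} {ξ : ℝ} {m : ℝ → ℂ} (h : IsSymbol N ω ξ m)
    (hN : 2 ≤ N) (hω : 0 < ω.len) (σ : ℤˣ) (f : Lp ℂ 2 (volume : Measure ℝ)) :
    multOp m h.memLp (riesz σ ξ f) = multOp _ ((h.isKink hN hω σ).memLp hω) f :=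
  multOp_multOp _ _ _ (fun _ => rfl) f

theorem IsSymbol.norm_multOp_riesz_le {N : ℕ} {ω : Ivl} {ξ : ℝ} {m : ℝ → ℂ}
    (h : IsSymbol N ω ξ m) (hN : 2 ≤ N) (hω : 0 < ω.len) (σ : ℤˣ)
    (f : Lp ℂ 2 (volume : Measure ℝ)) {D : ℝ} (hD : |ω.ctr - ξ| ≤ D * ω.len) :
    ‖multOp m h.memLp (riesz σ ξ f)‖ ≤ (5 + D) * ‖f‖ := by
  rw [h.multOp_riesz hN hω]
  exact norm_multOp_le _ ((h.isKink hN hω σ).norm_le hω hD) f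

theorem phaseNorm_riesz_ne_top {N : ℕ} (hN : 2 ≤ N) (I : DyadicIvl) {ω : Ivl} (hω : 0 < ω.len)
    (σ : ℤˣ) (ξ : ℝ) (f : Lp ℂ 2 (volume : Measure ℝ)) :
    phaseNorm N I.ivl ω ξ (riesz σ ξ f) ≠ ∞ := by
  refine ne_top_of_le_ne_top
    (ENNReal.ofReal_ne_top (r := (5 + |ω.ctr - ξ| / ω.len) * ‖f‖)) (iSup₂_le fun m hm => ?_)
  exact (cutoffNorm_le I _).trans (ENNReal.ofReal_le_ofReal
    (hm.norm_multOp_riesz_le hN hω σ f (by rw [div_mul_cancel₀ _ hω.ne'])))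

theorem isSymbol_zero (N : ℕ) {ω : Ivl} (hω : 0 < ω.len) (ξ : ℝ) :
    IsSymbol N ω ξ (fun _ => 0) where
  smooth := contDiff_const
  support := by simp
  bound k _ η := by
    have : iteratedDeriv k (fun _ : ℝ => (0 : ℂ)) η = 0 := by
      simp
    rw [this, norm_zero, mul_zero]
    positivity

/-- The supremum need not be attained; when it is finite and positive some symbol reaches half of
it, and when it is zero the zero symbol serves. -/
theorem exists_symbol {N : ℕ} {I ω : Ivl} {ξ : ℝ} {f : Lp ℂ 2 (volume : Measure ℝ)}
    (hω : 0 < ω.len) (hfin : phaseNorm N I ω ξ f ≠ ∞) :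
    ∃ (m : ℝ → ℂ) (hm : IsSymbol N ω ξ m),
      phaseNorm N I ω ξ f ≤ 2 * cutoffNorm I (multOp m hm.memLp f) := by
  rcases eq_or_ne (phaseNorm N I ω ξ f) 0 with h0 | h0
  · exact ⟨_, isSymbol_zero N hω ξ, by rw [h0]; exact zero_le⟩
  · have h := ENNReal.half_lt_self h0 hfin
    conv at h => rhs; unfold phaseNorm
    obtain ⟨m, h⟩ := lt_iSup_iff.mp h
    obtain ⟨hm, h⟩ := lt_iSup_iff.mp h
    refine ⟨m, hm, ?_⟩
    rw [mul_comm]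
    exact (ENNReal.div_le_iff_le_mul (by simp) (by simp)).mp h.le

/-- A piece of `T_m f`, localized to the `n`-th translate of a dyadic interval, with the data
which describe the position of the symbol `m`. -/
structure Packet (σ : ℤˣ) (V : ℝ) (n : ℤ) (f : Lp ℂ 2 (volume : Measure ℝ)) (e a : ℤ)
    (c ξ : ℝ) where
  ν : ℝ → ℂ
  F : Lp ℂ 2 (volume : Measure ℝ)
  kink : IsKink (V / 2 ^ e) c ξ σ ν
  dual : ∀ h : MemLp ν ∞ (volume : Measure ℝ), ⟪multOp ν h F, f⟫ = ((‖F‖ ^ 2 : ℝ) : ℂ)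
  supp : ∀ᵐ x, x ∉ dyIco e (a + n) → F x = 0

/-- The symbol of the packet is the conjugate of `m` cut off at `ξ`. Its multiplier is then the
adjoint of `f ↦ T_m Π f`, so pairing with `f` amounts to pairing `F` with the function from which it
was cut. -/
theorem exists_packet {N : ℕ} (hN : 2 ≤ N) {I : DyadicIvl} {ω : Ivl} {V ξ : ℝ} (hV : 0 < V)
    (hω : ω.len = V / 2 ^ I.exp) {m : ℝ → ℂ} (hm : IsSymbol N ω ξ m) (σ : ℤˣ) (n : ℤ)
    (f : Lp ℂ 2 (volume : Measure ℝ)) :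
    ∃ p : Packet σ V n f I.exp I.pos ω.ctr ξ, p.F =
      cutL2 (measurableSet_dyIco I.exp (I.pos + n)) (multOp m hm.memLp (riesz σ ξ f)) := by
  have hω0 : 0 < ω.len := by rw [hω]; positivity
  have hk := hm.isKink hN hω0 σ
  refine ⟨⟨_, cutL2 (measurableSet_dyIco I.exp (I.pos + n))
    (multOp m hm.memLp (riesz σ ξ f)), hω ▸ hk.conj, fun h => ?_, ?_⟩, rfl⟩
  · rw [inner_multOp_conj _ _ (hk.memLp hω0) h (fun _ => rfl), ← hm.multOp_riesz hN hω0,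
      inner_cutL2]
  · filter_upwards [coeFn_cutL2 (measurableSet_dyIco I.exp (I.pos + n))
      (multOp m hm.memLp (riesz σ ξ f))] with x hx hxn
    rw [hx, Set.indicator_of_notMem hxn]

/-! ### Trees of large size -/

namespace Setting

variable {n : ℕ} {S : Setting n}

theorem v_abs_pos (i : Fin n) : 0 < |S.v i| := abs_pos.mpr (S.v_ne_zero i)

theorem one_le_v_abs (i : Fin n) : 1 ≤ |S.v i| := by
  have hi := i.2
  have h := S.v_antitone (show i ≤ ⟨n - 1, by omega⟩ from Fin.le_def.mpr (by simp; omega))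
  have h1 := S.v_last ⟨n - 1, by omega⟩ (by simp; omega)
  simp only at h
  linarith

/-- The spatial interval of a multi-tile of a tree, or of the top of the tree. -/
def Tree.eltI (T : S.Tree) : Option (MultiTile n) → DyadicIvl
  | some P => P.I
  | none => T.I

/-- The frequency interval of a multi-tile of a tree, or of the top of the tree. -/
def Tree.eltω (T : S.Tree) (i : Fin n) : Option (MultiTile n) → Ivl
  | some P => (S.tile P i).ω
  | none => S.omegaTop T.ξ T.I i

/-- The semi-norm of a multi-tile of a tree, or of the top of the tree. -/
def Tree.eltNorm (T : S.Tree) (N : ℕ) (i : Fin n) (σ : ℤˣ) (f : Lp ℂ 2 (volume : Measure ℝ))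
    (x : Option (MultiTile n)) : ℝ≥0∞ :=
  phaseNorm N (T.eltI x).ivl (T.eltω i x) (T.ξ i) (riesz σ (T.ξ i) f)

theorem Tree.eltω_len (T : S.Tree) (i : Fin n) (x : Option (MultiTile n)) :
    (T.eltω i x).len = |S.v i| / 2 ^ (T.eltI x).exp := by
  cases x with
  | none => rfl
  | some P => simp [eltω, eltI, tile, MultiTile.I, Cube.side]

theorem Tree.eltω_len_pos (T : S.Tree) (i : Fin n) (x : Option (MultiTile n)) :
    0 < (T.eltω i x).len := by
  rw [T.eltω_len]
  have := S.v_abs_pos i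
  positivity

/-- Multi-tiles of a tree, and its top. -/
def Tree.IsElt (T : S.Tree) (x : Option (MultiTile n)) : Prop := ∀ P, x = some P → P ∈ T.tiles

theorem Tree.abs_eltω_sub_le (hn : 1 ≤ n) (T : S.Tree) (i : Fin n) {x : Option (MultiTile n)}
    (hx : T.IsElt x) : |(T.eltω i x).ctr - T.ξ i| ≤ 5 * C0 n * (T.eltω i x).len := by
  cases x with
  | none =>
    have := T.eltω_len_pos i none
    have hC := thousand_le_C0 hn
    simp only [eltω, omegaTop, sub_self, abs_zero] at this ⊢
    positivity
  | some P =>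
    have h := T.abs_ctr_sub_le hn (hx P rfl) i
    simp only [eltω, tile]
    rw [T.ξ_apply, mul_comm T.zeta, ← mul_sub, abs_mul]
    calc _ ≤ |S.v i| * (5 * C0 n * 2 ^ P.cube.exp) := by gcongr
      _ = _ := by simp only [Cube.side]; ring

/-- The constant in the lower bound for the packets of a tree of large size. -/
def witnessConst : ℝ := (2 ^ 24 * shellMass)⁻¹

theorem witnessConst_pos : 0 < witnessConst := by
  have := shellMass_pos
  unfold witnessConst
  positivity

/-- Packets of a tree, on the translates by `j` and either all from multi-tiles (for `b = true`)
or from the top (for `b = false`), which show that the size of the tree is at least `lam`. -/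
structure Tree.Witness (T : S.Tree) (N : ℕ) (i : Fin n) (σ : ℤˣ)
    (f : Lp ℂ 2 (volume : Measure ℝ)) (lam : ℝ) (j : ℤ) (b : Bool) where
  elts : Finset (Option (MultiTile n))
  isElt : ∀ x ∈ elts, T.IsElt x
  isSome : ∀ x ∈ elts, x.isSome = b
  pkt : ∀ x, Packet σ |S.v i| j f (T.eltI x).exp (T.eltI x).pos (T.eltω i x).ctr (T.ξ i)
  le_eltNorm : ∀ x, ENNReal.ofReal ‖(pkt x).F‖ ≤
    ENNReal.ofReal ((1 + |(j : ℝ)|) ^ 10) * T.eltNorm N i σ f x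
  le_norm : ∀ x ∈ elts, ‖(pkt x).F‖ ≤ (5 + 5 * C0 n) * ‖f‖
  big : witnessConst * (1 + |(j : ℝ)|) ^ 18 * (lam ^ 2 * 2 ^ T.I.exp) ≤
    ∑ x ∈ elts, ‖(pkt x).F‖ ^ 2

/-- The `2 ^ 24` in `witnessConst` collects a factor `4` from `lam / 2`, a factor `4` from the
nearly optimal symbols and `2 ^ 20` from `exists_shell`. -/
theorem Tree.exists_witness_of_sum (hn : 1 ≤ n) (T : S.Tree) {N : ℕ} (hN : 2 ≤ N) (i : Fin n)
    (σ : ℤˣ) (f : Lp ℂ 2 (volume : Measure ℝ)) {lam : ℝ} (hl : 0 < lam)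
    (s : Finset (Option (MultiTile n))) (b : Bool) (hs : ∀ x ∈ s, T.IsElt x)
    (hb : ∀ x ∈ s, x.isSome = b)
    (h : ENNReal.ofReal ((lam / 2) ^ 2 * 2 ^ T.I.exp) < ∑ x ∈ s, T.eltNorm N i σ f x ^ 2) :
    ∃ j, Nonempty (T.Witness N i σ f lam j b) := by
  choose m hm hle using fun x => exists_symbol (T.eltω_len_pos i x)
    (phaseNorm_riesz_ne_top hN (T.eltI x) (T.eltω_len_pos i x) σ (T.ξ i) f)
  have h2 : ENNReal.ofReal (lam ^ 2 * 2 ^ T.I.exp / 16) < ∑ x ∈ s, cutoffNorm (T.eltI x).ivl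
      (multOp (m x) (hm x).memLp (riesz σ (T.ξ i) f)) ^ 2 := by
    have h3 : ∑ x ∈ s, T.eltNorm N i σ f x ^ 2 ≤ 4 * ∑ x ∈ s, cutoffNorm (T.eltI x).ivl
        (multOp (m x) (hm x).memLp (riesz σ (T.ξ i) f)) ^ 2 := by
      rw [Finset.mul_sum]
      refine Finset.sum_le_sum fun x _ => ?_
      calc T.eltNorm N i σ f x ^ 2 ≤ (2 * _) ^ 2 := pow_le_pow_left₀ (by positivity) (hle x) 2
        _ = _ := by rw [mul_pow]; norm_num
    have h4 := h.trans_le h3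
    rw [show (lam / 2) ^ 2 * (2 : ℝ) ^ T.I.exp = 4 * (lam ^ 2 * 2 ^ T.I.exp / 16) by ring,
      ENNReal.ofReal_mul (by norm_num)] at h4
    norm_num at h4
    exact lt_of_mul_lt_mul_left' h4
  obtain ⟨j, hj⟩ := exists_shell s _ _ (by positivity) h2
  choose p hp using fun x => exists_packet hN (S.v_abs_pos i) (T.eltω_len i x) (hm x) σ j f
  refine ⟨j, ⟨⟨s, hs, hb, p, fun x => ?_, fun x hx => ?_, ?_⟩⟩⟩
  · rw [hp]
    refine (norm_cutL2_le_cutoffNorm _ _ _).trans ?_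
    gcongr
    exact le_iSup₂_of_le (m x) (hm x) le_rfl
  · rw [hp]
    exact (norm_cutL2_le _ _).trans ((hm x).norm_multOp_riesz_le hN (T.eltω_len_pos i x) σ f
      (T.abs_eltω_sub_le hn i (hs x hx)))
  · simp only [hp]
    refine le_trans (le_of_eq ?_) hj
    have := shellMass_pos
    unfold witnessConst
    field_simp
    norm_num

/-- One of the two summands of the size exceeds `lam / 2`, and this decides between packets from
multi-tiles and a single packet from the top. -/
theorem Tree.exists_witness (hn : 1 ≤ n) (T : S.Tree) (hT : T.tiles.Finite) {N : ℕ} (hN : 2 ≤ N)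
    (i : Fin n) (σ : ℤˣ) (f : Lp ℂ 2 (volume : Measure ℝ)) {lam : ℝ} (hl : 0 < lam)
    (h : ENNReal.ofReal lam < T.sizeSigned N i σ f) :
    ∃ j b, Nonempty (T.Witness N i σ f lam j b) := by
  classical
  have hI : 0 < T.I.ivl.len := T.I.len_pos
  have hI' : T.I.ivl.len = 2 ^ T.I.exp := rfl
  unfold sizeSigned size at h
  have hor : ENNReal.ofReal (lam / 2) < ((ENNReal.ofReal T.I.ivl.len)⁻¹ *
      ∑' P : T.tiles, tileNorm N (S.tile P i) (T.ξ i) (riesz σ (T.ξ i) f) ^ 2) ^ (1 / 2 : ℝ) ∨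
      ENNReal.ofReal (lam / 2) < ENNReal.ofReal T.I.ivl.len ^ (-(1 / 2) : ℝ) *
      phaseNorm N T.I.ivl (S.omegaTop T.ξ T.I i) (T.ξ i) (riesz σ (T.ξ i) f) := by
    by_contra! hcon
    refine absurd h (not_lt.mpr ((add_le_add hcon.1 hcon.2).trans ?_))
    rw [← ENNReal.ofReal_add (by positivity) (by positivity), add_halves]
  have hL0 : ENNReal.ofReal T.I.ivl.len ≠ 0 := by simpa using hI
  have hsq : ENNReal.ofReal ((lam / 2) ^ 2 * 2 ^ T.I.exp) =
      ENNReal.ofReal (lam / 2) ^ 2 * ENNReal.ofReal T.I.ivl.len := by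
    rw [ENNReal.ofReal_mul (by positivity), ENNReal.ofReal_pow (by positivity), hI']
  rcases hor with h1 | h1
  · have := hT.fintype
    obtain ⟨j, hj⟩ := T.exists_witness_of_sum hn hN i σ f hl
      (Finset.univ.map ⟨fun P : T.tiles => some (P : MultiTile n), fun P P' h => by
        simpa [Subtype.ext_iff] using h⟩) true (fun x hx => by
          simp only [Finset.mem_map, Finset.mem_univ, true_and] at hx
          obtain ⟨P, rfl⟩ := hx
          rintro _ ⟨⟩
          exact P.2) (fun x hx => by
          simp only [Finset.mem_map, Finset.mem_univ, true_and] at hx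
          obtain ⟨P, rfl⟩ := hx
          rfl) (by
        rw [Finset.sum_map, hsq]
        have h2 := (ENNReal.pow_lt_pow_left_iff two_ne_zero).mpr h1
        rw [← ENNReal.rpow_natCast (_ ^ (1 / 2 : ℝ)), ← ENNReal.rpow_mul] at h2
        norm_num at h2
        rw [mul_comm, ← div_eq_mul_inv,
          ENNReal.lt_div_iff_mul_lt (Or.inl hL0) (Or.inl ENNReal.ofReal_ne_top)] at h2
        exact h2)
    exact ⟨j, true, hj⟩
  · obtain ⟨j, hj⟩ := T.exists_witness_of_sum hn hN i σ f hl {none} false (fun x hx => by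
        rw [Finset.mem_singleton] at hx
        subst hx
        rintro _ ⟨⟩) (fun x hx => by
        rw [Finset.mem_singleton] at hx
        subst hx
        rfl) (by
        rw [Finset.sum_singleton, hsq]
        have h2 := (ENNReal.pow_lt_pow_left_iff two_ne_zero).mpr h1
        rw [mul_pow, ← ENNReal.rpow_natCast (_ ^ (-(1 / 2) : ℝ)), ← ENNReal.rpow_mul] at h2
        norm_num at h2
        rw [ENNReal.rpow_neg_one, mul_comm, ← div_eq_mul_inv,
          ENNReal.lt_div_iff_mul_lt (Or.inl hL0) (Or.inl ENNReal.ofReal_ne_top)] at h2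
        exact h2)
    exact ⟨j, false, hj⟩

end Setting

end PhasePlane
end

/-! ### Bounds for single packets, peeling of trees, and the selection. -/

noncomputable section

namespace PhasePlane

/-! ### Change of the reference frequency -/

theorem IsSymbol.iteratedDeriv_eq_zero {N : ℕ} {ω : Ivl} {ξ : ℝ} {m : ℝ → ℂ}
    (h : IsSymbol N ω ξ m) (k : ℕ) {η : ℝ} (hη : η ∉ (ω.dil 10).toSet) :
    iteratedDeriv k m η = 0 := by
  have hev : m =ᶠ[nhds η] fun _ => 0 := by
    filter_upwards [(isClosed_Icc (a := (ω.dil 10).ctr - (ω.dil 10).len / 2)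
      (b := (ω.dil 10).ctr + (ω.dil 10).len / 2)).isOpen_compl.mem_nhds hη] with y hy
    by_contra hne
    exact hy (h.support hne)
  rw [hev.iteratedDeriv_eq k]
  simp

/-- The support of `m` is at distance at least `395 |ω|` from `ξ`, so moving `ξ` by `20 |ω|` changes
`|η - ξ|` there by a factor of at most two. This costs `2 ^ k` on the left of the symbol bound and
`2` on the right. -/
theorem IsSymbol.change_frequency {N : ℕ} {ω : Ivl} {ξ ξ' : ℝ} {m : ℝ → ℂ}
    (h : IsSymbol N ω ξ m) (hω : 0 < ω.len) (h1 : 400 * ω.len ≤ |ω.ctr - ξ|)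
    (h2 : |ξ - ξ'| ≤ 20 * ω.len) :
    IsSymbol N ω ξ' (fun η => (((2 : ℝ) ^ (N ^ 2 + 1))⁻¹ : ℝ) • m η) where
  smooth := h.smooth.const_smul _
  support := fun x hx => h.support fun h0 => hx (by simp [h0])
  bound k hk η := by
    have e1 : iteratedDeriv k (fun η => (((2 : ℝ) ^ (N ^ 2 + 1))⁻¹ : ℝ) • m η) η =
        (((2 : ℝ) ^ (N ^ 2 + 1))⁻¹ : ℝ) • iteratedDeriv k m η :=
      iteratedDeriv_fun_const_smul_field _ m
    by_cases hη : η ∈ (ω.dil 10).toSet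
    · rw [e1, norm_smul, Real.norm_of_nonneg (by positivity)]
      simp only [Ivl.toSet, Ivl.dil, Set.mem_Icc] at hη
      have h3 : |η - ω.ctr| ≤ 5 * ω.len := abs_le.mpr ⟨by linarith, by linarith⟩
      have t1 := abs_sub_le ω.ctr η ξ
      have t2 := abs_sub_le η ξ ξ'
      have t3 := abs_sub_le η ξ' ξ
      rw [abs_sub_comm ω.ctr η] at t1
      rw [abs_sub_comm ξ' ξ] at t3
      have a1 : |η - ξ'| ≤ 2 * |η - ξ| := by linarith
      have a2 : |η - ξ| ≤ 2 * |η - ξ'| := by linarith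
      have hb := h.bound k hk η
      have hpow : (2 : ℝ) ^ (k + 1) ≤ 2 ^ (N ^ 2 + 1) :=
        pow_le_pow_right₀ (by norm_num) (by omega)
      have hp : (0 : ℝ) < 2 ^ (N ^ 2 + 1) := by positivity
      calc |η - ξ'| ^ k * (((2 : ℝ) ^ (N ^ 2 + 1))⁻¹ * ‖iteratedDeriv k m η‖)
          ≤ (2 * |η - ξ|) ^ k * (((2 : ℝ) ^ (N ^ 2 + 1))⁻¹ * ‖iteratedDeriv k m η‖) := by gcongr
        _ = 2 ^ k * ((2 : ℝ) ^ (N ^ 2 + 1))⁻¹ * (|η - ξ| ^ k * ‖iteratedDeriv k m η‖) := by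
            rw [mul_pow]; ring
        _ ≤ 2 ^ k * ((2 : ℝ) ^ (N ^ 2 + 1))⁻¹ * (2 * |η - ξ'| / ω.len) := by
            refine mul_le_mul_of_nonneg_left (hb.trans ?_) (by positivity)
            gcongr
        _ = 2 ^ (k + 1) * ((2 : ℝ) ^ (N ^ 2 + 1))⁻¹ * (|η - ξ'| / ω.len) := by
            rw [pow_succ]; ring
        _ ≤ 1 * (|η - ξ'| / ω.len) := by
            gcongr
            rwa [← div_eq_mul_inv, div_le_one hp]
        _ = _ := one_mul _
    · rw [e1, h.iteratedDeriv_eq_zero k hη, smul_zero, norm_zero, mul_zero]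
      positivity

theorem cutoffNorm_const_smul (I : Ivl) (c : ℂ) (g : Lp ℂ 2 (volume : Measure ℝ)) :
    cutoffNorm I (c • g : Lp ℂ 2 (volume : Measure ℝ)) = ‖c‖ₑ * cutoffNorm I g := by
  unfold cutoffNorm
  rw [← eLpNorm_const_smul]
  apply eLpNorm_congr_ae
  filter_upwards [Lp.coeFn_smul c g] with x hx
  rw [hx]
  simp only [Pi.smul_apply, smul_eq_mul]
  ring

/-- Since `ξ` and `ξ'` lie on the same side of the support of each symbol, the two Riesz projections
have the same effect after `T_m`; only the constant of `IsSymbol.change_frequency` is lost. -/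
theorem phaseNorm_riesz_le {N : ℕ} (hN : 2 ≤ N) (I : Ivl) {ω : Ivl} (hω : 0 < ω.len) (σ : ℤˣ)
    {ξ ξ' : ℝ} (h1 : 400 * ω.len ≤ |ω.ctr - ξ|) (h2 : |ξ - ξ'| ≤ 20 * ω.len)
    (f : Lp ℂ 2 (volume : Measure ℝ)) :
    phaseNorm N I ω ξ (riesz σ ξ f) ≤
      ENNReal.ofReal (2 ^ (N ^ 2 + 1)) * phaseNorm N I ω ξ' (riesz σ ξ' f) := by
  refine iSup₂_le fun m hm => ?_
  have hm' := hm.change_frequency hω h1 h2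
  have hp : (0 : ℝ) < 2 ^ (N ^ 2 + 1) := by positivity
  have hmul : multOp m hm.memLp (riesz σ ξ f) =
      (((2 : ℝ) ^ (N ^ 2 + 1) : ℝ) : ℂ) • multOp _ hm'.memLp (riesz σ ξ' f) := by
    rw [hm.multOp_riesz hN hω, hm'.multOp_riesz hN hω]
    refine multOp_const_mul _ _ _ (fun η => ?_) f
    simp only [Complex.real_smul]
    push_cast
    rw [← mul_assoc, ← mul_assoc, mul_inv_cancel₀ (pow_ne_zero _ two_ne_zero), one_mul]
    by_cases hη : m η = 0
    · rw [hη, zero_mul, zero_mul]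
    · congr 1
      have hs := hm.support hη
      simp only [Ivl.toSet, Ivl.dil, Set.mem_Icc] at hs
      have hiff : η ∈ halfLine σ ξ ↔ η ∈ halfLine σ ξ' := by
        unfold halfLine
        simp only [Set.mem_ofPred_eq]
        rw [abs_le] at h2
        rcases le_abs.mp h1 with h1 | h1 <;> rcases Int.units_eq_one_or σ with rfl | rfl <;>
          simp only [Units.val_one, Units.val_neg, Int.cast_one, Int.cast_neg, one_mul, neg_mul] <;>
          constructor <;> intro _ <;> linarith
      by_cases h : η ∈ halfLine σ ξ
      · rw [Set.indicator_of_mem h, Set.indicator_of_mem (hiff.mp h)]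
      · rw [Set.indicator_of_notMem h, Set.indicator_of_notMem fun h' => h (hiff.mpr h')]
  change cutoffNorm I _ ≤ _
  rw [hmul, cutoffNorm_const_smul, ← ofReal_norm, Complex.norm_real, Real.norm_of_nonneg hp.le]
  gcongr
  exact le_iSup₂_of_le _ hm' le_rfl

namespace Setting

variable {n : ℕ} {S : Setting n}

/-! ### The norms of single multi-tiles are bounded by the size -/

theorem Tree.top_norm_le (T : S.Tree) {N : ℕ} {i : Fin n} {σ : ℤˣ}
    {f : Lp ℂ 2 (volume : Measure ℝ)} {lam : ℝ} (h : T.sizeSigned N i σ f ≤ ENNReal.ofReal lam) :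
    T.eltNorm N i σ f none ≤ ENNReal.ofReal (lam * √(2 ^ T.I.exp)) := by
  have hI : 0 < T.I.ivl.len := T.I.len_pos
  have hL0 : ENNReal.ofReal T.I.ivl.len ≠ 0 := by simpa using hI
  have h1 := (le_add_left le_rfl).trans h
  rw [ENNReal.rpow_neg, mul_comm, ← div_eq_mul_inv, ENNReal.div_le_iff_le_mul
    (Or.inl (by simp [hI])) (Or.inl (by simp))] at h1
  rw [ENNReal.ofReal_mul' (by positivity), Real.sqrt_eq_rpow,
    ← ENNReal.ofReal_rpow_of_nonneg (by positivity) (by norm_num)]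
  exact h1

theorem Tree.tile_norm_le (T : S.Tree) {P : MultiTile n} (hT : P ∈ T.tiles) {N : ℕ} {i : Fin n}
    {σ : ℤˣ} {f : Lp ℂ 2 (volume : Measure ℝ)} {lam : ℝ}
    (h : T.sizeSigned N i σ f ≤ ENNReal.ofReal lam) :
    T.eltNorm N i σ f (some P) ≤ ENNReal.ofReal (lam * √(2 ^ T.I.exp)) := by
  have hI : 0 < T.I.ivl.len := T.I.len_pos
  have hL0 : ENNReal.ofReal T.I.ivl.len ≠ 0 := by simpa using hI
  have h1 := (le_add_right le_rfl).trans h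
  have h2 : T.eltNorm N i σ f (some P) ^ 2 ≤
      ∑' P : T.tiles, tileNorm N (S.tile P i) (T.ξ i) (riesz σ (T.ξ i) f) ^ 2 :=
    ENNReal.le_tsum (f := fun P : T.tiles =>
      tileNorm N (S.tile P i) (T.ξ i) (riesz σ (T.ξ i) f) ^ 2) ⟨P, hT⟩
  have h3 : ((ENNReal.ofReal T.I.ivl.len)⁻¹ * T.eltNorm N i σ f (some P) ^ 2) ^ (1 / 2 : ℝ) ≤
      ENNReal.ofReal lam := le_trans (by gcongr) h1
  rw [ENNReal.mul_rpow_of_nonneg _ _ (by norm_num), ← ENNReal.rpow_natCast, ← ENNReal.rpow_mul,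
    ENNReal.inv_rpow, mul_comm, ← div_eq_mul_inv, ENNReal.div_le_iff_le_mul
    (Or.inl (by simp [hI])) (Or.inl (by simp))] at h3
  rw [ENNReal.ofReal_mul' (by positivity), Real.sqrt_eq_rpow,
    ← ENNReal.ofReal_rpow_of_nonneg (by positivity) (by norm_num)]
  norm_num at h3 ⊢
  exact h3

/-- The tree with the only multi-tile `P` and a top interval of `2 ^ K` times its length. -/
def singleTree (P : MultiTile n) (hP : P.cube ∈ S.cubes) (ζ : ℝ)
    (h : S.Fits (ζ • S.v) (P.I.up (K n)) P) : S.Tree where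
  tiles := {P}
  ξ := ζ • S.v
  I := P.I.up (K n)
  nonempty := Set.singleton_nonempty P
  isMultiTile := by
    rintro _ rfl
    exact hP
  ξ_mem := Submodule.smul_mem _ _ (Submodule.mem_span_singleton_self _)
  I_kdyadic := by
    unfold DyadicIvl.IsKDyadic
    simp only [DyadicIvl.up, MultiTile.I]
    exact dvd_add ((dvd_neg).mpr (S.cubes_exp _ hP)) dvd_rfl
  fits := by
    rintro _ rfl
    exact h

/-- The constant in the bound of the norms of single multi-tiles by the size. -/
def tileConst (n N : ℕ) : ℝ := 2 ^ (N ^ 2 + 1) * √(2 ^ K n)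

theorem tileConst_pos (n N : ℕ) : 0 < tileConst n N := by
  unfold tileConst
  positivity

/-- With a top interval `2 ^ K` times as long as `I_P`, the frequency interval of the top is tiny
compared with the cube, so `P` fits as soon as `ζ` is within `490` side lengths of the center of
some side. The frequency of `T` itself qualifies when it is near the `i`-th side. Otherwise it is
within `510` side lengths of the center of some `j`-th side and is moved by `20` towards it, which
is harmless because it is far from the `i`-th side. -/
theorem exists_singleTree (hn : 1 ≤ n) (T : S.Tree) {P : MultiTile n} (hP : P ∈ T.tiles)
    (i : Fin n) : ∃ (ζ : ℝ), S.Fits (ζ • S.v) (P.I.up (K n)) P ∧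
      (ζ = T.zeta ∨ 400 * 2 ^ P.cube.exp ≤ |(P.cube.side i).ctr - T.zeta| ∧
        |T.zeta - ζ| ≤ 20 * 2 ^ P.cube.exp) := by
  have hQ : P.cube ∈ S.cubes := T.isMultiTile hP
  have hC := thousand_le_C0 hn
  have hK := C0_le_two_pow_K hn
  have hp : (0 : ℝ) < 2 ^ P.cube.exp := by positivity
  have hsmall : (500 : ℝ) / 2 ^ (P.I.up (K n)).exp ≤ 2 ^ P.cube.exp := by
    simp only [DyadicIvl.up, MultiTile.I]
    rw [zpow_add₀ (by norm_num), zpow_natCast, zpow_neg, div_le_iff₀ (by positivity),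
      ← mul_assoc, mul_inv_cancel₀ hp.ne', one_mul]
    linarith
  have key : ∀ ζ j, |ζ - (P.cube.side j).ctr| ≤ 490 * 2 ^ P.cube.exp →
      S.Fits (ζ • S.v) (P.I.up (K n)) P := by
    intro ζ j h
    rw [Setting.fits_iff]
    refine ⟨P.I.subset_up _, j, subset_Qbar hQ j ?_ ?_⟩ <;> rw [abs_le] at h <;> linarith
  rcases le_total (|(P.cube.side i).ctr - T.zeta|) (400 * 2 ^ P.cube.exp) with h | h
  · refine ⟨T.zeta, key _ i ?_, Or.inl rfl⟩
    rw [abs_sub_comm]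
    linarith
  · obtain ⟨j, hj⟩ := T.zeta_mem hP
    have hj' := abs_le.mp (abs_sub_le_of_mem_Qbar hQ hj)
    rcases le_total T.zeta (P.cube.side j).ctr with hle | hle
    · refine ⟨T.zeta + 20 * 2 ^ P.cube.exp, key _ j (abs_le.mpr ⟨by linarith, by linarith⟩),
        Or.inr ⟨h, ?_⟩⟩
      rw [abs_le]
      constructor <;> linarith
    · refine ⟨T.zeta - 20 * 2 ^ P.cube.exp, key _ j (abs_le.mpr ⟨by linarith, by linarith⟩),
        Or.inr ⟨h, ?_⟩⟩
      rw [abs_le]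
      constructor <;> linarith

/-- The size of `T` controls a multi-tile only in terms of `|I_T|`. The sharper bound by `|I_P|`
comes from the one-tile tree, which is also contained in `X` and whose top is longer than `I_P` by
the fixed factor `2 ^ K`. -/
theorem Tree.eltNorm_le (hn : 1 ≤ n) (T : S.Tree) {N : ℕ} (hN : 2 ≤ N) (i : Fin n) (σ : ℤˣ)
    (f : Lp ℂ 2 (volume : Measure ℝ)) {lam : ℝ} (hl : 0 ≤ lam) {X : Set (MultiTile n)}
    (hX : S.maxSizeSigned N i σ f X ≤ ENNReal.ofReal lam) (hT : T.tiles ⊆ X)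
    {x : Option (MultiTile n)} (hx : T.IsElt x) :
    T.eltNorm N i σ f x ≤ ENNReal.ofReal (tileConst n N * lam * √(2 ^ (T.eltI x).exp)) := by
  have hsz : ∀ T' : S.Tree, T'.tiles ⊆ X → T'.sizeSigned N i σ f ≤ ENNReal.ofReal lam :=
    fun T' h => (le_iSup₂_of_le T' h le_rfl).trans hX
  have hN1 : (1 : ℝ) ≤ 2 ^ (N ^ 2 + 1) := one_le_pow₀ (by norm_num)
  cases x with
  | none =>
    refine (T.top_norm_le (hsz T hT)).trans (ENNReal.ofReal_le_ofReal ?_)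
    have h1 : (1 : ℝ) ≤ tileConst n N := by
      unfold tileConst
      have : (1 : ℝ) ≤ √(2 ^ K n) := by
        rw [Real.one_le_sqrt]
        exact one_le_pow₀ (by norm_num)
      nlinarith
    simp only [eltI]
    gcongr
    exact le_mul_of_one_le_left hl h1
  | some P =>
    have hP := hx P rfl
    have hQ : P.cube ∈ S.cubes := T.isMultiTile hP
    obtain ⟨ζ, hfit, hζ⟩ := exists_singleTree hn T hP i
    have h1 := (singleTree P hQ ζ hfit).tile_norm_le (Set.mem_singleton P)
      (hsz _ (Set.singleton_subset_iff.mpr (hT hP)))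
    have h2 : T.eltNorm N i σ f (some P) ≤ ENNReal.ofReal (2 ^ (N ^ 2 + 1)) *
        (singleTree P hQ ζ hfit).eltNorm N i σ f (some P) := by
      rcases hζ with rfl | ⟨h3, h4⟩
      · have e : (singleTree P hQ T.zeta hfit).eltNorm N i σ f (some P) =
            T.eltNorm N i σ f (some P) := by
          unfold eltNorm
          rw [T.ξ_eq]
          rfl
        rw [e]
        exact le_mul_of_one_le_left (by positivity) (by rwa [ENNReal.one_le_ofReal])
      · have hv := S.v_abs_pos i
        refine phaseNorm_riesz_le hN _ (T.eltω_len_pos i (some P)) σ ?_ ?_ f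
        · simp only [eltω, tile]
          rw [T.ξ_apply, mul_comm T.zeta, ← mul_sub, abs_mul]
          calc _ = |S.v i| * (400 * 2 ^ P.cube.exp) := by simp only [Cube.side]; ring
            _ ≤ _ := by gcongr
        · simp only [eltω, tile, singleTree, Pi.smul_apply, smul_eq_mul]
          rw [T.ξ_apply, ← sub_mul, abs_mul]
          calc _ ≤ (20 * 2 ^ P.cube.exp) * |S.v i| := by gcongr
            _ = _ := by simp only [Cube.side]; ring
    refine (h2.trans (mul_le_mul_right h1 _)).trans (le_of_eq ?_)
    rw [← ENNReal.ofReal_mul (by positivity)]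
    congr 1
    have e : (2 : ℝ) ^ (singleTree P hQ ζ hfit).I.exp = 2 ^ P.I.exp * 2 ^ K n := by
      simp only [singleTree, DyadicIvl.up]
      rw [zpow_add₀ (by norm_num), zpow_natCast]
    rw [e, Real.sqrt_mul (by positivity)]
    simp only [eltI, tileConst]
    ring

/-! ### Successive removal of maximal trees -/

/-- `Y` is left of `X` after the successive removal of the maximal trees in the list. -/
inductive Peels : Set (MultiTile n) → List S.Tree → Set (MultiTile n) → Prop
  | nil (X : Set (MultiTile n)) : Peels X [] X
  | cons {X Y : Set (MultiTile n)} {T : S.Tree} {L : List S.Tree} (hT : T.IsMaximalIn X)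
      (h : Peels (X \ T.tiles) L Y) : Peels X (T :: L) Y

theorem Tree.IsMaximalIn.subset {T : S.Tree} {X : Set (MultiTile n)} (h : T.IsMaximalIn X) :
    T.tiles ⊆ X := by
  rw [show T.tiles = _ from h]
  exact Set.sep_subset _ _

theorem Peels.append {X Y Z : Set (MultiTile n)} {L L' : List S.Tree} (h : Peels X L Y)
    (h' : Peels Y L' Z) : Peels X (L ++ L') Z := by
  induction h with
  | nil X => exact h'
  | cons hT _ ih => exact Peels.cons hT (ih h')

theorem Peels.eq_diff {X Y : Set (MultiTile n)} {L : List S.Tree} (h : Peels X L Y) :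
    Y = {P ∈ X | ∀ T ∈ L, P ∉ T.tiles} := by
  induction h with
  | nil X => simp
  | cons hT _ ih =>
    rw [ih]
    ext P
    simp [and_assoc]

theorem Peels.subset {X Y : Set (MultiTile n)} {L : List S.Tree} (h : Peels X L Y) : Y ⊆ X := by
  rw [h.eq_diff]
  exact Set.sep_subset _ _

theorem Peels.tiles_subset {X Y : Set (MultiTile n)} {L : List S.Tree} (h : Peels X L Y) :
    ∀ T ∈ L, T.tiles ⊆ X := by
  induction h with
  | nil X => simp
  | cons hT _ ih =>
    intro T' hT'
    rcases List.mem_cons.mp hT' with rfl | hT'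
    · exact hT.subset
    · exact (ih T' hT').trans Set.sdiff_subset

theorem Peels.pairwise_disjoint {X Y : Set (MultiTile n)} {L : List S.Tree} (h : Peels X L Y) :
    L.Pairwise fun T T' => Disjoint T.tiles T'.tiles := by
  induction h with
  | nil X => exact List.Pairwise.nil
  | cons hT h ih =>
    refine List.pairwise_cons.mpr ⟨fun T' hT' => ?_, ih⟩
    exact Set.disjoint_left.mpr fun P hP hP' => (h.tiles_subset T' hT' hP').2 hP

theorem IsConvexSet.subset {X : Set (MultiTile n)} (h : S.IsConvexSet X) : X ⊆ S.P1 := by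
  obtain ⟨r, U, -, rfl⟩ := h
  exact Set.sdiff_subset

/-- `X` is exactly what a greedy process has left, so a tree maximal in `X` is an admissible next
step of that process. -/
theorem IsConvexSet.diff {X : Set (MultiTile n)} (h : S.IsConvexSet X) {T : S.Tree}
    (hT : T.IsMaximalIn X) : S.IsConvexSet (X \ T.tiles) ∧ T.IsConvex := by
  obtain ⟨r, U, hU, rfl⟩ := h
  set U' : Fin (r + 1) → S.Tree := Fin.snoc U T with hU'
  have hcast : ∀ k : Fin r, U' k.castSucc = U k := fun k => by simp [hU']
  have hlast : U' (Fin.last r) = T := by simp [hU']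
  have hun : ⋃ j, ⋃ _ : j < Fin.last r, (U' j).tiles = ⋃ k, (U k).tiles := by
    ext P
    simp only [Set.mem_iUnion]
    constructor
    · rintro ⟨j, hj, hP⟩
      refine Fin.lastCases (fun hj _ => absurd hj (lt_irrefl _)) (fun k _ hP => ?_) j hj hP
      exact ⟨k, hcast k ▸ hP⟩
    · rintro ⟨k, hP⟩
      exact ⟨k.castSucc, Fin.castSucc_lt_last k, (hcast k).symm ▸ hP⟩
  have hgreedy : IsGreedy U' := by
    intro k
    refine Fin.lastCases ?_ (fun k => ?_) k
    · rw [hlast, hun]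
      exact hT
    · have e : ⋃ j, ⋃ _ : j < k.castSucc, (U' j).tiles = ⋃ j, ⋃ _ : j < k, (U j).tiles := by
        ext P
        simp only [Set.mem_iUnion]
        constructor
        · rintro ⟨j, hj, hP⟩
          refine Fin.lastCases (fun hj _ => ?_) (fun l hl hP => ?_) j hj hP
          · exact absurd (hj.trans (Fin.castSucc_lt_last k)) (lt_irrefl _)
          · exact ⟨l, Fin.castSucc_lt_castSucc_iff.mp hl, hcast l ▸ hP⟩
        · rintro ⟨l, hl, hP⟩
          exact ⟨l.castSucc, Fin.castSucc_lt_castSucc_iff.mpr hl, (hcast l).symm ▸ hP⟩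
      rw [hcast, e]
      exact hU k
  refine ⟨⟨r + 1, U', hgreedy, ?_⟩, r + 1, U', hgreedy, Fin.last r, hlast⟩
  rw [Set.sdiff_sdiff]
  congr 1
  ext P
  simp only [Set.mem_union, Set.mem_iUnion]
  constructor
  · rintro (⟨k, hP⟩ | hP)
    · exact ⟨k.castSucc, (hcast k).symm ▸ hP⟩
    · exact ⟨Fin.last r, hlast.symm ▸ hP⟩
  · rintro ⟨j, hP⟩
    refine Fin.lastCases (fun hP => Or.inr (hlast ▸ hP)) (fun k hP => Or.inl ⟨k, hcast k ▸ hP⟩) j hP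

theorem Peels.isConvex {X Y : Set (MultiTile n)} {L : List S.Tree} (h : Peels X L Y)
    (hX : S.IsConvexSet X) : S.IsConvexSet Y ∧ ∀ T ∈ L, T.IsConvex := by
  induction h with
  | nil X => exact ⟨hX, by simp⟩
  | cons hT _ ih =>
    have h1 := hX.diff hT
    obtain ⟨h2, h3⟩ := ih h1.1
    refine ⟨h2, fun T' hT' => ?_⟩
    rcases List.mem_cons.mp hT' with rfl | hT'
    · exact h1.2
    · exact h3 T' hT'

/-- The sum of the widths of the trees in a list. -/
def totalWidth (L : List S.Tree) : ℝ := (L.map fun T => T.I.ivl.len).sum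

theorem totalWidth_append (L L' : List S.Tree) :
    totalWidth (L ++ L') = totalWidth L + totalWidth L' := by
  simp [totalWidth]

/-- The removal of all multi-tiles which fit one of finitely many given tops. -/
theorem exists_peels_tops (tops : List (ℝ × DyadicIvl))
    (htops : ∀ p ∈ tops, p.2.IsKDyadic n) {X : Set (MultiTile n)} (hX : X ⊆ S.P0) :
    ∃ L : List S.Tree, Peels X L {P ∈ X | ∀ p ∈ tops, ¬ S.Fits (p.1 • S.v) p.2 P} ∧
      totalWidth L ≤ (tops.map fun p => p.2.ivl.len).sum := by
  induction tops generalizing X with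
  | nil =>
    refine ⟨[], ?_, by simp [totalWidth]⟩
    have : {P ∈ X | ∀ p ∈ ([] : List (ℝ × DyadicIvl)), ¬ S.Fits (p.1 • S.v) p.2 P} = X := by
      ext P
      simp
    rw [this]
    exact Peels.nil X
  | cons p tops ih =>
    obtain ⟨L, hL, hw⟩ := ih (fun q hq => htops q (List.mem_cons_of_mem _ hq))
      (X := {P ∈ X | ¬ S.Fits (p.1 • S.v) p.2 P}) ((Set.sep_subset _ _).trans hX)
    have e : {P ∈ {P ∈ X | ¬ S.Fits (p.1 • S.v) p.2 P} |
        ∀ q ∈ tops, ¬ S.Fits (q.1 • S.v) q.2 P} =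
        {P ∈ X | ∀ q ∈ p :: tops, ¬ S.Fits (q.1 • S.v) q.2 P} := by
      ext P
      simp [and_assoc]
    rw [e] at hL
    rw [List.map_cons, List.sum_cons]
    -- Trees are non-empty by definition, so a top which nothing fits any more is skipped.
    by_cases hne : {P ∈ X | S.Fits (p.1 • S.v) p.2 P}.Nonempty
    · let T : S.Tree := ⟨{P ∈ X | S.Fits (p.1 • S.v) p.2 P}, p.1 • S.v, p.2, hne,
        (Set.sep_subset _ _).trans hX, Submodule.smul_mem _ _ (Submodule.mem_span_singleton_self _),
        htops p (List.mem_cons_self ..), fun P hP => hP.2⟩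
      refine ⟨T :: L, Peels.cons rfl ?_, ?_⟩
      · have e2 : X \ T.tiles = {P ∈ X | ¬ S.Fits (p.1 • S.v) p.2 P} := by
          ext P
          simp only [T, Set.mem_sdiff, Set.mem_sep_iff]
          tauto
        rw [e2]
        exact hL
      · simp only [totalWidth, List.map_cons, List.sum_cons] at hw ⊢
        exact add_le_add le_rfl hw
    · refine ⟨L, ?_, hw.trans (le_add_of_nonneg_left p.2.len_pos.le)⟩
      have e2 : {P ∈ X | ¬ S.Fits (p.1 • S.v) p.2 P} = X := by
        ext P
        simp only [Set.mem_sep_iff, and_iff_left_iff_imp]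
        exact fun hP hf => hne ⟨P, hP, hf⟩
      rwa [e2] at hL

theorem Tree.exists_peels_shadow (T : S.Tree) (J : ℕ) {X : Set (MultiTile n)} (hX : X ⊆ S.P0) :
    ∃ L : List S.Tree, Peels X L {P ∈ X | ¬ T.Shadow J P} ∧
      totalWidth L ≤ 3 * (2 * J + 1) * T.I.ivl.len := by
  let s : Finset (ℤ × ℤ) := Finset.Icc (-1) 1 ×ˢ Finset.Icc (-(J : ℤ)) J
  obtain ⟨L, hL, hw⟩ := exists_peels_tops (S := S)
    (s.toList.map fun p => (T.zeta + 300 * p.1 / 2 ^ T.I.exp, T.I.shift p.2)) (by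
      intro p hp
      obtain ⟨q, -, rfl⟩ := List.mem_map.mp hp
      exact T.I_kdyadic) hX
  refine ⟨L, ?_, hw.trans (le_of_eq ?_)⟩
  · convert hL using 1
    ext P
    simp only [Set.mem_sep_iff, and_congr_right_iff, List.mem_map, Finset.mem_toList,
      Tree.Shadow, s, Finset.mem_product, Finset.mem_Icc]
    intro _
    push Not
    constructor
    · rintro h _ ⟨⟨ε, j⟩, ⟨h1, h2⟩, rfl⟩
      exact h ε j (abs_le.mpr h1) (abs_le.mpr h2)
    · intro h ε j h1 h2
      exact h _ ⟨(ε, j), ⟨abs_le.mp h1, abs_le.mp h2⟩, rfl⟩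
  · have hc : s.card = 3 * (2 * J + 1) := by
      simp only [s, Finset.card_product, Int.card_Icc]
      have : ((J : ℤ) + 1 - -J).toNat = 2 * J + 1 := by omega
      rw [this]
      rfl
    have : ((fun p : ℝ × DyadicIvl => p.2.ivl.len) ∘ fun p : ℤ × ℤ =>
        (T.zeta + 300 * p.1 / 2 ^ T.I.exp, T.I.shift p.2)) = fun _ => T.I.ivl.len := by
      funext p
      rfl
    rw [List.map_map, this, List.map_const', List.sum_replicate, Finset.length_toList, hc,
      nsmul_eq_mul]
    push_cast
    ring

/-- Trees of a given kind are selected in the order of a nearly maximal score, and with each one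
its shadow is removed, until no such tree is left. -/
theorem exists_selection (good : S.Tree → Prop) (J : S.Tree → ℕ) (score : S.Tree → ℝ) {δ : ℝ}
    (hδ : 0 < δ) {X : Set (MultiTile n)} (hfin : X.Finite) (hX : X ⊆ S.P0)
    (hbdd : ∃ M, ∀ T, T.tiles ⊆ X → score T ≤ M) :
    ∃ Ts L : List S.Tree, ∃ Y, (∀ T ∈ Ts, good T ∧ T.tiles ⊆ X) ∧
      Ts.Pairwise (fun T T' => score T' ≤ score T + δ ∧ ∀ P ∈ T'.tiles, ¬ T.Shadow (J T) P) ∧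
      Peels X L Y ∧ totalWidth L ≤ (Ts.map fun T => 3 * (2 * J T + 1) * T.I.ivl.len).sum ∧
      ∀ T, T.tiles ⊆ Y → ¬ good T := by
  induction h : X.ncard using Nat.strong_induction_on generalizing X with
  | _ N ih =>
    subst h
    by_cases hex : ∃ T, T.tiles ⊆ X ∧ good T
    swap
    · push Not at hex
      exact ⟨[], [], X, by simp, List.Pairwise.nil, Peels.nil X, by simp [totalWidth], hex⟩
    obtain ⟨M, hM⟩ := hbdd
    -- Top frequencies range over a continuum, so the supremum of the scores may not be attained;
    -- hence the slack `δ`.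
    set A : Set ℝ := {x | ∃ T : S.Tree, T.tiles ⊆ X ∧ good T ∧ score T = x} with hA
    have hAne : A.Nonempty := by
      obtain ⟨T, h1, h2⟩ := hex
      exact ⟨_, T, h1, h2, rfl⟩
    have hAbdd : BddAbove A := ⟨M, by rintro _ ⟨T, h1, -, rfl⟩; exact hM T h1⟩
    obtain ⟨_, ⟨T, hTX, hTg, rfl⟩, hlt⟩ := exists_lt_of_lt_csSup hAne (sub_lt_self (sSup A) hδ)
    have hmax : ∀ T', T'.tiles ⊆ X → good T' → score T' ≤ score T + δ := fun T' h1 h2 => by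
      have := le_csSup hAbdd ⟨T', h1, h2, rfl⟩
      linarith
    obtain ⟨L₀, hL₀, hw₀⟩ := T.exists_peels_shadow (J T) hX
    have hsub : {P ∈ X | ¬ T.Shadow (J T) P} ⊆ X := Set.sep_subset _ _
    -- The shadow contains `T` itself, so every step removes at least one multi-tile and the
    -- recursion ends.
    have hlt' : {P ∈ X | ¬ T.Shadow (J T) P}.ncard < X.ncard := by
      refine Set.ncard_lt_ncard (LE.le.ssubset_of_not_superset hsub fun hcon => ?_) hfin
      obtain ⟨P, hP⟩ := T.nonempty
      exact (hcon (hTX hP)).2 (T.shadow_of_mem _ hP)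
    obtain ⟨Ts, L, Y, h1, h2, h3, h4, h5⟩ := ih _ hlt' (hfin.subset hsub) (hsub.trans hX)
      ⟨M, fun T' hT' => hM T' (hT'.trans hsub)⟩ rfl
    refine ⟨T :: Ts, L₀ ++ L, Y, ?_, ?_, hL₀.append h3, ?_, h5⟩
    · intro T' hT'
      rcases List.mem_cons.mp hT' with rfl | hT'
      · exact ⟨hTg, hTX⟩
      · exact ⟨(h1 T' hT').1, (h1 T' hT').2.trans hsub⟩
    · refine List.pairwise_cons.mpr ⟨fun T' hT' => ⟨?_, fun P hP => ((h1 T' hT').2 hP).2⟩, h2⟩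
      exact hmax T' ((h1 T' hT').2.trans hsub) (h1 T' hT').1
    · rw [totalWidth_append, List.map_cons, List.sum_cons]
      exact add_le_add hw₀ h4

/-! ### Finiteness -/

theorem P1_finite (S : Setting n) : S.P1.Finite := by
  set R : ℝ := 2 ^ ((K n : ℤ) * S.k) with hR
  refine Set.Finite.subset (S.cubes_finite.biUnion fun Q _ =>
    ((Set.finite_Icc ⌊-R / 2 ^ (-Q.exp)⌋ ⌈R / 2 ^ (-Q.exp)⌉).image
      fun a => (⟨Q, a⟩ : MultiTile n))) ?_
  rintro ⟨Q, a⟩ ⟨hQ, hI⟩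
  refine Set.mem_biUnion hQ ⟨a, ?_, rfl⟩
  rw [DyadicIvl.toSet_eq] at hI
  simp only [MultiTile.I] at hI
  have hp : (0 : ℝ) < 2 ^ (-Q.exp) := by positivity
  have h1 := hI (show (2 : ℝ) ^ (-Q.exp) * a ∈ _ from ⟨le_rfl, by nlinarith⟩)
  rw [Set.mem_Icc] at h1
  constructor
  · have : -R / 2 ^ (-Q.exp) ≤ a := by rw [div_le_iff₀ hp]; linarith [h1.1]
    exact_mod_cast (Int.floor_le _).trans this
  · have : (a : ℝ) ≤ R / 2 ^ (-Q.exp) := by rw [le_div_iff₀ hp]; linarith [h1.2]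
    exact_mod_cast this.trans (Int.le_ceil _)

/-- A tree contains a multi-tile, and its top frequency is within `5 C₀` side lengths of the sides
of the corresponding cube, one of finitely many. -/
theorem exists_score_bound (hn : 1 ≤ n) (S : Setting n) (i : Fin n) (σ : ℤˣ) :
    ∃ M, ∀ T : S.Tree, ((σ : ℤ) : ℝ) * T.ξ i ≤ M := by
  obtain ⟨M, hM⟩ := (S.cubes_finite.image fun Q : Cube n =>
    |S.v i| * (|(Q.side i).ctr| + 5 * C0 n * 2 ^ Q.exp)).bddAbove
  refine ⟨M, fun T => ?_⟩
  obtain ⟨P, hP⟩ := T.nonempty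
  refine le_trans ?_ (hM ⟨P.cube, T.isMultiTile hP, rfl⟩)
  have h := T.abs_ctr_sub_le hn hP i
  have hσ : ((σ : ℤ) : ℝ) * T.ξ i ≤ |T.ξ i| := by
    rcases Int.units_eq_one_or σ with rfl | rfl
    · simpa using le_abs_self _
    · simpa using neg_le_abs _
  refine hσ.trans ?_
  rw [T.ξ_apply, abs_mul, mul_comm]
  refine mul_le_mul_of_nonneg_left ?_ (abs_nonneg _)
  have := abs_sub_abs_le_abs_sub T.zeta (P.cube.side i).ctr
  rw [abs_sub_comm] at this
  linarith

end Setting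

theorem orthoConst_nonneg {D B : ℝ} (hD : 0 ≤ D) (hB : 0 ≤ B) : 0 ≤ orthoConst D B := by
  have := decayMass_nonneg
  unfold orthoConst
  positivity

namespace Setting

variable {n : ℕ} {S : Setting n}

/-! ### Trees of the same class are almost orthogonal -/

/-- The number of translates which are removed along with a tree with packets on the `j`-th
translates. -/
def shadowRadius (j : ℤ) : ℕ := 4 * j.natAbs + 3

theorem shadowRadius_cast (j : ℤ) : (shadowRadius j : ℝ) = 4 * |(j : ℝ)| + 3 := by
  unfold shadowRadius
  push_cast
  rw [Nat.cast_natAbs]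
  push_cast
  ring

/-- A sequence of selected trees with packets on the translates by `j` and of the same kind. -/
structure TreeClass (S : Setting n) (N : ℕ) (i : Fin n) (σ : ℤˣ)
    (f : Lp ℂ 2 (volume : Measure ℝ)) (lam : ℝ) (j : ℤ) (b : Bool) (r : ℕ) where
  T : Fin r → S.Tree
  W : ∀ l, (T l).Witness N i σ f lam j b
  norm_le : ∀ l, ∀ x ∈ (W l).elts, ‖((W l).pkt x).F‖ ≤
    (1 + |(j : ℝ)|) ^ 10 * (tileConst n N * (2 * lam)) * √(2 ^ ((T l).eltI x).exp)
  score : ∀ l l', l < l' → ((σ : ℤ) : ℝ) * (T l').ξ i ≤ ((σ : ℤ) : ℝ) * (T l).ξ i +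
    1 / 2 ^ (T l').I.exp
  shadow : ∀ l l', l < l' → ∀ P ∈ (T l').tiles, ¬ (T l).Shadow (shadowRadius j) P

namespace TreeClass

variable {N : ℕ} {i : Fin n} {σ : ℤˣ} {f : Lp ℂ 2 (volume : Measure ℝ)} {lam : ℝ} {j : ℤ}
  {b : Bool} {r : ℕ} (C : TreeClass S N i σ f lam j b r)

/-- The index set of the packets of a class of trees. -/
abbrev Idx : Type := Σ l : Fin r, (C.W l).elts

theorem eq_of_common {l l' : Fin r} {P : MultiTile n} (h : P ∈ (C.T l).tiles)
    (h' : P ∈ (C.T l').tiles) : l = l' := by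
  rcases lt_trichotomy l l' with hlt | heq | hlt
  · exact absurd ((C.T l).shadow_of_mem _ h) (C.shadow _ _ hlt P h')
  · exact heq
  · exact absurd ((C.T l').shadow_of_mem _ h') (C.shadow _ _ hlt P h)

theorem exp_le (p : C.Idx) : ((C.T p.1).eltI p.2.1).exp ≤ (C.T p.1).I.exp := by
  obtain ⟨l, x, hx⟩ := p
  cases x with
  | none => exact le_rfl
  | some P => exact DyadicIvl.exp_le_of_subset ((C.T l).fits_iff ((C.W l).isElt _ hx P rfl)).1

theorem dyIco_subset (p : C.Idx) :
    dyIco ((C.T p.1).eltI p.2.1).exp ((C.T p.1).eltI p.2.1).pos ⊆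
      dyIco (C.T p.1).I.exp (C.T p.1).I.pos := by
  obtain ⟨l, x, hx⟩ := p
  cases x with
  | none => exact subset_rfl
  | some P => exact dyIco_subset_of_subset ((C.T l).fits_iff ((C.W l).isElt _ hx P rfl)).1

/-- Otherwise the interval of `q` would lie in one of the translates of the top interval that belong
to the shadow of the earlier tree. Then the multi-tile `q`, or, if `q` is a top, a multi-tile of its
tree, would have been removed before the later tree was picked. That all packets of a class are of
the same kind excludes the mixed cases. -/
theorem sep (hn : 1 ≤ n) (p q : C.Idx) (hl : p.1 < q.1)
    (he : ((C.T q.1).eltI q.2.1).exp < ((C.T p.1).eltI p.2.1).exp)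
    (hc : |((C.T p.1).eltω i p.2.1).ctr - ((C.T q.1).eltω i q.2.1).ctr| ≤
      20 * (|S.v i| / 2 ^ ((C.T q.1).eltI q.2.1).exp)) {x : ℝ}
    (hx : x ∈ dyIco ((C.T q.1).eltI q.2.1).exp ((C.T q.1).eltI q.2.1).pos) :
    (4 * |(j : ℝ)| + 3) * 2 ^ (C.T p.1).I.exp ≤ |x - (C.T p.1).I.ivl.ctr| := by
  by_contra! hlt
  rw [← shadowRadius_cast] at hlt
  obtain ⟨k, hk, hxk⟩ := exists_mem_shift hlt
  have hle := C.exp_le p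
  obtain ⟨l, y, hy⟩ := p
  obtain ⟨l', y', hy'⟩ := q
  simp only at *
  have hsub : ((C.T l').eltI y').ivl.toSet ⊆ ((C.T l).I.shift k).ivl.toSet :=
    DyadicIvl.subset_of_mem (by simp only [DyadicIvl.shift]; omega) hx hxk
  have hb := (C.W l).isSome y hy
  have hb' := (C.W l').isSome y' hy'
  have hv := S.v_abs_pos i
  cases y with
  | none =>
    cases y' with
    | none =>
      obtain ⟨P, hP⟩ := (C.T l').nonempty
      refine C.shadow l l' hl P hP ((C.T l).shadow_of_top hn (C.T l') hk he ?_ hsub hP)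
      simp only [Tree.eltω, omegaTop, Tree.ξ_apply, Tree.eltI] at hc
      rw [← sub_mul, abs_mul, ← mul_div_assoc, mul_comm 20, mul_div_assoc,
        mul_comm |S.v i|] at hc
      exact le_of_mul_le_mul_right hc hv
    | some P' => simp [← hb'] at hb
  | some P =>
    cases y' with
    | none => simp [← hb'] at hb
    | some P' =>
      have hP := (C.W l).isElt _ hy P rfl
      have hP' := (C.W l').isElt _ hy' P' rfl
      refine C.shadow l l' hl P' hP' ((C.T l).shadow_of_tile hn hk hP ((C.T l').isMultiTile hP')
        he (i := i) ?_ hsub)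
      simp only [Tree.eltω, tile, Tree.eltI, MultiTile.I, zpow_neg, div_inv_eq_mul] at hc
      rw [← mul_sub, abs_mul, mul_left_comm] at hc
      exact le_of_mul_le_mul_left hc hv

/-- For multi-tiles, equal scale and nearby frequency force equal cubes by sparseness, and a
multi-tile belongs to only one selected tree. For tops, at most one tree has a multi-tile of full
width, by `eq_of_full_width`. The remaining ones have normalized top frequencies more than `100 /
|I|` apart: otherwise `shadow_of_eq` would put multi-tiles of the later tree into the shadow of the
earlier one. The shifts by `± 300 / |I|` in the definition of the shadow serve this purpose. -/
theorem count (hn : 1 ≤ n) (e₀ a₀ : ℤ) (y : ℝ) (t : Finset C.Idx)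
    (ht : ∀ q ∈ t, ((C.T q.1).eltI q.2.1).exp = e₀ ∧ ((C.T q.1).eltI q.2.1).pos = a₀ ∧
      |((C.T q.1).eltω i q.2.1).ctr - y| ≤ (5 * C0 n + 20) * (|S.v i| / 2 ^ e₀)) :
    (t.card : ℝ) ≤ 5 * C0 n + 22 := by
  classical
  have hv := S.v_abs_pos i
  have hC := thousand_le_C0 hn
  have hK := C0_le_two_pow_K hn
  have hE : (0 : ℝ) < 2 ^ e₀ := by positivity
  cases b with
  | true =>
    have h1 : t.card ≤ 1 := by
      rw [Finset.card_le_one]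
      rintro ⟨l, x, hx⟩ hp ⟨l', x', hx'⟩ hq
      have hb := (C.W l).isSome x hx
      have hb' := (C.W l').isSome x' hx'
      obtain ⟨P, rfl⟩ := Option.isSome_iff_exists.mp hb
      obtain ⟨P', rfl⟩ := Option.isSome_iff_exists.mp hb'
      have hP := (C.W l).isElt _ hx P rfl
      have hP' := (C.W l').isElt _ hx' P' rfl
      obtain ⟨e1, a1, c1⟩ := ht _ hp
      obtain ⟨e2, a2, c2⟩ := ht _ hq
      simp only [Tree.eltI, MultiTile.I] at e1 a1 e2 a2
      have hQ : P.cube = P'.cube := by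
        refine cube_eq ((C.T l).isMultiTile hP) ((C.T l').isMultiTile hP') (by omega) i ?_
        have h3 := abs_sub_le ((C.T l).eltω i (some P)).ctr y ((C.T l').eltω i (some P')).ctr
        rw [abs_sub_comm y] at h3
        have h4 : |((C.T l).eltω i (some P)).ctr - ((C.T l').eltω i (some P')).ctr| ≤
            |S.v i| * ((10 * C0 n + 40) * 2 ^ P.cube.exp) := by
          refine (h3.trans (add_le_add c1 c2)).trans (le_of_eq ?_)
          rw [← e1, zpow_neg, div_inv_eq_mul]
          ring
        simp only [Tree.eltω, tile] at h4
        rw [← mul_sub, abs_mul] at h4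
        refine (le_of_mul_le_mul_left h4 hv).trans_lt ?_
        have : (0 : ℝ) < 2 ^ P.cube.exp := by positivity
        gcongr
        linarith
      have hPP : P = P' := MultiTile.ext hQ (a1.trans a2.symm)
      subst hPP
      obtain rfl := C.eq_of_common hP hP'
      rfl
    have h2 : (t.card : ℝ) ≤ 1 := by exact_mod_cast h1
    linarith
  | false =>
    have hnone : ∀ q ∈ t, q.2.1 = none := fun q _ => by
      simpa using (C.W q.1).isSome q.2.1 q.2.2
    have hinj : ∀ p ∈ t, ∀ q ∈ t, p.1 = q.1 → p = q := by
      rintro ⟨l, x, hx⟩ hp ⟨l', x', hx'⟩ hq h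
      have h1 := hnone _ hp
      have h2 := hnone _ hq
      simp only at h h1 h2
      subst h h1 h2
      rfl
    have hI : ∀ q ∈ t, (C.T q.1).I = ⟨e₀, a₀⟩ := fun q hq => by
      obtain ⟨h1, h2, -⟩ := ht q hq
      rw [hnone q hq] at h1 h2
      exact DyadicIvl.ext h1 h2
    have hz : ∀ q ∈ t, |(C.T q.1).zeta - y / S.v i| ≤ (5 * C0 n + 20) * (1 / 2 ^ e₀) := by
      intro q hq
      obtain ⟨-, -, h3⟩ := ht q hq
      rw [hnone q hq] at h3
      simp only [Tree.eltω, omegaTop, Tree.ξ_apply] at h3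
      have e : (C.T q.1).zeta * S.v i - y = ((C.T q.1).zeta - y / S.v i) * S.v i := by
        have := S.v_ne_zero i
        field_simp
      rw [e, abs_mul] at h3
      refine le_of_mul_le_mul_right (h3.trans (le_of_eq ?_)) hv
      ring
    have hzz : ∀ p ∈ t, ∀ q ∈ t, |(C.T p.1).zeta - (C.T q.1).zeta| ≤
        (10 * C0 n + 40) / 2 ^ (C.T p.1).I.exp := by
      intro p hp q hq
      have h1 := hz p hp
      have h2 := hz q hq
      have h3 := abs_sub_le (C.T p.1).zeta (y / S.v i) (C.T q.1).zeta
      rw [abs_sub_comm (y / S.v i)] at h3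
      rw [hI p hp]
      refine (h3.trans (add_le_add h1 h2)).trans (le_of_eq ?_)
      ring
    set full : C.Idx → Prop := fun q => ∃ P ∈ (C.T q.1).tiles, P.I.exp = (C.T q.1).I.exp with hfull
    have h1 : ((t.filter full).card : ℝ) ≤ 1 := by
      have : (t.filter full).card ≤ 1 := by
        rw [Finset.card_le_one]
        intro p hp q hq
        rw [Finset.mem_filter] at hp hq
        obtain ⟨hp, P, hP, heP⟩ := hp
        obtain ⟨hq, P', hP', heP'⟩ := hq
        have hII : (C.T q.1).I = (C.T p.1).I := by rw [hI p hp, hI q hq]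
        have heq := (C.T p.1).eq_of_full_width hn (C.T q.1) hII (hzz p hp q hq) hP hP' heP heP'
        subst heq
        exact hinj p hp q hq (C.eq_of_common hP hP')
      exact_mod_cast this
    have h2 : ((t.filter fun q => ¬ full q).card : ℝ) ≤ (5 * C0 n + 20) + 1 := by
      refine card_le_of_separated _ (fun q => (C.T q.1).zeta) (y := y / S.v i)
        (δ := 1 / 2 ^ e₀) (by positivity) (by linarith)
        (fun q hq => hz q (Finset.mem_filter.mp hq).1) ?_
      have key : ∀ p ∈ t.filter (fun q => ¬ full q), ∀ q ∈ t.filter (fun q => ¬ full q),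
          p.1 < q.1 → 100 * (1 / 2 ^ e₀) < |(C.T p.1).zeta - (C.T q.1).zeta| := by
        intro p hp q hq hlt
        rw [Finset.mem_filter] at hp hq
        by_contra! hcon
        obtain ⟨P, hP⟩ := (C.T q.1).nonempty
        have hexp : P.I.exp < (C.T q.1).I.exp :=
          lt_of_le_of_ne (DyadicIvl.exp_le_of_subset ((C.T q.1).fits_iff hP).1)
            fun h => hq.2 ⟨P, hP, h⟩
        refine C.shadow _ _ hlt P hP ((C.T p.1).shadow_of_eq hn (C.T q.1) _ ?_ ?_ hP hexp)
        · rw [hI p hp.1, hI q hq.1]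
        · rw [hI p hp.1]
          refine hcon.trans (le_of_eq ?_)
          ring
      intro p hp q hq hpq
      rcases lt_trichotomy p.1 q.1 with h | h | h
      · exact key p hp q hq h
      · exact absurd (hinj p (Finset.mem_filter.mp hp).1 q (Finset.mem_filter.mp hq).1 h) hpq
      · rw [abs_sub_comm]
        exact key q hq p hp h
    have h3 := Finset.card_filter_add_card_filter_not (s := t) full
    have h4 : (t.card : ℝ) = ((t.filter full).card : ℝ) +
        ((t.filter fun q => ¬ full q).card : ℝ) := by
      rw [← h3]
      push_cast
      rfl
    linarith

/-- The packets of a class of trees. -/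
def family (hn : 1 ≤ n) (hlam : 0 ≤ lam) :
    PacketFamily C.Idx (Fin r) σ |S.v i| (5 * C0 n) (5 * C0 n + 22)
      ((1 + |(j : ℝ)|) ^ 10 * (tileConst n N * (2 * lam))) j f where
  e p := ((C.T p.1).eltI p.2.1).exp
  a p := ((C.T p.1).eltI p.2.1).pos
  c p := ((C.T p.1).eltω i p.2.1).ctr
  ξ p := (C.T p.1).ξ i
  l p := p.1
  width l := (C.T l).I.exp
  ctr l := (C.T l).I.ivl.ctr
  ν p := ((C.W p.1).pkt p.2.1).ν
  F p := ((C.W p.1).pkt p.2.1).F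
  one_le_V := S.one_le_v_abs i
  D_nonneg := by positivity
  Λ_nonneg := by
    have := tileConst_pos n N
    positivity
  kink p := ((C.W p.1).pkt p.2.1).kink
  dual p := ((C.W p.1).pkt p.2.1).dual
  supp p := ((C.W p.1).pkt p.2.1).supp
  near p := by
    rw [← Tree.eltω_len]
    exact (C.T p.1).abs_eltω_sub_le hn i ((C.W p.1).isElt _ p.2.2)
  sep p q hl he hc x hx := C.sep hn p q hl he hc hx
  order p q hl := by
    have hV := S.one_le_v_abs i
    have hp : (0 : ℝ) < 2 ^ ((C.T p.1).eltI p.2.1).exp := by positivity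
    rcases hl.lt_or_eq with hlt | heq
    -- The slack `1 / |I_T|` in the score is below the frequency width of every packet of that tree,
    -- since `|vᵢ| ≥ 1` and the packets are no longer than the top.
    · refine (C.score _ _ hlt).trans ?_
      gcongr
      · norm_num
      · exact C.exp_le p
    · rw [heq]
      have : 0 ≤ |S.v i| / 2 ^ ((C.T p.1).eltI p.2.1).exp := by positivity
      linarith
  count e₀ a₀ y t ht := C.count hn e₀ a₀ y t ht
  size p := C.norm_le p.1 p.2.1 p.2.2
  e_le := C.exp_le
  inside p x hx := by
    have h := C.dyIco_subset p hx
    obtain ⟨h1, h2⟩ := h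
    simp only [DyadicIvl.ivl]
    rw [abs_le]
    constructor <;> linarith
  same p q h := by
    have : p.1 = q.1 := h
    rw [this]

end TreeClass

/-- The constant in the bound of the total width of a class of trees. -/
def classConst (n N : ℕ) : ℝ :=
  orthoConst (5 * C0 n) (5 * C0 n + 22) * (1 + 4 * tileConst n N ^ 2 / witnessConst) / witnessConst

theorem classConst_nonneg (n N : ℕ) : 0 ≤ classConst n N := by
  have := witnessConst_pos
  have := orthoConst_nonneg (D := 5 * C0 n) (B := 5 * C0 n + 22) (by positivity) (by positivity)
  unfold classConst
  positivity

/-- Let `G` be the sum of the squared norms of all packets and `w = 1 + |j|`. The witnesses bound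
the total width by a multiple of `G / (w ^ 18 lam²)`, so the term `Λ² ∑ |I_T|` of the orthogonality
estimate is `O(w² G)`. One factor `G` cancels and leaves `G ≲ w² ‖f‖²`; inserted in the first bound,
this gives the power `-16`. -/
theorem TreeClass.sum_width_le (hn : 1 ≤ n) {N : ℕ} {i : Fin n} {σ : ℤˣ}
    {f : Lp ℂ 2 (volume : Measure ℝ)} {lam : ℝ} (hlam : 0 < lam) {j : ℤ} {b : Bool} {r : ℕ}
    (C : TreeClass S N i σ f lam j b r) : ∑ l, (2 : ℝ) ^ (C.T l).I.exp ≤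
      classConst n N * (‖f‖ ^ 2 / lam ^ 2) / (1 + |(j : ℝ)|) ^ 16 := by
  classical
  have hmain := (C.family hn hlam.le).sq_sum_norm_sq_le
  set G := ∑ p, ‖(C.family hn hlam.le).F p‖ ^ 2 with hG
  set M := orthoConst (5 * C0 n) (5 * C0 n + 22) with hM
  set A := ∑ l, (2 : ℝ) ^ (C.T l).I.exp with hA
  set w := 1 + |(j : ℝ)| with hw
  have hM0 : 0 ≤ M := orthoConst_nonneg (by positivity) (by positivity)
  have hκ := witnessConst_pos
  have hw1 : 1 ≤ w := le_add_of_nonneg_right (abs_nonneg _)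
  have hw0 : 0 < w := by linarith
  have hB := tileConst_pos n N
  have hG0 : 0 ≤ G := Finset.sum_nonneg fun _ _ => by positivity
  have hsum : ∑ l ∈ Finset.univ.image (C.family hn hlam.le).l,
      (2 : ℝ) ^ (C.family hn hlam.le).width l ≤ A :=
    Finset.sum_le_sum_of_subset_of_nonneg (Finset.subset_univ _) fun _ _ _ => by positivity
  have hbig : witnessConst * w ^ 18 * (lam ^ 2 * A) ≤ G := by
    have e : G = ∑ l, ∑ x ∈ (C.W l).elts, ‖((C.W l).pkt x).F‖ ^ 2 := by
      rw [hG, Fintype.sum_sigma]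
      refine Finset.sum_congr rfl fun l _ => ?_
      exact Finset.sum_coe_sort (C.W l).elts fun x => ‖((C.W l).pkt x).F‖ ^ 2
    rw [e, hA, Finset.mul_sum, Finset.mul_sum]
    exact Finset.sum_le_sum fun l _ => (C.W l).big
  have hA1 : A ≤ G / (witnessConst * w ^ 18 * lam ^ 2) := by
    rw [le_div_iff₀ (by positivity)]
    linarith
  have h1 : (w ^ 10 * (tileConst n N * (2 * lam))) ^ 2 * A ≤
      4 * tileConst n N ^ 2 / witnessConst * w ^ 2 * G := by
    calc _ ≤ (w ^ 10 * (tileConst n N * (2 * lam))) ^ 2 *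
          (G / (witnessConst * w ^ 18 * lam ^ 2)) := by gcongr
      _ = _ := by
        field_simp
        ring
  have h2 : G ^ 2 ≤ ‖f‖ ^ 2 * (M * ((1 + 4 * tileConst n N ^ 2 / witnessConst) * w ^ 2 * G)) := by
    refine hmain.trans ?_
    gcongr
    have h3 : G ≤ w ^ 2 * G := le_mul_of_one_le_left hG0 (one_le_pow₀ hw1)
    have h4 : (w ^ 10 * (tileConst n N * (2 * lam))) ^ 2 *
        ∑ l ∈ Finset.univ.image (C.family hn hlam.le).l,
          (2 : ℝ) ^ (C.family hn hlam.le).width l ≤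
        (w ^ 10 * (tileConst n N * (2 * lam))) ^ 2 * A := by gcongr
    linarith
  have h5 : G ≤ ‖f‖ ^ 2 * (M * ((1 + 4 * tileConst n N ^ 2 / witnessConst) * w ^ 2)) := by
    rcases hG0.eq_or_lt with h0 | h0
    · rw [← h0]
      positivity
    · refine le_of_mul_le_mul_right ?_ h0
      linarith
  calc A ≤ G / (witnessConst * w ^ 18 * lam ^ 2) := hA1
    _ ≤ ‖f‖ ^ 2 * (M * ((1 + 4 * tileConst n N ^ 2 / witnessConst) * w ^ 2)) /
        (witnessConst * w ^ 18 * lam ^ 2) := by gcongr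
    _ = _ := by
      unfold classConst
      rw [← hM]
      field_simp

/-! ### Selection of trees of large signed size -/

/-- A crude count of packets, each of norm at most a multiple of `‖f‖`. The dependence on the
cardinality is harmless: the bound serves only to show that the maximal size is finite and that the
widths of trees of large size are bounded. -/
theorem Tree.Witness.sq_mul_width_le {T : S.Tree} {N : ℕ} {i : Fin n} {σ : ℤˣ}
    {f : Lp ℂ 2 (volume : Measure ℝ)} {lam : ℝ} {j : ℤ} {b : Bool}
    (W : T.Witness N i σ f lam j b) {X : Set (MultiTile n)} (hfin : X.Finite)
    (hT : T.tiles ⊆ X) : witnessConst * (lam ^ 2 * 2 ^ T.I.exp) ≤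
      (X.ncard + 1) * ((5 + 5 * C0 n) * ‖f‖) ^ 2 := by
  classical
  have hκ := witnessConst_pos
  have hcard : W.elts.card ≤ X.ncard + 1 := by
    have hsub : W.elts ⊆ Finset.insertNone hfin.toFinset := by
      intro x hx
      rw [Finset.mem_insertNone]
      intro P hP
      rw [Set.Finite.mem_toFinset]
      exact hT (W.isElt x hx P hP)
    refine (Finset.card_le_card hsub).trans (le_of_eq ?_)
    rw [Finset.card_insertNone, Set.ncard_eq_toFinset_card X hfin]
  have h1 : (1 : ℝ) ≤ (1 + |(j : ℝ)|) ^ 18 :=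
    one_le_pow₀ (le_add_of_nonneg_right (abs_nonneg _))
  calc witnessConst * (lam ^ 2 * 2 ^ T.I.exp)
      ≤ witnessConst * (1 + |(j : ℝ)|) ^ 18 * (lam ^ 2 * 2 ^ T.I.exp) := by
        gcongr
        exact le_mul_of_one_le_right hκ.le h1
    _ ≤ ∑ x ∈ W.elts, ‖(W.pkt x).F‖ ^ 2 := W.big
    _ ≤ ∑ x ∈ W.elts, ((5 + 5 * C0 n) * ‖f‖) ^ 2 := by
        refine Finset.sum_le_sum fun x hx => ?_
        exact pow_le_pow_left₀ (norm_nonneg _) (W.le_norm x hx) 2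
    _ = W.elts.card * ((5 + 5 * C0 n) * ‖f‖) ^ 2 := by
        rw [Finset.sum_const, nsmul_eq_mul]
    _ ≤ _ := by
        gcongr
        exact_mod_cast hcard

theorem exists_maxSizeSigned_le (hn : 1 ≤ n) {N : ℕ} (hN : 2 ≤ N) (i : Fin n) (σ : ℤˣ)
    (f : Lp ℂ 2 (volume : Measure ℝ)) {X : Set (MultiTile n)} (hX : X ⊆ S.P1) :
    ∃ lam : ℝ, 0 < lam ∧ S.maxSizeSigned N i σ f X ≤ ENNReal.ofReal lam := by
  have hfin : X.Finite := S.P1_finite.subset hX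
  obtain ⟨E, hE⟩ := (S.cubes_finite.image fun Q : Cube n => Q.exp).bddAbove
  have hκ := witnessConst_pos
  have hs : (0 : ℝ) < 2 ^ (-E) := by positivity
  set R : ℝ := (X.ncard + 1) * ((5 + 5 * C0 n) * ‖f‖) ^ 2 with hR
  have hR0 : 0 ≤ R := by positivity
  -- The summand `1` contradicts the crude bound strictly and also ensures `lam ≤ lam²`; `2 ^ (-E)`
  -- bounds the width of every tree from below.
  set lam : ℝ := R / (witnessConst * 2 ^ (-E)) + 1 with hlam
  have hlam1 : 1 ≤ lam := le_add_of_nonneg_left (by positivity)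
  refine ⟨lam, by linarith, iSup₂_le fun T hT => ?_⟩
  by_contra! hlt
  obtain ⟨j, b, ⟨W⟩⟩ := T.exists_witness hn (hfin.subset hT) hN i σ f (by linarith) hlt
  have h1 := W.sq_mul_width_le hfin hT
  obtain ⟨P, hP⟩ := T.nonempty
  have h2 : (2 : ℝ) ^ (-E) ≤ 2 ^ T.I.exp := by
    apply zpow_le_zpow_right₀ (by norm_num)
    have h3 := DyadicIvl.exp_le_of_subset (T.fits_iff hP).1
    have h4 := hE ⟨P.cube, T.isMultiTile hP, rfl⟩
    simp only [MultiTile.I] at h3 h4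
    omega
  have h5 : witnessConst * (lam * 2 ^ (-E)) ≤ R := by
    refine le_trans ?_ h1
    gcongr
    nlinarith
  have h6 : lam * (witnessConst * 2 ^ (-E)) = R + witnessConst * 2 ^ (-E) := by
    rw [hlam]
    field_simp
  have h7 : 0 < witnessConst * (2 : ℝ) ^ (-E) := by positivity
  linarith

/-- The constant in the bound of the total width in one step of the selection. -/
def stepConst (n N : ℕ) : ℝ := 48 * classConst n N * shellMass

theorem stepConst_nonneg (n N : ℕ) : 0 ≤ stepConst n N := by
  have := classConst_nonneg n N
  have := shellMass_pos
  unfold stepConst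
  positivity

/-- The upper bound `2 lam` controls each packet and the lower bound `lam` the packets of a picked
tree jointly; that the two are comparable is what lets `TreeClass.sum_width_le` close. What is
peeled off are the shadows of the picked trees, whose tops number `O(1 + |j|)`. -/
theorem exists_peels_half (hn : 1 ≤ n) {N : ℕ} (hN : 2 ≤ N) (i : Fin n) (σ : ℤˣ)
    (f : Lp ℂ 2 (volume : Measure ℝ)) {X : Set (MultiTile n)} (hX : X ⊆ S.P1) {lam : ℝ}
    (hlam : 0 < lam) (hsize : S.maxSizeSigned N i σ f X ≤ ENNReal.ofReal (2 * lam)) :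
    ∃ L : List S.Tree, ∃ Y, Peels X L Y ∧ S.maxSizeSigned N i σ f Y ≤ ENNReal.ofReal lam ∧
      totalWidth L ≤ stepConst n N * (‖f‖ ^ 2 / lam ^ 2) := by
  classical
  have hfin : X.Finite := S.P1_finite.subset hX
  have hX0 : X ⊆ S.P0 := hX.trans (Set.sep_subset _ _)
  have hκ := witnessConst_pos
  have hQ0 : 0 ≤ classConst n N * (‖f‖ ^ 2 / lam ^ 2) :=
    mul_nonneg (classConst_nonneg n N) (by positivity)
  set good : S.Tree → Prop := fun T => T.tiles ⊆ X ∧ ENNReal.ofReal lam < T.sizeSigned N i σ f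
    with hgood
  have hW : ∀ T : S.Tree, ∃ c : ℤ × Bool, good T → Nonempty (T.Witness N i σ f lam c.1 c.2) := by
    intro T
    by_cases h : good T
    · obtain ⟨j, b, W⟩ := T.exists_witness hn (hfin.subset h.1) hN i σ f hlam h.2
      exact ⟨(j, b), fun _ => W⟩
    · exact ⟨(0, false), fun h' => absurd h' h⟩
  choose cls hcls using hW
  -- An upper bound for the width of every tree of large size; with slack `1 / R`, the scores are
  -- ordered up to `1 / |I_T|`.
  set R : ℝ := (X.ncard + 1) * ((5 + 5 * C0 n) * ‖f‖) ^ 2 / (witnessConst * lam ^ 2) + 1 with hR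
  have hR0 : 0 < R := by positivity
  have hwidth : ∀ T, good T → (2 : ℝ) ^ T.I.exp ≤ R := by
    intro T hT
    obtain ⟨W⟩ := hcls T hT
    have h := W.sq_mul_width_le hfin hT.1
    refine le_trans ?_ (le_add_of_nonneg_right zero_le_one)
    rw [le_div_iff₀ (by positivity)]
    linarith
  obtain ⟨M, hM⟩ := exists_score_bound hn S i σ
  obtain ⟨Ts, L, Y, hTs, hpair, hpeel, hwL, hrem⟩ := exists_selection good
    (fun T => shadowRadius (cls T).1) (fun T => ((σ : ℤ) : ℝ) * T.ξ i) (δ := 1 / R)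
    (by positivity) hfin hX0 ⟨M, fun T _ => hM T⟩
  refine ⟨L, Y, hpeel, iSup₂_le fun T hT => ?_, hwL.trans ?_⟩
  · by_contra! hlt
    exact hrem T hT ⟨hT.trans hpeel.subset, hlt⟩
  · have hg : ∀ l, good (Ts.get l) := fun l => (hTs _ (List.get_mem Ts l)).1
    rw [List.pairwise_iff_get] at hpair
    set k : Fin Ts.length → ℤ × Bool := fun l => cls (Ts.get l) with hk
    have hclass : ∀ c : ℤ × Bool, ∑ l ∈ Finset.univ.filter (fun l => k l = c),
        (2 : ℝ) ^ (Ts.get l).I.exp ≤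
          classConst n N * (‖f‖ ^ 2 / lam ^ 2) / (1 + |(c.1 : ℝ)|) ^ 16 := by
      intro c
      set s := Finset.univ.filter fun l => k l = c with hs
      -- The trees of a class are enumerated in their order of selection, so the score and shadow
      -- relations are inherited.
      set φ := s.orderEmbOfFin rfl with hφ
      have hmem : ∀ a, cls (Ts.get (φ a)) = c := fun a =>
        (Finset.mem_filter.mp (Finset.orderEmbOfFin_mem s rfl a)).2
      have hWit : ∀ a, Nonempty ((Ts.get (φ a)).Witness N i σ f lam c.1 c.2) := fun a => by
        have := hcls _ (hg (φ a))
        rwa [hmem] at this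
      let C : TreeClass S N i σ f lam c.1 c.2 s.card :=
        { T := fun a => Ts.get (φ a)
          W := fun a => (hWit a).some
          norm_le := fun a x hx => by
            have hnn := tileConst_pos n N
            have h1 := ((hWit a).some).le_eltNorm x
            have h2 := (Ts.get (φ a)).eltNorm_le hn hN i σ f (by positivity) hsize (hg (φ a)).1
              (((hWit a).some).isElt x hx)
            have h3 := h1.trans (mul_le_mul_right h2 _)
            rw [← ENNReal.ofReal_mul (by positivity),
              ENNReal.ofReal_le_ofReal_iff (by positivity)] at h3
            rwa [← mul_assoc] at h3
          score := fun a a' h => by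
            refine (hpair _ _ (φ.strictMono h)).1.trans ?_
            gcongr
            exact hwidth _ (hg (φ a'))
          shadow := fun a a' h P hP => by
            have := (hpair _ _ (φ.strictMono h)).2 P hP
            rwa [hmem] at this }
      have h := C.sum_width_le hn hlam
      refine le_trans (le_of_eq ?_) h
      have e := Finset.sum_map Finset.univ φ.toEmbedding fun l => (2 : ℝ) ^ (Ts.get l).I.exp
      rw [hφ, Finset.map_orderEmbOfFin_univ] at e
      exact e
    have hlist : (Ts.map fun T => 3 * (2 * (shadowRadius (cls T).1 : ℝ) + 1) * T.I.ivl.len).sum =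
        ∑ l, 3 * (2 * (shadowRadius (k l).1 : ℝ) + 1) * (2 : ℝ) ^ (Ts.get l).I.exp :=
      (Fin.sum_univ_fun_getElem Ts _).symm
    rw [hlist, ← Finset.sum_fiberwise_of_maps_to (s := Finset.univ) (t := Finset.univ.image k)
      (fun l _ => Finset.mem_image_of_mem k (Finset.mem_univ l))]
    set Q := classConst n N * (‖f‖ ^ 2 / lam ^ 2) with hQ
    have hone : ∀ c : ℤ × Bool, ∑ l ∈ Finset.univ.filter (fun l => k l = c),
        3 * (2 * (shadowRadius (k l).1 : ℝ) + 1) * (2 : ℝ) ^ (Ts.get l).I.exp ≤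
          24 * Q * ((1 + |(c.1 : ℝ)|) ^ 2)⁻¹ := by
      intro c
      have e : ∑ l ∈ Finset.univ.filter (fun l => k l = c),
          3 * (2 * (shadowRadius (k l).1 : ℝ) + 1) * (2 : ℝ) ^ (Ts.get l).I.exp =
          3 * (2 * (shadowRadius c.1 : ℝ) + 1) *
            ∑ l ∈ Finset.univ.filter (fun l => k l = c), (2 : ℝ) ^ (Ts.get l).I.exp := by
        rw [Finset.mul_sum]
        refine Finset.sum_congr rfl fun l hl => ?_
        rw [(Finset.mem_filter.mp hl).2]
      set w := 1 + |(c.1 : ℝ)| with hw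
      have hw1 : 1 ≤ w := le_add_of_nonneg_right (abs_nonneg _)
      have hrad : 3 * (2 * (shadowRadius c.1 : ℝ) + 1) ≤ 24 * w := by
        rw [shadowRadius_cast, hw]
        linarith [abs_nonneg (c.1 : ℝ)]
      rw [e]
      calc _ ≤ 24 * w * (Q / w ^ 16) := by
            gcongr
            exact hclass c
        _ = 24 * Q * (w ^ 15)⁻¹ := by
            field_simp
        _ ≤ 24 * Q * (w ^ 2)⁻¹ := by
            gcongr
            norm_num
    calc _ ≤ ∑ c ∈ Finset.univ.image k, 24 * Q * ((1 + |(c.1 : ℝ)|) ^ 2)⁻¹ :=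
          Finset.sum_le_sum fun c _ => hone c
      -- Both kinds of packets are allowed for every `j`, which doubles the constant `24` to `48`.
      _ ≤ ∑ c ∈ (Finset.univ.image k).image Prod.fst ×ˢ (Finset.univ : Finset Bool),
          24 * Q * ((1 + |(c.1 : ℝ)|) ^ 2)⁻¹ := by
          refine Finset.sum_le_sum_of_subset_of_nonneg (fun c hc => ?_) fun _ _ _ => by positivity
          exact Finset.mem_product.mpr ⟨Finset.mem_image_of_mem _ hc, Finset.mem_univ _⟩
      _ = 48 * Q * ∑ j ∈ (Finset.univ.image k).image Prod.fst, ((1 + |(j : ℝ)|) ^ 2)⁻¹ := by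
          rw [Finset.sum_product, Finset.mul_sum]
          refine Finset.sum_congr rfl fun j _ => ?_
          simp only [Finset.sum_const, Finset.card_univ, Fintype.card_bool, nsmul_eq_mul]
          push_cast
          ring
      _ ≤ 48 * Q * shellMass := by
          gcongr
          exact summable_shell.sum_le_tsum _ fun _ _ => by positivity
      _ = _ := by
          rw [hQ, stepConst]
          ring

/-- Halving down to the level `2 ^ k lam` costs `4 ^ (-k)` times the cost at the level `lam`, so the
final step dominates. The factor `2 (1 - 4 ^ (-k))` is a form of the partial sums convenient for
induction. -/
theorem exists_peels_of_le (hn : 1 ≤ n) {N : ℕ} (hN : 2 ≤ N) (i : Fin n) (σ : ℤˣ)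
    (f : Lp ℂ 2 (volume : Measure ℝ)) {lam : ℝ} (hlam : 0 < lam) (k : ℕ)
    {X : Set (MultiTile n)} (hX : X ⊆ S.P1)
    (hsize : S.maxSizeSigned N i σ f X ≤ ENNReal.ofReal (2 ^ k * lam)) :
    ∃ L : List S.Tree, ∃ Y, Peels X L Y ∧ S.maxSizeSigned N i σ f Y ≤ ENNReal.ofReal lam ∧
      totalWidth L ≤ 2 * (1 - (4 ^ k)⁻¹) * (stepConst n N * (‖f‖ ^ 2 / lam ^ 2)) := by
  induction k generalizing X with
  | zero => exact ⟨[], X, Peels.nil X, by simpa using hsize, by simp [totalWidth]⟩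
  | succ k ih =>
    rw [pow_succ', mul_assoc] at hsize
    obtain ⟨L, Y, h1, h2, h3⟩ := exists_peels_half hn hN i σ f hX (by positivity) hsize
    obtain ⟨L', Z, h4, h5, h6⟩ := ih (h1.subset.trans hX) h2
    refine ⟨L ++ L', Z, h1.append h4, h5, ?_⟩
    rw [totalWidth_append]
    have hc := stepConst_nonneg n N
    have e : stepConst n N * (‖f‖ ^ 2 / (2 ^ k * lam) ^ 2) =
        (4 ^ k)⁻¹ * (stepConst n N * (‖f‖ ^ 2 / lam ^ 2)) := by
      have : (4 : ℝ) ^ k = (2 ^ k) ^ 2 := by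
        rw [← pow_mul, mul_comm, pow_mul]
        norm_num
      rw [this]
      field_simp
    rw [e] at h3
    have hq : 0 ≤ stepConst n N * (‖f‖ ^ 2 / lam ^ 2) := by positivity
    have h4k : (0 : ℝ) < (4 ^ k)⁻¹ := by positivity
    have e2 : ((4 : ℝ) ^ (k + 1))⁻¹ = (4 ^ k)⁻¹ / 4 := by
      rw [pow_succ, mul_inv]
      ring
    rw [e2]
    nlinarith [mul_nonneg h4k.le hq]

theorem exists_peels_signed (hn : 1 ≤ n) {N : ℕ} (hN : 2 ≤ N) (i : Fin n) (σ : ℤˣ)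
    (f : Lp ℂ 2 (volume : Measure ℝ)) {X : Set (MultiTile n)} (hX : X ⊆ S.P1) {lam : ℝ}
    (hlam : 0 < lam) :
    ∃ L : List S.Tree, ∃ Y, Peels X L Y ∧ S.maxSizeSigned N i σ f Y ≤ ENNReal.ofReal lam ∧
      totalWidth L ≤ 2 * (stepConst n N * (‖f‖ ^ 2 / lam ^ 2)) := by
  obtain ⟨lam₀, h0, hle⟩ := exists_maxSizeSigned_le hn hN i σ f hX
  obtain ⟨k, hk⟩ := pow_unbounded_of_one_lt (lam₀ / lam) (one_lt_two (α := ℝ))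
  rw [div_lt_iff₀ hlam] at hk
  obtain ⟨L, Y, h1, h2, h3⟩ := exists_peels_of_le hn hN i σ f hlam k hX
    (hle.trans (ENNReal.ofReal_le_ofReal hk.le))
  refine ⟨L, Y, h1, h2, h3.trans ?_⟩
  have hc := stepConst_nonneg n N
  gcongr
  have : (0 : ℝ) < (4 ^ k)⁻¹ := by positivity
  linarith

end Setting

/-! ### The size is controlled by the signed sizes -/

theorem riesz_add_riesz (ξ : ℝ) (f : Lp ℂ 2 (volume : Measure ℝ)) :
    riesz 1 ξ f + riesz (-1) ξ f = f := by
  apply fourier_L2_injective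
  rw [FourierTransform.fourier_add]
  have hne : ∀ᵐ η : ℝ, η ≠ ξ := by
    rw [ae_iff]
    simp
  filter_upwards [fourier_multOp _ (memLp_halfLine 1 ξ) f, fourier_multOp _ (memLp_halfLine (-1) ξ) f,
    Lp.coeFn_add (𝓕 (riesz 1 ξ f) : Lp ℂ 2 (volume : Measure ℝ)) (𝓕 (riesz (-1) ξ f)), hne]
    with η e1 e2 e3 hη
  rw [e3, Pi.add_apply]
  unfold riesz
  rw [e1, e2, ← add_mul]
  rcases lt_or_gt_of_ne hη with h | h
  · rw [Set.indicator_of_notMem, Set.indicator_of_mem, zero_add, one_mul] <;>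
      simp [halfLine] <;> linarith
  · rw [Set.indicator_of_mem, Set.indicator_of_notMem, add_zero, one_mul] <;>
      simp [halfLine] <;> linarith

theorem phaseNorm_add_le (N : ℕ) (I ω : Ivl) (ξ : ℝ) (f g : Lp ℂ 2 (volume : Measure ℝ)) :
    phaseNorm N I ω ξ (f + g) ≤ phaseNorm N I ω ξ f + phaseNorm N I ω ξ g := by
  refine iSup₂_le fun m hm => ?_
  have hmeas : AEStronglyMeasurable (fun x => (cutoff I x : ℂ) ^ 10) (volume : Measure ℝ) := by
    have : Measurable (cutoff I) := by
      unfold cutoff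
      fun_prop
    fun_prop
  have e : eLpNorm (fun x => (cutoff I x : ℂ) ^ 10 * multOp m hm.memLp (f + g) x) 2
      (volume : Measure ℝ) = eLpNorm ((fun x => (cutoff I x : ℂ) ^ 10 * multOp m hm.memLp f x) +
        fun x => (cutoff I x : ℂ) ^ 10 * multOp m hm.memLp g x) 2 (volume : Measure ℝ) := by
    apply eLpNorm_congr_ae
    rw [multOp_add]
    filter_upwards [Lp.coeFn_add (multOp m hm.memLp f) (multOp m hm.memLp g)] with x hx
    rw [hx, Pi.add_apply, Pi.add_apply, mul_add]
  rw [e]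
  refine (eLpNorm_add_le (hmeas.mul (Lp.aestronglyMeasurable _))
    (hmeas.mul (Lp.aestronglyMeasurable _)) (by norm_num)).trans ?_
  exact add_le_add (le_iSup₂_of_le m hm le_rfl) (le_iSup₂_of_le m hm le_rfl)

namespace Setting

variable {n : ℕ} {S : Setting n}

theorem Tree.size_le (T : S.Tree) (N : ℕ) (i : Fin n) (f : Lp ℂ 2 (volume : Measure ℝ)) :
    T.size N i f ≤ 2 * (T.sizeSigned N i 1 f + T.sizeSigned N i (-1) f) := by
  unfold sizeSigned size
  set g := riesz 1 (T.ξ i) f with hg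
  set h := riesz (-1) (T.ξ i) f with hh
  have hf : f = g + h := (riesz_add_riesz (T.ξ i) f).symm
  set c := (ENNReal.ofReal T.I.ivl.len)⁻¹ with hc
  set A := ∑' P : T.tiles, tileNorm N (S.tile P i) (T.ξ i) g ^ 2 with hA
  set B := ∑' P : T.tiles, tileNorm N (S.tile P i) (T.ξ i) h ^ 2 with hB
  -- The constant `4` is crude, but its square root is the factor `2` in the conclusion.
  have hsq : ∀ a b : ℝ≥0∞, (a + b) ^ 2 ≤ 4 * (a ^ 2 + b ^ 2) := by
    intro a b
    have key : ∀ a b : ℝ≥0∞, a ≤ b → (a + b) ^ 2 ≤ 4 * (a ^ 2 + b ^ 2) := fun a b hab => by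
      calc (a + b) ^ 2 ≤ (2 * b) ^ 2 := by
            rw [two_mul]
            gcongr
        _ = 4 * b ^ 2 := by rw [mul_pow]; norm_num
        _ ≤ _ := by
            gcongr
            exact le_add_self
    rcases le_total a b with hab | hab
    · exact key a b hab
    · rw [add_comm a, add_comm (a ^ 2)]
      exact key b a hab
  have h1 : ∑' P : T.tiles, tileNorm N (S.tile P i) (T.ξ i) f ^ 2 ≤ 4 * (A + B) := by
    rw [hA, hB, ← ENNReal.tsum_add, ← ENNReal.tsum_mul_left]
    refine ENNReal.tsum_le_tsum fun P => ?_
    refine le_trans ?_ (hsq _ _)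
    gcongr
    rw [hf]
    exact phaseNorm_add_le N _ _ _ g h
  have h2 : (c * ∑' P : T.tiles, tileNorm N (S.tile P i) (T.ξ i) f ^ 2) ^ (1 / 2 : ℝ) ≤
      2 * ((c * A) ^ (1 / 2 : ℝ) + (c * B) ^ (1 / 2 : ℝ)) := by
    calc _ ≤ (4 * (c * A + c * B)) ^ (1 / 2 : ℝ) := by
          refine ENNReal.rpow_le_rpow ?_ (by norm_num)
          calc c * ∑' P : T.tiles, tileNorm N (S.tile P i) (T.ξ i) f ^ 2
              ≤ c * (4 * (A + B)) := mul_le_mul_right h1 _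
            _ = _ := by ring
      _ = 2 * (c * A + c * B) ^ (1 / 2 : ℝ) := by
          rw [ENNReal.mul_rpow_of_nonneg _ _ (by norm_num), show (4 : ℝ≥0∞) = 2 ^ (2 : ℝ) by
            norm_num, ← ENNReal.rpow_mul]
          norm_num
      _ ≤ _ := by
          gcongr
          exact ENNReal.rpow_add_le_add_rpow _ _ (by norm_num) (by norm_num)
  have h3 : phaseNorm N T.I.ivl (S.omegaTop T.ξ T.I i) (T.ξ i) f ≤
      2 * (phaseNorm N T.I.ivl (S.omegaTop T.ξ T.I i) (T.ξ i) g +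
        phaseNorm N T.I.ivl (S.omegaTop T.ξ T.I i) (T.ξ i) h) := by
    conv_lhs => rw [hf]
    refine (phaseNorm_add_le N _ _ _ g h).trans ?_
    exact le_mul_of_one_le_left (by positivity) (by norm_num)
  calc _ ≤ 2 * ((c * A) ^ (1 / 2 : ℝ) + (c * B) ^ (1 / 2 : ℝ)) +
        ENNReal.ofReal T.I.ivl.len ^ (-(1 / 2) : ℝ) *
        (2 * (phaseNorm N T.I.ivl (S.omegaTop T.ξ T.I i) (T.ξ i) g +
        phaseNorm N T.I.ivl (S.omegaTop T.ξ T.I i) (T.ξ i) h)) := by gcongr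
    _ = _ := by ring

theorem maxSizeSigned_mono {N : ℕ} {i : Fin n} {σ : ℤˣ} {f : Lp ℂ 2 (volume : Measure ℝ)}
    {X Y : Set (MultiTile n)} (h : X ⊆ Y) :
    S.maxSizeSigned N i σ f X ≤ S.maxSizeSigned N i σ f Y :=
  iSup₂_le fun T hT => le_iSup₂_of_le T (hT.trans h) le_rfl

theorem maxSize_le (N : ℕ) (i : Fin n) (f : Lp ℂ 2 (volume : Measure ℝ))
    (X : Set (MultiTile n)) : S.maxSize N i f X ≤
      2 * (S.maxSizeSigned N i 1 f X + S.maxSizeSigned N i (-1) f X) := by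
  refine iSup₂_le fun T hT => (T.size_le N i f).trans ?_
  gcongr
  · exact le_iSup₂_of_le T hT le_rfl
  · exact le_iSup₂_of_le T hT le_rfl

/-- The signs are treated in turn; the second removal only shrinks the set, so the first signed size
stays small. The level `lam / 4` absorbs the factor `2` of `maxSize_le` and the two summands, and
the width constant is `2 * 2 * 16 = 64`. -/
theorem exists_peels_unsigned (hn : 1 ≤ n) {N : ℕ} (hN : 2 ≤ N) (i : Fin n)
    (f : Lp ℂ 2 (volume : Measure ℝ)) {X : Set (MultiTile n)} (hX : X ⊆ S.P1) {lam : ℝ}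
    (hlam : 0 < lam) :
    ∃ L : List S.Tree, ∃ Y, Peels X L Y ∧ S.maxSize N i f Y ≤ ENNReal.ofReal lam ∧
      totalWidth L ≤ 64 * (stepConst n N * (‖f‖ ^ 2 / lam ^ 2)) := by
  obtain ⟨L, Y, h1, h2, h3⟩ := exists_peels_signed hn hN i 1 f hX (lam := lam / 4) (by positivity)
  obtain ⟨L', Z, h4, h5, h6⟩ := exists_peels_signed hn hN i (-1) f (h1.subset.trans hX)
    (lam := lam / 4) (by positivity)
  refine ⟨L ++ L', Z, h1.append h4, ?_, ?_⟩
  · refine (maxSize_le N i f Z).trans ?_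
    have h7 := (maxSizeSigned_mono h4.subset).trans h2
    calc 2 * (S.maxSizeSigned N i 1 f Z + S.maxSizeSigned N i (-1) f Z)
        ≤ 2 * (ENNReal.ofReal (lam / 4) + ENNReal.ofReal (lam / 4)) := by gcongr
      _ = ENNReal.ofReal 2 * ENNReal.ofReal (lam / 4 + lam / 4) := by
          rw [ENNReal.ofReal_add (by positivity) (by positivity)]
          norm_num
      _ = ENNReal.ofReal lam := by
          rw [← ENNReal.ofReal_mul (by norm_num)]
          congr 1
          ring
  · rw [totalWidth_append]
    have e : ‖f‖ ^ 2 / (lam / 4) ^ 2 = 16 * (‖f‖ ^ 2 / lam ^ 2) := by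
      field_simp
      norm_num
    rw [e] at h3 h6
    linarith

theorem Peels.treeSelection {X Y : Set (MultiTile n)} {L : List S.Tree} (h : Peels X L Y)
    (hX : S.IsConvexSet X) {size : Set (MultiTile n) → ℝ≥0∞} {A C : ℝ} {m : ℤ}
    (hw : totalWidth L ≤ C * (2 : ℝ) ^ (-m))
    (hs : size Y < ENNReal.ofReal (A * (2 : ℝ) ^ (((m : ℝ) - 1) / 2))) :
    ∃ (r : ℕ) (T : Fin r → S.Tree),
      (∀ l, (T l).IsConvex ∧ (T l).tiles ⊆ X) ∧
      (∀ l l', l ≠ l' → Disjoint (T l).tiles (T l').tiles) ∧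
      ∑ l, (T l).I.ivl.len ≤ C * (2 : ℝ) ^ (-m) ∧
      S.IsConvexSet (X \ ⋃ l, (T l).tiles) ∧
      size (X \ ⋃ l, (T l).tiles) < ENNReal.ofReal (A * (2 : ℝ) ^ (((m : ℝ) - 1) / 2)) := by
  have hY : X \ ⋃ l, (L.get l).tiles = Y := by
    rw [h.eq_diff]
    ext P
    simp only [Set.mem_sdiff, Set.mem_iUnion, not_exists, Set.mem_sep_iff, and_congr_right_iff]
    intro _
    constructor
    · intro h' T hT
      obtain ⟨l, rfl⟩ := List.mem_iff_get.mp hT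
      exact h' l
    · exact fun h' l => h' _ (List.get_mem L l)
  have hconv := h.isConvex hX
  have hdisj := List.pairwise_iff_get.mp h.pairwise_disjoint
  refine ⟨L.length, L.get, fun l => ⟨hconv.2 _ (List.get_mem L l),
    h.tiles_subset _ (List.get_mem L l)⟩, fun l l' hl => ?_, ?_, hY ▸ hconv.1, hY ▸ hs⟩
  · rcases lt_or_gt_of_ne hl with hlt | hlt
    · exact hdisj l l' hlt
    · exact (hdisj l' l hlt).symm
  · exact (Fin.sum_univ_fun_getElem L fun T => T.I.ivl.len).le.trans hw

end Setting

end PhasePlane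
end

/-! ### Conclusion. -/

theorem mainTheorem3 (n : ℕ) (hn : 3 ≤ n) :
    ∃ N₀ : ℕ, ∀ N : ℕ, N₀ ≤ N → ∃ C : ℝ, 0 < C ∧
      ∀ (S : Setting n) (i : Fin n) (f : Lp ℂ 2 (volume : Measure ℝ)) (m : ℤ)
        (Ps : Set (MultiTile n)), S.IsConvexSet Ps →
          S.TreeSelection (S.maxSize N i f) ‖f‖ C m Ps ∧
          ∀ σ : ℤˣ, S.TreeSelection (S.maxSizeSigned N i σ f) ‖f‖ C m Ps := by
  have hn1 : 1 ≤ n := by omega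
  -- Only derivatives of symbols up to second order are needed to obtain kinks, and `2 ≤ N ^ 2` for
  -- `N ≥ 2`.
  refine ⟨2, fun N hN => ?_⟩
  have hc := Setting.stepConst_nonneg n N
  -- `512 = 64 * 8`: the constant of the unsigned selection times the `8` of `hwidth`. The summand
  -- `1` only makes the constant positive.
  refine ⟨512 * Setting.stepConst n N + 1, by positivity, fun S i f m Ps hPs => ?_⟩
  set A := ‖f‖ * (2 : ℝ) ^ (((m : ℝ) - 1) / 2) with hA
  -- Nothing is strictly below zero, so the hypothesis on the size forces `f ≠ 0`. The level `A / 2`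
  -- is then positive and strictly below `A`, and selecting at that level gives the strict
  -- inequality in the conclusion.
  have hpos : ∀ x : ℝ≥0∞, x < ENNReal.ofReal (‖f‖ * (2 : ℝ) ^ ((m : ℝ) / 2)) → 0 < ‖f‖ := by
    intro x hx
    refine lt_of_le_of_ne (norm_nonneg _) fun h0 => ?_
    rw [← h0, zero_mul, ENNReal.ofReal_zero] at hx
    exact absurd hx not_lt_zero
  have hwidth : 0 < ‖f‖ → ‖f‖ ^ 2 / (A / 2) ^ 2 = 8 * (2 : ℝ) ^ (-m) := by
    intro hf
    have h1 : ((2 : ℝ) ^ (((m : ℝ) - 1) / 2)) ^ 2 = 2 ^ m / 2 := by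
      rw [← Real.rpow_natCast, ← Real.rpow_mul (by norm_num)]
      push_cast
      rw [div_mul_cancel₀ _ (by norm_num), Real.rpow_sub_one (by norm_num), Real.rpow_intCast]
    rw [div_pow, hA, mul_pow, h1, zpow_neg]
    field_simp
    norm_num
  have hm : (0 : ℝ) < 2 ^ (-m) := by positivity
  have hlt : 0 < ‖f‖ → ENNReal.ofReal (A / 2) < ENNReal.ofReal A := fun hf => by
    have : 0 < A := by positivity
    exact (ENNReal.ofReal_lt_ofReal_iff this).mpr (by linarith)
  constructor
  · intro hsize
    have hf := hpos _ hsize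
    obtain ⟨L, Y, h1, h2, h3⟩ := Setting.exists_peels_unsigned hn1 hN i f hPs.subset
      (lam := A / 2) (by positivity)
    refine h1.treeSelection hPs (h3.trans ?_) (h2.trans_lt (hlt hf))
    rw [hwidth hf]
    nlinarith
  · intro σ hsize
    have hf := hpos _ hsize
    obtain ⟨L, Y, h1, h2, h3⟩ := Setting.exists_peels_signed hn1 hN i σ f hPs.subset
      (lam := A / 2) (by positivity)
    refine h1.treeSelection hPs (h3.trans ?_) (h2.trans_lt (hlt hf))
    rw [hwidth hf]
    nlinarith [mul_nonneg hc hm.le]
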